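/- For pairs of bits let $\binom{g}{p}\circ\binom{g'}{p'}=\binom{g\vee(p\wedge g')}{p\wedge p'}$. A parallel prefix graph on inputs $z_1,\dots,z_n$ is a finite acyclic graph of two-input gates, each computing $x\circ y$ from its left predecessor $x$ and its right predecessor $y$, with $n$ outputs, the $i$-th of which computes $z_i\circ z_{i-1}\circ\dots\circ z_1$. Its logic circuit arises by replacing every input $z_i$ by a pair of inputs $g_i,p_i$ and every gate by three logic gates that compute $p\wedge g'$, $g\vee(p\wedge g')$ and $p\wedge p'$. The size of a logic circuit is its number of gates. If $g_i$ and $p_i$ both have arrival time $t_i$, the delay of the circuit is the maximum, over all paths from an input to an output, of the arrival time of the input plus the number of gates on the path. Running times refer to random access machine programs (registers and finitely many arrays of natural numbers; constants, addition, truncated subtraction, right shift by one bit, comparison, branching, loops and procedure calls), where for a word length $w\ge 1$ every elementary step that handles numbers of $b$ bits takes time linear in $1+\lfloor b/w\rfloor$. In particular, for $w=1$ addition takes time linear in the number of bits. **Theorem.** Let $\varphi=\frac{1+\sqrt5}{2}$. There are a program and a constant $C$ such that, for all $n\ge 2$ and all arrival times $t_1,\dots,t_n\in\mathbb N_0$,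 the program, given $n$ and $t_1,\dots,t_n$, outputs a parallel prefix graph on $n$ inputs with the following properties. 1. Its logic circuit is an adder: for all $i=1,\dots,n$ it computes the carry bit $c_{i+1}$, where $c_1=0$ and $c_{i+1}=g_i\vee(p_i\wedge c_i)$, and $p_1\wedge\dots\wedge p_i$. 2. The delay of its logic circuit is at most $$\log_\varphi\Big(\sum_{i=1}^n\varphi^{t_i}\Big)+5\log_2\log_2 n+4.5\;\le\;1.441\,\log_2\Big(\sum_{i=1}^n2^{t_i}\Big)+5\log_2\log_2 n+4.5 .$$ 3. If $n\ge 3$, its logic circuit has at most $6n\log_2\log_2 n$ gates. 4. For every word length $w\ge1$, the program runs in time at most $C\big(n(\log_2 n)^2+n\,\tfrac{b}{w}\big)$, where $b$ is the number of bits of $\max_i t_i$. Hence the running time is $O(n\log^2 n)$ whenever every arrival time occupies $O(\log^2 n)$ machine words, in particular if every arrival time fits into one machine word, or, for $w=1$, if the arrival times are polynomially bounded in $n$. -/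

import Mathlib

namespace PrefixAdder

/-! ### Logic circuits -/

/-- The Boolean functions used by the prefix gadget. -/
inductive LogicOp where
  | and
  | or

/-- The Boolean function of a logic gate. -/
def LogicOp.apply : LogicOp → Bool → Bool → Bool
  | .and, a, b => a && b
  | .or, a, b => a || b

/-- A logic circuit with inputs indexed by `ι` and outputs indexed by `ο`: a finite acyclic
directed graph of two-input gates.  A node is an input (`Sum.inl`) or a gate (`Sum.inr`), and
every output is attached to a node. -/
structure LogicCircuit (ι ο : Type) where
  Gate : Type
  finite : Finite Gate
  op : Gate → LogicOp
  fst : Gate → ι ⊕ Gate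
  snd : Gate → ι ⊕ Gate
  acyclic : WellFounded fun a b : Gate => fst b = Sum.inr a ∨ snd b = Sum.inr a
  out : ο → ι ⊕ Gate

namespace LogicCircuit

variable {ι ο : Type}

/-- The size of a circuit is its number of gates. -/
noncomputable def size (C : LogicCircuit ι ο) : ℕ := Nat.card C.Gate

/-- `C.Evals x v b`: on the input values `x`, the node `v` has the value `b`. -/
inductive Evals (C : LogicCircuit ι ο) (x : ι → Bool) : ι ⊕ C.Gate → Bool → Prop
  | input (i : ι) : Evals C x (Sum.inl i) (x i)
  | gate (a : C.Gate) (b c : Bool) :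
      Evals C x (C.fst a) b → Evals C x (C.snd a) c → Evals C x (Sum.inr a) ((C.op a).apply b c)

/-- `C.Path i v d`: there is a directed path from the input `i` to the node `v` on which exactly
`d` gates lie. -/
inductive Path (C : LogicCircuit ι ο) (i : ι) : ι ⊕ C.Gate → ℕ → Prop
  | input : Path C i (Sum.inl i) 0
  | fst (a : C.Gate) (d : ℕ) : Path C i (C.fst a) d → Path C i (Sum.inr a) (d + 1)
  | snd (a : C.Gate) (d : ℕ) : Path C i (C.snd a) d → Path C i (Sum.inr a) (d + 1)

/-- The delay of a path is the arrival time of its input plus its number of gates.  The delay of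
the circuit, which is the maximum delay of a path from an input to an output, is at most `B`. -/
def DelayAtMost (C : LogicCircuit ι ο) (t : ι → ℕ) (B : ℝ) : Prop :=
  ∀ (i : ι) (o : ο) (d : ℕ), C.Path i (C.out o) d → ((t i + d : ℕ) : ℝ) ≤ B

end LogicCircuit

/-! ### Carry bits and prefix adders

Bit positions are numbered from `0`, so position `i` here is position `i + 1` in one-based
numbering. -/

/-- The two components of a pair of a generate signal and a propagate signal. -/
inductive Signal where
  | generate
  | propagate

/-- The carry into position `i`. -/
def carry (g p : ℕ → Bool) : ℕ → Bool
  | 0 => false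
  | i + 1 => g i || (p i && carry g p i)

/-- The conjunction of the propagate signals at the positions below `i`. -/
def allPropagate (p : ℕ → Bool) : ℕ → Bool
  | 0 => true
  | i + 1 => p i && allPropagate p i

/-- Collects generate and propagate signals into one family. -/
def signals (g p : ℕ → Bool) : Signal → ℕ → Bool
  | .generate, i => g i
  | .propagate, i => p i

/-- The circuit computes, for each position `i < n`, the carry out of position `i` and the
conjunction of the propagate signals at the positions `0, …, i`. -/
def LogicCircuit.IsAdder {n : ℕ} (C : LogicCircuit (Signal × Fin n) (Signal × Fin n)) : Prop :=
  ∀ (g p : ℕ → Bool) (i : Fin n),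
    C.Evals (fun x => signals g p x.1 x.2) (C.out (.generate, i)) (carry g p (i + 1)) ∧
    C.Evals (fun x => signals g p x.1 x.2) (C.out (.propagate, i)) (allPropagate p (i + 1))

/-! ### Parallel prefix graphs -/

/-- A graph of prefix gates on the inputs `z_0, …, z_{n-1}`, with its `size` gates listed in a
topological order.  A node is an input (`Sum.inl`) or a gate (`Sum.inr`); every gate has a left
and a right predecessor, and there is one output for each `i < n`. -/
structure PrefixGraph (n : ℕ) where
  size : ℕ
  left : Fin size → Fin n ⊕ Fin size
  right : Fin size → Fin n ⊕ Fin size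
  left_lt : ∀ j k, left j = Sum.inr k → k < j
  right_lt : ∀ j k, right j = Sum.inr k → k < j
  out : Fin n → Fin n ⊕ Fin size

namespace PrefixGraph

variable {n : ℕ}

/-- `G.Word v l`: the node `v` computes the product `z_{l_0} ∘ z_{l_1} ∘ ⋯`, where
`l = [l_0, l_1, …]`. -/
inductive Word (G : PrefixGraph n) : Fin n ⊕ Fin G.size → List (Fin n) → Prop
  | input (i : Fin n) : Word G (Sum.inl i) [i]
  | gate (j : Fin G.size) (l r : List (Fin n)) :
      Word G (G.left j) l → Word G (G.right j) r → Word G (Sum.inr j) (l ++ r)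

/-- A parallel prefix graph: for each `i`, output `i` computes `z_i ∘ z_{i-1} ∘ ⋯ ∘ z_0`. -/
def IsParallelPrefix (G : PrefixGraph n) : Prop :=
  ∀ i : Fin n, G.Word (G.out i) ((List.finRange n).take (i + 1)).reverse

/-- The three logic gates of the gadget that computes
`(g, p) ∘ (g', p') = (g ∨ (p ∧ g'), p ∧ p')`. -/
inductive GadgetGate where
  /-- `p ∧ g'` -/
  | inner
  /-- `g ∨ (p ∧ g')` -/
  | generate
  /-- `p ∧ p'` -/
  | propagate
  deriving DecidableEq

instance : Fintype GadgetGate where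
  elems := {.inner, .generate, .propagate}
  complete a := by cases a <;> simp

/-- The node of the logic circuit that carries the signal `s` of the node `v`. -/
def signalNode (G : PrefixGraph n) (s : Signal) :
    Fin n ⊕ Fin G.size → (Signal × Fin n) ⊕ (Fin G.size × GadgetGate)
  | .inl i => .inl (s, i)
  | .inr j => .inr (j, match s with
      | .generate => .generate
      | .propagate => .propagate)

def gateOp : GadgetGate → LogicOp
  | .inner => .and
  | .generate => .or
  | .propagate => .and

def gateFst (G : PrefixGraph n) :
    Fin G.size × GadgetGate → (Signal × Fin n) ⊕ (Fin G.size × GadgetGate)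
  | (j, .inner) => G.signalNode .propagate (G.left j)
  | (j, .generate) => G.signalNode .generate (G.left j)
  | (j, .propagate) => G.signalNode .propagate (G.left j)

def gateSnd (G : PrefixGraph n) :
    Fin G.size × GadgetGate → (Signal × Fin n) ⊕ (Fin G.size × GadgetGate)
  | (j, .inner) => G.signalNode .generate (G.right j)
  | (j, .generate) => .inr (j, .inner)
  | (j, .propagate) => G.signalNode .propagate (G.right j)

def gateRank (G : PrefixGraph n) : Fin G.size × GadgetGate → ℕ
  | (j, .inner) => 2 * j
  | (j, .generate) => 2 * j + 1
  | (j, .propagate) => 2 * j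

theorem le_gateRank (G : PrefixGraph n) (b : Fin G.size × GadgetGate) :
    2 * (b.1 : ℕ) ≤ G.gateRank b ∧ G.gateRank b ≤ 2 * (b.1 : ℕ) + 1 := by
  rcases b with ⟨j, _ | _ | _⟩ <;> simp [gateRank]

theorem signalNode_eq_inr {G : PrefixGraph n} {s : Signal} {v : Fin n ⊕ Fin G.size}
    {a : Fin G.size × GadgetGate} (h : G.signalNode s v = Sum.inr a) : v = Sum.inr a.1 := by
  rcases v with i | j
  · simp [signalNode] at h
  · simp only [signalNode, Sum.inr.injEq] at h
    rw [← h]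

theorem gateRank_lt (G : PrefixGraph n) (a b : Fin G.size × GadgetGate)
    (h : G.gateFst b = Sum.inr a ∨ G.gateSnd b = Sum.inr a) : G.gateRank a < G.gateRank b := by
  have key : (G.left b.1 = Sum.inr a.1 ∨ G.right b.1 = Sum.inr a.1) →
      G.gateRank a < G.gateRank b := by
    intro h
    have hlt : (a.1 : ℕ) < b.1 := by
      rcases h with h | h
      · exact G.left_lt _ _ h
      · exact G.right_lt _ _ h
    have h1 := G.le_gateRank a
    have h2 := G.le_gateRank b
    omega
  rcases b with ⟨j, _ | _ | _⟩ <;> rcases h with h | h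
  · exact key (Or.inl (signalNode_eq_inr h))
  · exact key (Or.inr (signalNode_eq_inr h))
  · exact key (Or.inl (signalNode_eq_inr h))
  · simp only [gateSnd, Sum.inr.injEq] at h
    subst h
    simp [gateRank]
  · exact key (Or.inl (signalNode_eq_inr h))
  · exact key (Or.inr (signalNode_eq_inr h))

/-- The underlying logic circuit: every prefix gate is replaced by its three-gate gadget, and
every input and output is replaced by a pair of a generate and a propagate signal. -/
def toCircuit (G : PrefixGraph n) : LogicCircuit (Signal × Fin n) (Signal × Fin n) where
  Gate := Fin G.size × GadgetGate
  finite := inferInstance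
  op a := gateOp a.2
  fst := G.gateFst
  snd := G.gateSnd
  acyclic := Subrelation.wf (fun {a b} h => G.gateRank_lt a b h) (measure G.gateRank).wf
  out x := G.signalNode x.1 (G.out x.2)

end PrefixGraph

/-! ### A random access machine -/

/-- A machine state: registers, and arrays of natural numbers (first the name of the array, then
the index of the entry). -/
structure State where
  reg : ℕ → ℕ
  arr : ℕ → ℕ → ℕ

def State.setReg (σ : State) (x v : ℕ) : State :=
  { σ with reg := Function.update σ.reg x v }

def State.setArr (σ : State) (a i v : ℕ) : State :=
  { σ with arr := Function.update σ.arr a (Function.update (σ.arr a) i v) }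

/-- Expressions; `sub` is truncated subtraction and `half` is the right shift by one bit. -/
inductive Expr where
  | const (c : ℕ)
  | reg (x : ℕ)
  | arr (a : ℕ) (i : Expr)
  | add (e f : Expr)
  | sub (e f : Expr)
  | half (e : Expr)

def Expr.eval (σ : State) : Expr → ℕ
  | .const c => c
  | .reg x => σ.reg x
  | .arr a i => σ.arr a (i.eval σ)
  | .add e f => e.eval σ + f.eval σ
  | .sub e f => e.eval σ - f.eval σ
  | .half e => e.eval σ / 2

/-- The cost of handling the number `v` with machine words of `w` bits: it is linear in the number
of words that `v` occupies.  For `w = 1` it is linear in the number of bits of `v`. -/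
def wordCost (w v : ℕ) : ℕ := 1 + v.size / w

/-- The cost of evaluating an expression: all constants, operands, addresses and intermediate
results are charged. -/
def Expr.cost (w : ℕ) (σ : State) : Expr → ℕ
  | .const c => wordCost w c
  | .reg x => wordCost w (σ.reg x)
  | .arr a i => i.cost w σ + wordCost w (σ.arr a (i.eval σ))
  | .add e f => e.cost w σ + f.cost w σ + wordCost w (e.eval σ + f.eval σ)
  | .sub e f => e.cost w σ + f.cost w σ + wordCost w (e.eval σ - f.eval σ)
  | .half e => e.cost w σ + wordCost w (e.eval σ / 2)

/-- Commands.  `ite e f c d` and `loop e f c` test whether `e < f`; `call k` calls the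
parameterless procedure number `k`. -/
inductive Cmd where
  | skip
  | assign (x : ℕ) (e : Expr)
  | store (a : ℕ) (i e : Expr)
  | seq (c d : Cmd)
  | ite (e f : Expr) (c d : Cmd)
  | loop (e f : Expr) (c : Cmd)
  | call (k : ℕ)

/-- A program: a main command and finitely many, possibly recursive, procedures. -/
structure Program where
  main : Cmd
  procs : List Cmd

/-- `Exec w procs c σ σ' T`: with word length `w`, the command `c`, started in the state `σ`,
terminates in the state `σ'` with running time `T`. -/
inductive Exec (w : ℕ) (procs : List Cmd) : Cmd → State → State → ℕ → Prop
  | skip (σ : State) : Exec w procs .skip σ σ 1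
  | assign (σ : State) (x : ℕ) (e : Expr) :
      Exec w procs (.assign x e) σ (σ.setReg x (e.eval σ)) (1 + e.cost w σ)
  | store (σ : State) (a : ℕ) (i e : Expr) :
      Exec w procs (.store a i e) σ (σ.setArr a (i.eval σ) (e.eval σ))
        (1 + i.cost w σ + e.cost w σ)
  | seq (σ₁ σ₂ σ₃ : State) (c d : Cmd) (T₁ T₂ : ℕ) :
      Exec w procs c σ₁ σ₂ T₁ → Exec w procs d σ₂ σ₃ T₂ →
      Exec w procs (.seq c d) σ₁ σ₃ (T₁ + T₂)
  | ite_true (σ σ' : State) (e f : Expr) (c d : Cmd) (T : ℕ) :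
      e.eval σ < f.eval σ → Exec w procs c σ σ' T →
      Exec w procs (.ite e f c d) σ σ' (1 + e.cost w σ + f.cost w σ + T)
  | ite_false (σ σ' : State) (e f : Expr) (c d : Cmd) (T : ℕ) :
      ¬ e.eval σ < f.eval σ → Exec w procs d σ σ' T →
      Exec w procs (.ite e f c d) σ σ' (1 + e.cost w σ + f.cost w σ + T)
  | loop_true (σ₁ σ₂ σ₃ : State) (e f : Expr) (c : Cmd) (T₁ T₂ : ℕ) :
      e.eval σ₁ < f.eval σ₁ → Exec w procs c σ₁ σ₂ T₁ →
      Exec w procs (.loop e f c) σ₂ σ₃ T₂ →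
      Exec w procs (.loop e f c) σ₁ σ₃ (1 + e.cost w σ₁ + f.cost w σ₁ + T₁ + T₂)
  | loop_false (σ : State) (e f : Expr) (c : Cmd) :
      ¬ e.eval σ < f.eval σ →
      Exec w procs (.loop e f c) σ σ (1 + e.cost w σ + f.cost w σ)
  | call (σ σ' : State) (k : ℕ) (c : Cmd) (T : ℕ) :
      procs[k]? = some c → Exec w procs c σ σ' T →
      Exec w procs (.call k) σ σ' (1 + T)

/-- `P.Runs w σ σ' T`: with word length `w`, the program `P`, started in the state `σ`,
terminates in the state `σ'` with running time `T`. -/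
def Program.Runs (P : Program) (w : ℕ) (σ σ' : State) (T : ℕ) : Prop :=
  Exec w P.procs P.main σ σ' T

/-- The initial state for the arrival times `t`: register `0` holds `n`, array `0` holds
`t 0, …, t (n - 1)`, and everything else is `0`. -/
def inputState {n : ℕ} (t : Fin n → ℕ) : State where
  reg x := if x = 0 then n else 0
  arr a i := if h : a = 0 ∧ i < n then t ⟨i, h.2⟩ else 0

/-- The number of a node: the inputs come first, then the gates. -/
def nodeCode {n m : ℕ} : Fin n ⊕ Fin m → ℕ
  | .inl i => i
  | .inr j => n + j

/-- The state `σ` holds the graph `G`: register `0` holds the number of gates, arrays `1` and `2`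
the left and right predecessors of the gates, and array `3` the nodes of the outputs. -/
def State.Holds {n : ℕ} (σ : State) (G : PrefixGraph n) : Prop :=
  σ.reg 0 = G.size ∧
  (∀ j : Fin G.size, σ.arr 1 j = nodeCode (G.left j)) ∧
  (∀ j : Fin G.size, σ.arr 2 j = nodeCode (G.right j)) ∧
  (∀ i : Fin n, σ.arr 3 i = nodeCode (G.out i))

end PrefixAdder

/-!
The program builds a prefix graph by recursion on square roots, and the delay is bounded by a
potential argument with powers of the golden ratio `φ`.

*Levels.*  In the three-gate gadget, the right generate signal and the left propagate signal pass
two gates, and the left generate signal passes one.  So each node gets one number, its level: the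
level of a gate is `max (a + 1) (b + 2)`, where `a` and `b` are the levels of its left and right
predecessors, and the signals of a node of level `a` arrive by time `a + 1` (`Computes.delay`).  As
`φ ^ (c + 2) = φ ^ (c + 1) + φ ^ c`, a tree of such gates whose leaves have the levels `a_i` should
have level about `log_φ W`, where `W = ∑ φ ^ a_i` is the weight of the leaves.

*One product.*  A greedy procedure with a stack reaches level `log_φ W + 3` (`groupProduct_spec`).
The leaves are pushed one after the other, and before a leaf is pushed, the topmost stack nodes are
merged until the levels on the stack grow in steps of at least two from the top to the bottom.  The
potential `∑ φ ^ c` over the levels `c` on the stack grows by at most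
`φ ^ a + φ ^ (a + 1) = φ ^ (a + 2)` for a leaf of level `a` (`golden_merge`), and in the end the
stack collapses onto its lowest node at the cost of one more level.

*All prefixes.*  The `m` nodes are split into `q ≤ √m` groups of `√m + 1` nodes and a last group.
The products of the groups are built greedily, which multiplies the weight by at most `φ ^ 3`; the
prefix products of these `q` products and the prefix products inside each group are computed
recursively; and one gate per node combines the two.  By induction, all prefix products have level
at most `log_φ W + 5 log₂ log₂ m + 2` (`split_spec`): for the sequence of group products, the
iterated logarithm drops by one, and the five levels that are gained pay for `φ ^ 3` and for the
two levels of the combining gate.  Few nodes are treated by a chain (`chain_level_le`).  The number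
of gates satisfies the same recursion, with linear overhead, and is at most `2 m log₂ log₂ m`
(`gates_le`).

*Truncation.*  Before that, a number `θ` is subtracted from all arrival times, such that the
remaining times are at most twice the number of bits of `n`.  The times that are cut off at `0`
have together at most the weight of the latest input, so this at most doubles the weight and costs
at most `log_φ 2 < 3 / 2` (`logb_truncated_weight_le`).  With the constant `2` of the recursion and
the `1` of the generate signals, this gives the constant `4.5`.

*Running time.*  `Spec` counts steps of a command that handle numbers of bounded size,
independently of the word length.  The truncation takes linearly many steps with numbers of the
size of the arrival times, and the recursion takes `O(n log n)` steps with numbers of at most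
`8 n²`, hence of `O(log n)` bits (`running_time_le`).
-/

namespace PrefixAdder

/-! ### Reasoning about programs of the random access machine -/

theorem one_le_wordCost (w v : ℕ) : 1 ≤ wordCost w v := Nat.le_add_right _ _

theorem wordCost_mono (w : ℕ) {v v' : ℕ} (h : v ≤ v') : wordCost w v ≤ wordCost w v' :=
  Nat.add_le_add_left (Nat.div_le_div_right (Nat.size_le_size h)) 1

/-- All numbers that occur while `e` is evaluated in the state `σ` are at most `M`. -/
def Expr.Small (M : ℕ) (σ : State) : Expr → Prop
  | .const c => c ≤ M
  | .reg x => σ.reg x ≤ M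
  | .arr a i => i.Small M σ ∧ σ.arr a (i.eval σ) ≤ M
  | .add e f => e.Small M σ ∧ f.Small M σ ∧ e.eval σ + f.eval σ ≤ M
  | .sub e f => e.Small M σ ∧ f.Small M σ
  | .half e => e.Small M σ

/-- The number of nodes of an expression, that is, of the numbers that are charged when it is
evaluated. -/
def Expr.nodes : Expr → ℕ
  | .const _ => 1
  | .reg _ => 1
  | .arr _ i => i.nodes + 1
  | .add e f => e.nodes + f.nodes + 1
  | .sub e f => e.nodes + f.nodes + 1
  | .half e => e.nodes + 1

theorem Expr.Small.eval_le {M : ℕ} {σ : State} : ∀ {e : Expr}, e.Small M σ → e.eval σ ≤ M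
  | .const _, h => h
  | .reg _, h => h
  | .arr _ _, h => h.2
  | .add _ _, h => h.2.2
  | .sub _ _, h => (Nat.sub_le _ _).trans (Expr.Small.eval_le h.1)
  | .half _, h => (Nat.div_le_self _ _).trans (Expr.Small.eval_le h)

theorem Expr.Small.cost_le {M w : ℕ} {σ : State} :
    ∀ {e : Expr}, e.Small M σ → e.cost w σ ≤ e.nodes * wordCost w M
  | .const c, h => by
    simpa [Expr.cost, Expr.nodes] using wordCost_mono w h
  | .reg x, h => by
    simpa [Expr.cost, Expr.nodes] using wordCost_mono w h
  | .arr a i, h => by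
    have h1 := Expr.Small.cost_le (w := w) h.1
    have h2 := wordCost_mono w h.2
    simp only [Expr.cost, Expr.nodes, add_mul, one_mul]
    omega
  | .add e f, h => by
    have h1 := Expr.Small.cost_le (w := w) h.1
    have h2 := Expr.Small.cost_le (w := w) h.2.1
    have h3 := wordCost_mono w h.2.2
    simp only [Expr.cost, Expr.nodes, add_mul, one_mul]
    omega
  | .sub e f, h => by
    have h1 := Expr.Small.cost_le (w := w) h.1
    have h2 := Expr.Small.cost_le (w := w) h.2
    have h3 := wordCost_mono w (Expr.Small.eval_le (e := .sub e f) h)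
    simp only [Expr.cost, Expr.nodes, add_mul, one_mul, Expr.eval] at h3 ⊢
    omega
  | .half e, h => by
    have h1 := Expr.Small.cost_le (w := w) (e := e) h
    have h3 := wordCost_mono w (Expr.Small.eval_le (e := .half e) h)
    simp only [Expr.cost, Expr.nodes, add_mul, one_mul, Expr.eval] at h3 ⊢
    omega

/-- `Spec procs M c σ Q`: started in the state `σ`, the command `c` terminates in a state `σ'`
that does not depend on the word length `w`, in time at most `u * wordCost w M` for some `u`
such that `Q σ' u` holds.  So `u` counts steps that handle numbers of at most `M`. -/
def Spec (procs : List Cmd) (M : ℕ) (c : Cmd) (σ : State) (Q : State → ℕ → Prop) : Prop :=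
  ∃ σ' u, Q σ' u ∧ ∀ w, 1 ≤ w → ∃ T, T ≤ u * wordCost w M ∧ Exec w procs c σ σ' T

namespace Spec

variable {procs : List Cmd} {M : ℕ} {c d : Cmd} {e f : Expr} {σ : State} {Q R : State → ℕ → Prop}

theorem mono (h : Spec procs M c σ Q) (hQ : ∀ σ' u, Q σ' u → R σ' u) : Spec procs M c σ R := by
  obtain ⟨σ', u, h1, h2⟩ := h
  exact ⟨σ', u, hQ _ _ h1, h2⟩

theorem seq (h : Spec procs M c σ fun σ' u => Spec procs M d σ' fun σ'' v => Q σ'' (u + v)) :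
    Spec procs M (.seq c d) σ Q := by
  obtain ⟨σ', u, ⟨σ'', v, h1, h2⟩, h3⟩ := h
  refine ⟨σ'', u + v, h1, fun w hw => ?_⟩
  obtain ⟨T, hT, hc⟩ := h3 w hw
  obtain ⟨T', hT', hd⟩ := h2 w hw
  exact ⟨T + T', by rw [add_mul]; omega, .seq _ _ _ _ _ _ _ hc hd⟩

theorem call {k : ℕ} (hk : procs[k]? = some c) (h : Spec procs M c σ fun σ' u => Q σ' (u + 1)) :
    Spec procs M (.call k) σ Q := by
  obtain ⟨σ', u, h1, h2⟩ := h
  refine ⟨σ', u + 1, h1, fun w hw => ?_⟩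
  obtain ⟨T, hT, hc⟩ := h2 w hw
  have := one_le_wordCost w M
  exact ⟨1 + T, by rw [add_mul]; omega, .call _ _ _ _ _ hk hc⟩

theorem ite (he : e.Small M σ) (hf : f.Small M σ)
    (h1 : e.eval σ < f.eval σ → Spec procs M c σ fun σ' u => Q σ' (u + (1 + e.nodes + f.nodes)))
    (h2 : ¬ e.eval σ < f.eval σ →
      Spec procs M d σ fun σ' u => Q σ' (u + (1 + e.nodes + f.nodes))) :
    Spec procs M (.ite e f c d) σ Q := by
  have key (w : ℕ) : 1 + e.cost w σ + f.cost w σ ≤ (1 + e.nodes + f.nodes) * wordCost w M := by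
    have := one_le_wordCost w M
    have := he.cost_le (w := w)
    have := hf.cost_le (w := w)
    simp only [add_mul, one_mul]
    omega
  by_cases hlt : e.eval σ < f.eval σ
  · obtain ⟨σ', u, h3, h4⟩ := h1 hlt
    refine ⟨σ', _, h3, fun w hw => ?_⟩
    obtain ⟨T, hT, hc⟩ := h4 w hw
    have := key w
    exact ⟨_, by rw [add_mul]; omega, .ite_true _ _ _ _ _ _ _ hlt hc⟩
  · obtain ⟨σ', u, h3, h4⟩ := h2 hlt
    refine ⟨σ', _, h3, fun w hw => ?_⟩
    obtain ⟨T, hT, hc⟩ := h4 w hw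
    have := key w
    exact ⟨_, by rw [add_mul]; omega, .ite_false _ _ _ _ _ _ _ hlt hc⟩

/-- The loop rule: `I σ u` is an invariant in which `u` is the number of steps made so far, and
`μ` is a termination measure. -/
theorem loop (I : State → ℕ → Prop) (μ : State → ℕ)
    (hI : ∀ σ u, I σ u → e.Small M σ ∧ f.Small M σ ∧
      (e.eval σ < f.eval σ → Spec procs M c σ fun σ' v =>
        I σ' (u + (1 + e.nodes + f.nodes) + v) ∧ μ σ' < μ σ) ∧
      (¬ e.eval σ < f.eval σ → Q σ (u + (1 + e.nodes + f.nodes))))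
    (h : I σ 0) : Spec procs M (.loop e f c) σ Q := by
  have main : ∀ k σ u, μ σ = k → I σ u →
      Spec procs M (.loop e f c) σ fun σ' v => Q σ' (u + v) := by
    intro k
    induction k using Nat.strong_induction_on with
    | _ k ih =>
      intro σ u hμ hσ
      obtain ⟨he, hf, hstep, hdone⟩ := hI σ u hσ
      have key (w : ℕ) :
          1 + e.cost w σ + f.cost w σ ≤ (1 + e.nodes + f.nodes) * wordCost w M := by
        have := one_le_wordCost w M
        have := he.cost_le (w := w)
        have := hf.cost_le (w := w)
        simp only [add_mul, one_mul]
        omega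
      by_cases hlt : e.eval σ < f.eval σ
      · obtain ⟨σ', v, ⟨h1, h2⟩, h3⟩ := hstep hlt
        obtain ⟨σ'', v', h4, h5⟩ := ih _ (hμ ▸ h2) σ' _ rfl h1
        refine ⟨σ'', (1 + e.nodes + f.nodes) + v + v', by simpa [add_assoc] using h4,
          fun w hw => ?_⟩
        obtain ⟨T, hT, hc⟩ := h3 w hw
        obtain ⟨T', hT', hc'⟩ := h5 w hw
        have := key w
        exact ⟨_, by rw [add_mul, add_mul]; omega, .loop_true _ _ _ _ _ _ _ _ hlt hc hc'⟩
      · exact ⟨σ, _, hdone hlt, fun w _ => ⟨_, key w, .loop_false _ _ _ _ hlt⟩⟩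
  simpa using main _ σ 0 rfl h

end Spec

/-- A bound on the number of steps of a command without loops and calls (with the junk value `0` for
the others, whose `Cmd.wp` is `False`); both branches of a conditional are counted. -/
def Cmd.steps : Cmd → ℕ
  | .skip => 1
  | .assign _ e => 1 + e.nodes
  | .store _ i e => 1 + i.nodes + e.nodes
  | .seq c d => c.steps + d.steps
  | .ite e f c d => 1 + e.nodes + f.nodes + (c.steps + d.steps)
  | .loop _ _ _ => 0
  | .call _ => 0

/-- The weakest precondition of a command without loops and calls that handles only numbers of at
most `M`. -/
def Cmd.wp (M : ℕ) : Cmd → State → (State → Prop) → Prop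
  | .skip, σ, Q => Q σ
  | .assign x e, σ, Q => e.Small M σ ∧ Q (σ.setReg x (e.eval σ))
  | .store a i e, σ, Q => i.Small M σ ∧ e.Small M σ ∧ Q (σ.setArr a (i.eval σ) (e.eval σ))
  | .seq c d, σ, Q => c.wp M σ fun σ' => d.wp M σ' Q
  | .ite e f c d, σ, Q => e.Small M σ ∧ f.Small M σ ∧
      (e.eval σ < f.eval σ → c.wp M σ Q) ∧ (¬ e.eval σ < f.eval σ → d.wp M σ Q)
  | .loop _ _ _, _, _ => False
  | .call _, _, _ => False

theorem Cmd.wp_sound {procs : List Cmd} {M : ℕ} (c : Cmd) (σ : State) (Q : State → Prop)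
    (h : c.wp M σ Q) : ∃ σ', Q σ' ∧
      ∀ w, 1 ≤ w → ∃ T, T ≤ c.steps * wordCost w M ∧ Exec w procs c σ σ' T := by
  induction c generalizing σ Q with
  | skip => exact ⟨σ, h, fun w _ => ⟨1, by simp [steps, one_le_wordCost], .skip σ⟩⟩
  | assign x e =>
    refine ⟨_, h.2, fun w _ => ⟨_, ?_, .assign σ x e⟩⟩
    have := one_le_wordCost w M
    have := h.1.cost_le (w := w)
    simp only [steps, add_mul, one_mul]
    omega
  | store a i e =>
    refine ⟨_, h.2.2, fun w _ => ⟨_, ?_, .store σ a i e⟩⟩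
    have := one_le_wordCost w M
    have := h.1.cost_le (w := w)
    have := h.2.1.cost_le (w := w)
    simp only [steps, add_mul, one_mul]
    omega
  | seq c d ihc ihd =>
    obtain ⟨σ', h1, h2⟩ := ihc σ _ h
    obtain ⟨σ'', h3, h4⟩ := ihd σ' _ h1
    refine ⟨σ'', h3, fun w hw => ?_⟩
    obtain ⟨T, hT, hc⟩ := h2 w hw
    obtain ⟨T', hT', hd⟩ := h4 w hw
    exact ⟨T + T', by simp only [steps, add_mul]; omega, .seq _ _ _ _ _ _ _ hc hd⟩
  | ite e f c d ihc ihd =>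
    obtain ⟨he, hf, h1, h2⟩ := h
    have key (w : ℕ) : 1 + e.cost w σ + f.cost w σ ≤ (1 + e.nodes + f.nodes) * wordCost w M := by
      have := one_le_wordCost w M
      have := he.cost_le (w := w)
      have := hf.cost_le (w := w)
      simp only [add_mul, one_mul]
      omega
    by_cases hlt : e.eval σ < f.eval σ
    · obtain ⟨σ', h3, h4⟩ := ihc σ _ (h1 hlt)
      refine ⟨σ', h3, fun w hw => ?_⟩
      obtain ⟨T, hT, hc⟩ := h4 w hw
      have := key w
      exact ⟨_, by simp only [steps, add_mul] at *; omega, .ite_true _ _ _ _ _ _ _ hlt hc⟩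
    · obtain ⟨σ', h3, h4⟩ := ihd σ _ (h2 hlt)
      refine ⟨σ', h3, fun w hw => ?_⟩
      obtain ⟨T, hT, hc⟩ := h4 w hw
      have := key w
      exact ⟨_, by simp only [steps, add_mul] at *; omega, .ite_false _ _ _ _ _ _ _ hlt hc⟩
  | loop e f c _ => exact h.elim
  | call k => exact h.elim

theorem Spec.straight {procs : List Cmd} {M : ℕ} {c : Cmd} {σ : State} {Q : State → ℕ → Prop}
    (h : c.wp M σ fun σ' => Q σ' c.steps) : Spec procs M c σ Q := by
  obtain ⟨σ', h1, h2⟩ := Cmd.wp_sound (procs := procs) c σ _ h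
  exact ⟨σ', _, h1, h2⟩

/-- Sequential composition of a list of commands. -/
def block : List Cmd → Cmd
  | [] => .skip
  | [c] => c
  | c :: d :: l => .seq c (block (d :: l))

@[simp] theorem State.reg_setReg (σ : State) (x v y : ℕ) :
    (σ.setReg x v).reg y = if y = x then v else σ.reg y := by
  simp [State.setReg, Function.update_apply]

@[simp] theorem State.arr_setReg (σ : State) (x v : ℕ) : (σ.setReg x v).arr = σ.arr := rfl

@[simp] theorem State.reg_setArr (σ : State) (a i v : ℕ) : (σ.setArr a i v).reg = σ.reg := rfl

@[simp] theorem State.arr_setArr (σ : State) (a i v b : ℕ) :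
    (σ.setArr a i v).arr b = if b = a then Function.update (σ.arr a) i v else σ.arr b := by
  simp [State.setArr, Function.update_apply]

/-! ### Products computed by a list of gates -/

/-- `Computes n τ L R k v i j a`: in the graph with `n` inputs and the gates `0, …, k - 1`, whose
left and right predecessors are given by `L` and `R`, the node number `v` computes the product
`z_{j-1} ∘ ⋯ ∘ z_i` at level at most `a`.  The level of the input `i` is `τ i`, and the level of a
gate with a left predecessor of level `a` and a right predecessor of level `b` is the maximum of
`a + 1` and `b + 2`.  A node of level `a` has its propagate signal by time `a` and its generate
signal by time `a + 1`: in the gadget, two gates follow the right generate signal and the left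
propagate signal, but only one gate follows the left generate signal. -/
inductive Computes (n : ℕ) (τ L R : ℕ → ℕ) (k : ℕ) : ℕ → ℕ → ℕ → ℝ → Prop
  | input (i : ℕ) (a : ℝ) : i < n → (τ i : ℝ) ≤ a → Computes n τ L R k i i (i + 1) a
  | gate (x i h j : ℕ) (a : ℝ) : x < k → Computes n τ L R k (L x) h j (a - 1) →
      Computes n τ L R k (R x) i h (a - 2) → Computes n τ L R k (n + x) i j a

namespace Computes

variable {n : ℕ} {τ L R : ℕ → ℕ} {k v i j : ℕ} {a : ℝ}

theorem mono {b : ℝ} (hv : Computes n τ L R k v i j a) (hab : a ≤ b) :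
    Computes n τ L R k v i j b := by
  induction hv generalizing b with
  | input i a hi ha => exact .input i b hi (ha.trans hab)
  | gate x i h j a hx _ _ ihl ihr =>
    exact .gate x i h j b hx (ihl (by linarith)) (ihr (by linarith))

/-- New gates do not change what the old nodes compute. -/
theorem extend {L' R' : ℕ → ℕ} {k' : ℕ} (hv : Computes n τ L R k v i j a) (hk : k ≤ k')
    (hL : ∀ x < k, L' x = L x) (hR : ∀ x < k, R' x = R x) : Computes n τ L' R' k' v i j a := by
  induction hv with
  | input i a hi ha => exact .input i a hi ha
  | gate x i h j a hx _ _ ihl ihr =>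
    exact .gate x i h j a (hx.trans_le hk) (hL x hx ▸ ihl) (hR x hx ▸ ihr)

theorem lt (hv : Computes n τ L R k v i j a) : v < n + k := by
  cases hv <;> omega

theorem bounds (hv : Computes n τ L R k v i j a) : i < j ∧ j ≤ n := by
  induction hv <;> omega

/-- Appending a gate. -/
theorem append {u h : ℕ} (hv : Computes n τ L R k v h j (a - 1))
    (hu : Computes n τ L R k u i h (a - 2)) :
    Computes n τ (Function.update L k v) (Function.update R k u) (k + 1) (n + k) i j a := by
  have ext {v i j a} (hv : Computes n τ L R k v i j a) :
      Computes n τ (Function.update L k v) (Function.update R k u) (k + 1) v i j a :=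
    hv.extend (by omega) (fun x hx => by simp [hx.ne])
      (fun x hx => by simp [hx.ne])
  refine .gate k i h j a (by omega) ?_ ?_
  · simpa using hv.extend (by omega) (fun x hx => by simp [hx.ne])
      (fun x hx => by simp [hx.ne])
  · simpa using hu.extend (by omega) (fun x hx => by simp [hx.ne])
      (fun x hx => by simp [hx.ne])

end Computes

/-- The word `z_{j-1} ∘ ⋯ ∘ z_i`. -/
def segWord (n i j : ℕ) : List (Fin n) := (((List.finRange n).take j).drop i).reverse

theorem segWord_append {n i h j : ℕ} (h1 : i ≤ h) (h2 : h ≤ j) :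
    segWord n h j ++ segWord n i h = segWord n i j := by
  simp only [segWord, ← List.reverse_append]
  congr 1
  have e : ((List.finRange n).take h).drop i =
      (((List.finRange n).take j).drop i).take (h - i) := by
    rw [List.drop_take, List.drop_take, List.take_take]
    congr 1
    omega
  have e' : ((List.finRange n).take j).drop h
      = (((List.finRange n).take j).drop i).drop (h - i) := by
    rw [List.drop_drop]
    congr 1
    omega
  rw [e, e', List.take_append_drop]

theorem segWord_succ {n i : ℕ} (hi : i < n) : segWord n i (i + 1) = [⟨i, hi⟩] := by
  simp [segWord, List.drop_eq_getElem_cons, hi]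

/-- The node with the given number. -/
def decode {n k : ℕ} (v : ℕ) (hv : v < n + k) : Fin n ⊕ Fin k :=
  if h : v < n then .inl ⟨v, h⟩ else .inr ⟨v - n, by omega⟩

theorem nodeCode_decode {n k v : ℕ} (hv : v < n + k) : nodeCode (decode (n := n) v hv) = v := by
  unfold decode
  split_ifs with h
  · rfl
  · simp only [nodeCode]
    omega

theorem decode_eq_inr {n k v : ℕ} {hv : v < n + k} {x : Fin k}
    (h : decode (n := n) v hv = .inr x) : v = n + x := by
  rw [← nodeCode_decode (n := n) hv, h]
  rfl

theorem eq_inl_of_nodeCode {n k i : ℕ} {u : Fin n ⊕ Fin k} (hi : i < n) (h : nodeCode u = i) :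
    u = .inl ⟨i, hi⟩ := by
  rcases u with u | u
  · simp only [nodeCode] at h
    simp [← h]
  · simp only [nodeCode] at h
    omega

theorem eq_inr_of_nodeCode {n k x : ℕ} {u : Fin n ⊕ Fin k} (hx : x < k)
    (h : nodeCode u = n + x) : u = .inr ⟨x, hx⟩ := by
  rcases u with u | u
  · simp only [nodeCode] at h
    omega
  · simp only [nodeCode, Nat.add_left_cancel_iff] at h
    simp [← h]

/-- The prefix graph with the gates `0, …, k - 1` whose predecessors are given by `L` and `R`. -/
def graphOf (n k : ℕ) (L R out : ℕ → ℕ) (hLR : ∀ x < k, L x < n + x ∧ R x < n + x)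
    (hout : ∀ i < n, out i < n + k) : PrefixGraph n where
  size := k
  left x := decode (L x) (by have := hLR x x.2; omega)
  right x := decode (R x) (by have := hLR x x.2; omega)
  left_lt x y h := by
    have := hLR x x.2
    have := decode_eq_inr h
    exact Fin.lt_def.2 (by omega)
  right_lt x y h := by
    have := hLR x x.2
    have := decode_eq_inr h
    exact Fin.lt_def.2 (by omega)
  out i := decode (out i) (hout i i.2)

section

variable {n k : ℕ} {L R out : ℕ → ℕ} (hLR : ∀ x < k, L x < n + x ∧ R x < n + x)
  (hout : ∀ i < n, out i < n + k)

theorem nodeCode_graphOf_left (x : Fin k) :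
    nodeCode ((graphOf n k L R out hLR hout).left x) = L x :=
  nodeCode_decode (k := k) (by have := hLR x x.2; omega)

theorem nodeCode_graphOf_right (x : Fin k) :
    nodeCode ((graphOf n k L R out hLR hout).right x) = R x :=
  nodeCode_decode (k := k) (by have := hLR x x.2; omega)

theorem nodeCode_graphOf_out (i : Fin n) :
    nodeCode ((graphOf n k L R out hLR hout).out i) = out i :=
  nodeCode_decode (k := k) (hout i i.2)

end

namespace LogicCircuit

variable {ι ο : Type} {C : LogicCircuit ι ο} {i : ι}

theorem Path.eq_of_inl {x : ι} {d : ℕ} (h : C.Path i (.inl x) d) : x = i ∧ d = 0 := by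
  cases h
  exact ⟨rfl, rfl⟩

theorem Path.of_inr {x : C.Gate} {d : ℕ} (h : C.Path i (.inr x) d) :
    ∃ d', d = d' + 1 ∧ (C.Path i (C.fst x) d' ∨ C.Path i (C.snd x) d') := by
  cases h with
  | fst _ d h => exact ⟨d, rfl, .inl h⟩
  | snd _ d h => exact ⟨d, rfl, .inr h⟩

end LogicCircuit

section Graph

variable {n : ℕ} {G : PrefixGraph n} {τ L R : ℕ → ℕ} {v i j : ℕ} {a : ℝ}

theorem Computes.word (hL : ∀ x : Fin G.size, L x = nodeCode (G.left x))
    (hR : ∀ x : Fin G.size, R x = nodeCode (G.right x)) (h : Computes n τ L R G.size v i j a)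
    (u : Fin n ⊕ Fin G.size) (hu : nodeCode u = v) : G.Word u (segWord n i j) := by
  induction h generalizing u with
  | input i a hi ha =>
    rw [eq_inl_of_nodeCode hi hu, segWord_succ hi]
    exact .input _
  | gate x i h j a hx hl hr ihl ihr =>
    rw [← segWord_append hr.bounds.1.le hl.bounds.1.le, eq_inr_of_nodeCode hx hu]
    exact .gate ⟨x, hx⟩ _ _ (ihl _ (hL ⟨x, hx⟩).symm) (ihr _ (hR ⟨x, hx⟩).symm)

/-- The level of a node bounds the arrival times of its two signals, when all arrival times have
been lowered by at most `θ`. -/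
theorem Computes.delay (hL : ∀ x : Fin G.size, L x = nodeCode (G.left x))
    (hR : ∀ x : Fin G.size, R x = nodeCode (G.right x)) {t : Fin n → ℕ} {θ : ℕ}
    (ht : ∀ x : Fin n, t x ≤ τ x + θ) (h : Computes n τ L R G.size v i j a)
    (u : Fin n ⊕ Fin G.size) (hu : nodeCode u = v) (y : Signal × Fin n) (d : ℕ) :
    (G.toCircuit.Path y (G.signalNode .propagate u) d → ((t y.2 + d : ℕ) : ℝ) ≤ a + θ) ∧
    (G.toCircuit.Path y (G.signalNode .generate u) d → ((t y.2 + d : ℕ) : ℝ) ≤ a + θ + 1) := by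
  induction h generalizing u d with
  | input i a hi ha =>
    have h1 := ht ⟨i, hi⟩
    have h2 : (t ⟨i, hi⟩ : ℝ) ≤ τ i + θ := by exact_mod_cast h1
    rw [eq_inl_of_nodeCode hi hu]
    constructor <;> intro h <;> obtain ⟨rfl, rfl⟩ := h.eq_of_inl <;> push_cast <;> linarith
  | gate x i h j a hx hl hr ihl ihr =>
    rw [eq_inr_of_nodeCode hx hu]
    have hl' := ihl _ (hL ⟨x, hx⟩).symm
    have hr' := ihr _ (hR ⟨x, hx⟩).symm
    push_cast at hl' hr'
    constructor <;> intro h <;> obtain ⟨d, rfl, h | h⟩ := h.of_inr <;> push_cast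
    · linarith [(hl' d).1 h]
    · linarith [(hr' d).1 h]
    · linarith [(hl' d).2 h]
    · obtain ⟨d, rfl, h | h⟩ := LogicCircuit.Path.of_inr (C := G.toCircuit)
          (x := (⟨x, hx⟩, PrefixGraph.GadgetGate.inner)) h <;> push_cast
      · linarith [(hl' d).1 h]
      · linarith [(hr' d).2 h]

end Graph

/-! ### Parallel prefix graphs are adders -/

/-- The product of the pairs `(g i, p i)` along a word. -/
def wordValue {n : ℕ} (g p : ℕ → Bool) : List (Fin n) → Bool × Bool
  | [] => (false, true)
  | i :: l => (g i || (p i && (wordValue g p l).1), p i && (wordValue g p l).2)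

theorem wordValue_append {n : ℕ} (g p : ℕ → Bool) (l r : List (Fin n)) :
    wordValue g p (l ++ r) =
      ((wordValue g p l).1 || ((wordValue g p l).2 && (wordValue g p r).1),
        (wordValue g p l).2 && (wordValue g p r).2) := by
  induction l with
  | nil => simp [wordValue]
  | cons i l ih =>
    simp only [List.cons_append, wordValue, ih, Prod.mk.injEq]
    constructor
    · cases g i <;> cases p i <;> simp
    · cases p i <;> simp

theorem PrefixGraph.Word.evals {n : ℕ} {G : PrefixGraph n} (g p : ℕ → Bool)
    {v : Fin n ⊕ Fin G.size} {l : List (Fin n)} (h : G.Word v l) :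
    G.toCircuit.Evals (fun x => signals g p x.1 x.2) (G.signalNode .generate v)
      (wordValue g p l).1 ∧
    G.toCircuit.Evals (fun x => signals g p x.1 x.2) (G.signalNode .propagate v)
      (wordValue g p l).2 := by
  induction h with
  | input i =>
    simp only [wordValue, Bool.and_false, Bool.or_false, Bool.and_true]
    exact ⟨.input (C := G.toCircuit) (x := fun x => signals g p x.1 x.2) (.generate, i),
      .input (C := G.toCircuit) (x := fun x => signals g p x.1 x.2) (.propagate, i)⟩
  | gate x l r _ _ ihl ihr =>
    rw [wordValue_append]
    exact ⟨.gate (C := G.toCircuit) (x, .generate) _ _ ihl.1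
      (.gate (C := G.toCircuit) (x, .inner) _ _ ihl.2 ihr.1),
      .gate (C := G.toCircuit) (x, .propagate) _ _ ihl.2 ihr.2⟩

theorem wordValue_segWord {n : ℕ} (g p : ℕ → Bool) (j : ℕ) (hj : j ≤ n) :
    wordValue g p (segWord n 0 j) = (carry g p j, allPropagate p j) := by
  induction j with
  | zero => simp [segWord, wordValue, carry, allPropagate]
  | succ j ih =>
    rw [← segWord_append (Nat.zero_le j) (Nat.le_succ j), segWord_succ (by omega)]
    simp [wordValue, ih (by omega), carry, allPropagate]

theorem PrefixGraph.IsParallelPrefix.isAdder {n : ℕ} {G : PrefixGraph n}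
    (h : G.IsParallelPrefix) : G.toCircuit.IsAdder := by
  intro g p i
  have h1 := (h i).evals g p
  have h2 := wordValue_segWord (n := n) g p (i + 1) i.2
  rw [segWord, List.drop_zero] at h2
  rw [h2] at h1
  exact h1

/-! ### The iterated logarithm -/

/-- The iterated binary logarithm. Its value at `1` is `0`, because `Real.log 0 = 0`; this agrees
with `loglog 2 = 0`, so that `loglog` is monotone from `1` on. -/
noncomputable def loglog (m : ℕ) : ℝ := Real.logb 2 (Real.logb 2 m)

/-- Comparing integer powers gives rational lower bounds of binary logarithms. -/
theorem div_le_logb_two {x : ℝ} (p q : ℕ) (hq : 0 < q) (h : (2 : ℝ) ^ p ≤ x ^ q) :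
    (p : ℝ) / q ≤ Real.logb 2 x := by
  have h1 := Real.logb_le_logb_of_le (b := 2) (by norm_num) (by positivity) h
  rw [Real.logb_pow, Real.logb_pow, Real.logb_self_eq_one (by norm_num), mul_one] at h1
  rw [div_le_iff₀ (by exact_mod_cast hq)]
  linarith

theorem le_loglog {m : ℕ} (p q p' q' : ℕ) (hp : 0 < p) (hq : 0 < q) (hq' : 0 < q')
    (h : (2 : ℝ) ^ p ≤ (m : ℝ) ^ q) (h' : (2 : ℝ) ^ p' ≤ ((p : ℝ) / q) ^ q') :
    (p' : ℝ) / q' ≤ loglog m := by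
  have h1 := div_le_logb_two (x := m) p q hq h
  have h2 : 0 < (p : ℝ) / q := by positivity
  exact (div_le_logb_two p' q' hq' h').trans
    (Real.logb_le_logb_of_le (by norm_num) h2 h1)

theorem loglog_one : loglog 1 = 0 := by simp [loglog]

theorem loglog_two : loglog 2 = 0 := by simp [loglog]

theorem one_le_logb_two {m : ℕ} (hm : 2 ≤ m) : 1 ≤ Real.logb 2 m := by
  have h : (2 : ℝ) ≤ m := by exact_mod_cast hm
  simpa using div_le_logb_two (x := m) 1 1 (by norm_num) (by simpa using h)

theorem loglog_nonneg {m : ℕ} (hm : 2 ≤ m) : 0 ≤ loglog m :=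
  Real.logb_nonneg (by norm_num) (one_le_logb_two hm)

theorem loglog_mono {a b : ℕ} (ha : 1 ≤ a) (hab : a ≤ b) : loglog a ≤ loglog b := by
  rcases Nat.lt_or_ge a 2 with h | h
  · obtain rfl : a = 1 := by omega
    rcases Nat.lt_or_ge b 2 with h' | h'
    · obtain rfl : b = 1 := by omega
      rfl
    · rw [loglog_one]
      exact loglog_nonneg h'
  · have h1 := one_le_logb_two h
    have h2 : (0 : ℝ) < a := by exact_mod_cast (by omega : 0 < a)
    exact Real.logb_le_logb_of_le (by norm_num) (by linarith)
      (Real.logb_le_logb_of_le (by norm_num) h2 (by exact_mod_cast hab))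

/-- Taking square roots lowers the iterated logarithm by one. -/
theorem loglog_add_one_le {q m : ℕ} (hq : 1 ≤ q) (hm : 4 ≤ m) (h : q * q ≤ m) :
    loglog q + 1 ≤ loglog m := by
  rcases Nat.lt_or_ge q 2 with h' | h'
  · obtain rfl : q = 1 := by omega
    have h4 : (4 : ℝ) ≤ m := by exact_mod_cast hm
    have := le_loglog (m := m) 2 1 1 1 (by norm_num) (by norm_num) (by norm_num)
      (by norm_num; linarith) (by norm_num)
    rw [loglog_one]
    simpa using this
  · have h1 := one_le_logb_two h'
    have h2 : (0 : ℝ) < q := by exact_mod_cast (by omega : 0 < q)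
    have h3 : Real.logb 2 ((q : ℝ) ^ 2) ≤ Real.logb 2 m :=
      Real.logb_le_logb_of_le (by norm_num) (by positivity) (by rw [sq]; exact_mod_cast h)
    rw [Real.logb_pow] at h3
    have h4 := Real.logb_le_logb_of_le (b := 2) (by norm_num) (by push_cast; linarith) h3
    rw [Real.logb_mul (by norm_num) (by linarith)] at h4
    push_cast at h4
    rw [Real.logb_self_eq_one (by norm_num)] at h4
    simpa [loglog, add_comm] using h4

/-- Raising to the power `4 / 3` raises the iterated logarithm by at least `1 / 5`, since
`2 ≤ (4 / 3) ^ 5`. -/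
theorem loglog_succ_le {s m : ℕ} (hs : 1 ≤ s) (h : (s + 1) ^ 4 ≤ m ^ 3) :
    5 * loglog (s + 1) + 1 ≤ 5 * loglog m := by
  have h1 := one_le_logb_two (m := s + 1) (by omega)
  have h2 : (0 : ℝ) < ((s + 1 : ℕ) : ℝ) := by exact_mod_cast (by omega : 0 < s + 1)
  have h3 : Real.logb 2 (((s + 1 : ℕ) : ℝ) ^ 4) ≤ Real.logb 2 ((m : ℝ) ^ 3) :=
    Real.logb_le_logb_of_le (by norm_num) (by positivity) (by exact_mod_cast h)
  rw [Real.logb_pow, Real.logb_pow] at h3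
  push_cast at h3 h1
  have h5 : Real.logb 2 ((4 / 3) * Real.logb 2 ((s + 1 : ℕ) : ℝ)) ≤ loglog m :=
    Real.logb_le_logb_of_le (by norm_num) (by push_cast; linarith) (by push_cast; linarith)
  rw [Real.logb_mul (by norm_num) (by push_cast; linarith)] at h5
  have h6 := div_le_logb_two (x := 4 / 3) 1 5 (by norm_num) (by norm_num)
  have h7 : loglog (s + 1) = Real.logb 2 (Real.logb 2 ((s + 1 : ℕ) : ℝ)) := rfl
  push_cast at h6
  linarith

theorem loglog_three : 1 / 2 ≤ loglog 3 := by
  simpa using le_loglog (m := 3) 3 2 1 2 (by norm_num) (by norm_num) (by norm_num)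
    (by norm_num) (by norm_num)

theorem loglog_four : 1 ≤ loglog 4 := by
  simpa using le_loglog (m := 4) 2 1 1 1 (by norm_num) (by norm_num) (by norm_num)
    (by norm_num) (by norm_num)

theorem loglog_five : 6 / 5 ≤ loglog 5 := by
  simpa using le_loglog (m := 5) 23 10 6 5 (by norm_num) (by norm_num) (by norm_num)
    (by norm_num) (by norm_num)

theorem loglog_six : 5 / 4 ≤ loglog 6 := by
  simpa using le_loglog (m := 6) 5 2 5 4 (by norm_num) (by norm_num) (by norm_num)
    (by norm_num) (by norm_num)

/-- A chain of at most five inputs meets the level bound. -/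
theorem chain_level_le {m : ℕ} (h1 : 1 ≤ m) (h2 : m < 6) :
    2 * ((m : ℝ) - 1) ≤ 5 * loglog m + 2 := by
  have := loglog_one
  have := loglog_two
  have := loglog_three
  have := loglog_four
  have := loglog_five
  interval_cases m <;> norm_num <;> linarith

/-! ### Splitting into groups and counting gates -/

/-- The sizes that arise when `m` inputs are split into `q` groups of `s + 1` inputs and a last
group of `l` inputs, where `s` is the integer square root of `m`. -/
structure Split (m s q l : ℕ) : Prop where
  six_le : 6 ≤ m
  sq_le : s * s ≤ m
  lt_sq : m < (s + 1) * (s + 1)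
  eq : q * (s + 1) + l = m
  one_le : 1 ≤ l
  le : l ≤ s + 1

namespace Split

variable {m s q l : ℕ}

theorem two_le_s (h : Split m s q l) : 2 ≤ s := by
  by_contra! hs
  have := h.lt_sq
  have := h.six_le
  have : s + 1 ≤ 2 := by omega
  nlinarith

theorem q_le (h : Split m s q l) : q ≤ s := by
  have h1 := h.lt_sq
  have h2 := h.eq
  have h3 := h.one_le
  by_contra! hq
  nlinarith

theorem two_mul_add_one_lt (h : Split m s q l) : 2 * s + 1 < m := by
  have h1 := h.six_le
  have h2 := h.sq_le
  have h3 := h.two_le_s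
  rcases Nat.lt_or_ge s 3 with h4 | h4
  · omega
  · nlinarith

theorem one_le_q (h : Split m s q l) : 1 ≤ q := by
  have h1 := h.eq
  have h2 := h.le
  have h3 := h.two_mul_add_one_lt
  have h4 := h.two_le_s
  by_contra! hq
  obtain rfl : q = 0 := by omega
  omega

theorem q_sq_le (h : Split m s q l) : q * q ≤ m := (Nat.mul_le_mul h.q_le h.q_le).trans h.sq_le

theorem s_eq (h : Split m s q l) : s = Nat.sqrt m := Nat.eq_sqrt.2 ⟨h.sq_le, h.lt_sq⟩

theorem q_eq (h : Split m s q l) : q = (m - 1) / (s + 1) := by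
  have h1 := h.eq
  have h2 := h.one_le
  have h3 := h.le
  have e : m - 1 = (l - 1) + (s + 1) * q := by rw [mul_comm]; omega
  rw [e, Nat.add_mul_div_left _ _ (by omega), Nat.div_eq_of_lt (by omega), zero_add]

theorem pow_le (h : Split m s q l) : (s + 1) ^ 4 ≤ m ^ 3 := by
  have h1 := h.two_le_s
  have h2 := h.sq_le
  have h3 := h.six_le
  rcases Nat.lt_or_ge s 3 with h4 | h4
  · obtain rfl : s = 2 := by omega
    calc (2 + 1) ^ 4 ≤ 6 ^ 3 := by norm_num
      _ ≤ m ^ 3 := Nat.pow_le_pow_left h3 3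
  · calc (s + 1) ^ 4 = ((s + 1) ^ 2) ^ 2 := by ring
      _ ≤ (s ^ 3) ^ 2 := Nat.pow_le_pow_left (by nlinarith) 2
      _ = (s * s) ^ 3 := by ring
      _ ≤ m ^ 3 := Nat.pow_le_pow_left h2 3

theorem loglog_s (h : Split m s q l) : loglog s + 1 ≤ loglog m :=
  loglog_add_one_le (by have := h.two_le_s; omega) (by have := h.six_le; omega) h.sq_le

theorem loglog_q (h : Split m s q l) : loglog q + 1 ≤ loglog m :=
  loglog_add_one_le h.one_le_q (by have := h.six_le; omega) h.q_sq_le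

theorem loglog_l (h : Split m s q l) : 5 * loglog l + 1 ≤ 5 * loglog m := by
  have h1 := loglog_succ_le (by have := h.two_le_s; omega) h.pow_le
  have h2 := loglog_mono h.one_le h.le
  linarith

end Split

theorem exists_split {m : ℕ} (hm : 6 ≤ m) :
    Split m m.sqrt ((m - 1) / (m.sqrt + 1)) (m - (m - 1) / (m.sqrt + 1) * (m.sqrt + 1)) := by
  have h1 := Nat.div_mul_le_self (m - 1) (m.sqrt + 1)
  have h2 := Nat.lt_div_mul_add (a := m - 1) (b := m.sqrt + 1) (by omega)
  exact ⟨hm, Nat.sqrt_le m, Nat.lt_succ_sqrt m, by omega, by omega, by omega⟩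

/-- The number of gates of the constructed prefix graph on `m` inputs: the products of the `q`
groups, their prefix products, the prefix products inside the groups (without the last input of
each of the `q` groups), and the gates that multiply these by the product of the preceding groups.
-/
def gates (m : ℕ) : ℕ :=
  if hm : m < 6 then m - 1
  else
    let s := m.sqrt
    let q := (m - 1) / (s + 1)
    let l := m - q * (s + 1)
    q * s + gates q + q * gates s + gates l + (q - 1) * s + l
termination_by m
decreasing_by
  all_goals
    have h := exists_split (m := m) (by omega)
    have h1 := h.two_mul_add_one_lt
    have h2 := h.q_le
    have h3 := h.le
    have h4 := h.two_le_s
    omega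

theorem gates_of_lt {m : ℕ} (hm : m < 6) : gates m = m - 1 := by
  rw [gates, dif_pos hm]

theorem Split.gates {m s q l : ℕ} (h : Split m s q l) : gates m =
    q * s + gates q + q * gates s + gates l + (q - 1) * s + l := by
  have h1 := h.six_le
  have h2 := h.eq
  have h3 := h.q_eq
  rw [PrefixAdder.gates, dif_neg (by omega)]
  simp only [← h.s_eq, ← h3]
  rw [show m - q * (s + 1) = l by omega]

theorem gates_le_sq (m : ℕ) : gates m ≤ m * m := by
  induction m using Nat.strong_induction_on with
  | _ m ih =>
    rcases Nat.lt_or_ge m 6 with hm | hm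
    · rw [gates_of_lt hm]
      interval_cases m <;> norm_num
    · obtain ⟨s, q, l, h⟩ : ∃ s q l, Split m s q l := ⟨_, _, _, exists_split hm⟩
      have h1 := h.two_mul_add_one_lt
      have h2 := h.q_le
      have h3 := h.le
      have h4 := h.two_le_s
      have h5 := h.one_le_q
      have h6 := h.one_le
      have i1 := ih s (by omega)
      have i2 := ih q (by omega)
      have i3 := ih l (by omega)
      have i4 := Nat.mul_le_mul_left q i1
      rw [h.gates, ← h.eq]
      obtain ⟨q, rfl⟩ := Nat.exists_eq_add_of_le' h5
      simp only [Nat.add_sub_cancel]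
      nlinarith [Nat.zero_le (q * s), Nat.zero_le (q * q * s), Nat.zero_le (q * q * s * s),
        Nat.zero_le (q * s * l), Nat.zero_le (q * s * s), Nat.mul_le_mul h6 h4]

theorem gates_le {m : ℕ} (hm : 3 ≤ m) : (gates m : ℝ) ≤ 2 * m * loglog m := by
  induction m using Nat.strong_induction_on with
  | _ m ih =>
    rcases Nat.lt_or_ge m 6 with hm' | hm'
    · rw [gates_of_lt hm']
      have := loglog_three
      have := loglog_four
      have := loglog_five
      interval_cases m <;> norm_num <;> linarith
    · obtain ⟨s, q, l, h⟩ : ∃ s q l, Split m s q l := ⟨_, _, _, exists_split hm'⟩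
      have h1 := h.two_mul_add_one_lt
      have h2 := h.q_le
      have h3 := h.le
      have h4 := h.two_le_s
      have h5 := h.one_le_q
      have h6 := h.one_le
      have hsix := loglog_six.trans (loglog_mono (by norm_num) hm')
      -- Two inputs need one gate although `loglog 2 = 0`, so they need a separate argument.
      have small {x : ℕ} {c : ℝ} (h1 : 1 ≤ x) (h2 : x < m) (h3 : loglog x ≤ c) (h4 : 1 / 4 ≤ c) :
          (gates x : ℝ) ≤ 2 * x * c := by
        rcases Nat.lt_or_ge x 3 with hx | hx
        · rw [gates_of_lt (by omega)]
          interval_cases x <;> norm_num <;> linarith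
        · have hx0 : (0 : ℝ) ≤ 2 * x := by positivity
          exact (ih x h2 hx).trans (mul_le_mul_of_nonneg_left h3 hx0)
      have i1 := small (x := s) (c := loglog m - 1) (by omega) (by omega)
        (by linarith [h.loglog_s]) (by linarith)
      have i2 := small (x := q) (c := loglog m - 1) (by omega) (by omega)
        (by linarith [h.loglog_q]) (by linarith)
      have i3 := small (x := l) (c := loglog m) (by omega) (by omega)
        (by linarith [h.loglog_l]) (by linarith)
      have hq : (0 : ℝ) ≤ q := by positivity
      have i4 := mul_le_mul_of_nonneg_left i1 hq
      have e : (m : ℝ) = q * (s + 1) + l := by exact_mod_cast h.eq.symm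
      have h3' : (l : ℝ) ≤ s + 1 := by exact_mod_cast h3
      have h5' : (1 : ℝ) ≤ q := by exact_mod_cast h5
      rw [h.gates]
      push_cast [Nat.cast_sub h5]
      have e' : 2 * (m : ℝ) * loglog m = 2 * (q * (s + 1) + l) * loglog m := by rw [← e]
      rw [e']
      nlinarith

/-! ### Powers of the golden ratio -/

theorem golden_pow_add_two (c : ℕ) : Real.goldenRatio ^ (c + 2) =
    Real.goldenRatio ^ (c + 1) + Real.goldenRatio ^ c := by
  rw [pow_add, Real.goldenRatio_sq]
  ring

theorem golden_pow_le {a b : ℕ} (h : a ≤ b) : Real.goldenRatio ^ a ≤ Real.goldenRatio ^ b :=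
  pow_le_pow_right₀ Real.one_lt_goldenRatio.le h

theorem golden_pow_pos (a : ℕ) : 0 < Real.goldenRatio ^ a := pow_pos Real.goldenRatio_pos a

theorem logb_golden_le {x y : ℝ} (hx : 0 < x) (h : x ≤ y) :
    Real.logb Real.goldenRatio x ≤ Real.logb Real.goldenRatio y :=
  Real.logb_le_logb_of_le Real.one_lt_goldenRatio hx h

theorem logb_golden_pow (c : ℕ) : Real.logb Real.goldenRatio (Real.goldenRatio ^ c) = c := by
  rw [Real.logb_pow, Real.logb_self_eq_one Real.one_lt_goldenRatio, mul_one]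

theorem logb_golden_pow_mul (c : ℕ) {y : ℝ} (hy : 0 < y) :
    Real.logb Real.goldenRatio (Real.goldenRatio ^ c * y) =
      Real.logb Real.goldenRatio y + c := by
  rw [Real.logb_mul (golden_pow_pos c).ne' hy.ne', logb_golden_pow, add_comm]

theorem le_logb_golden {c : ℕ} {y : ℝ} (h : Real.goldenRatio ^ c ≤ y) :
    (c : ℝ) ≤ Real.logb Real.goldenRatio y := by
  rw [← logb_golden_pow c]
  exact logb_golden_le (golden_pow_pos c) h

/-- The total weight of the levels `A x` for `lo ≤ x < hi`. -/
noncomputable def weight (A : ℕ → ℕ) (lo hi : ℕ) : ℝ :=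
  ∑ x ∈ Finset.Ico lo hi, Real.goldenRatio ^ A x

theorem weight_pos (A : ℕ → ℕ) {lo hi : ℕ} (h : lo < hi) : 0 < weight A lo hi :=
  Finset.sum_pos (fun _ _ => golden_pow_pos _) (by simpa using h)

theorem weight_mono (A : ℕ → ℕ) {lo hi lo' hi' : ℕ} (h : lo' ≤ lo) (h' : hi ≤ hi') :
    weight A lo hi ≤ weight A lo' hi' :=
  Finset.sum_le_sum_of_subset_of_nonneg (Finset.Ico_subset_Ico h h')
    fun _ _ _ => (golden_pow_pos _).le

theorem weight_congr {A B : ℕ → ℕ} {lo hi : ℕ} (h : ∀ x, lo ≤ x → x < hi → A x = B x) :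
    weight A lo hi = weight B lo hi :=
  Finset.sum_congr rfl fun x hx => by rw [h x (Finset.mem_Ico.1 hx).1 (Finset.mem_Ico.1 hx).2]

theorem pow_le_weight (A : ℕ → ℕ) {lo hi x : ℕ} (h : lo ≤ x) (h' : x < hi) :
    Real.goldenRatio ^ A x ≤ weight A lo hi :=
  Finset.single_le_sum (f := fun x => Real.goldenRatio ^ A x) (fun _ _ => (golden_pow_pos _).le)
    (Finset.mem_Ico.2 ⟨h, h'⟩)

theorem weight_succ_right (A : ℕ → ℕ) {lo hi : ℕ} (h : lo ≤ hi) :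
    weight A lo (hi + 1) = weight A lo hi + Real.goldenRatio ^ A hi :=
  Finset.sum_Ico_succ_top h _

theorem weight_succ_left (A : ℕ → ℕ) {lo hi : ℕ} (h : lo < hi) :
    weight A lo hi = Real.goldenRatio ^ A lo + weight A (lo + 1) hi :=
  Finset.sum_eq_sum_Ico_succ_bot h _

theorem weight_add (A : ℕ → ℕ) {a b c : ℕ} (h : a ≤ b) (h' : b ≤ c) :
    weight A a b + weight A b c = weight A a c :=
  Finset.sum_Ico_consecutive _ h h'

/-! ### The graph under construction

Register `0` holds the number of gates, register `1` holds `n`, and the arrays `1` and `2` hold the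
predecessors of the gates. -/

/-- The graph that the state `σ` holds computes a product at a level; see
`PrefixAdder.Computes`. -/
def State.Computes (σ : State) (n : ℕ) (τ : ℕ → ℕ) : ℕ → ℕ → ℕ → ℝ → Prop :=
  PrefixAdder.Computes n τ (σ.arr 1) (σ.arr 2) (σ.reg 0)

/-- The invariants of the construction: register `1` holds the number of inputs, entry `0` of
array `6` holds a number `S` that exceeds all levels, and the gates are topologically ordered. -/
structure State.Valid (σ : State) (n S : ℕ) : Prop where
  reg_one : σ.reg 1 = n
  sentinel : σ.arr 6 0 = S
  lt : ∀ x < σ.reg 0, σ.arr 1 x < n + x ∧ σ.arr 2 x < n + x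

/-- The graph of `σ'` arises from the graph of `σ` by appending gates. -/
structure State.Extends (σ' σ : State) : Prop where
  le : σ.reg 0 ≤ σ'.reg 0
  left : ∀ x < σ.reg 0, σ'.arr 1 x = σ.arr 1 x
  right : ∀ x < σ.reg 0, σ'.arr 2 x = σ.arr 2 x

/-- The graph of `σ'` arises from the graph of `σ` by appending one gate with the predecessors
`l` and `r`. -/
structure State.Appends (σ' σ : State) (l r : ℕ) : Prop where
  reg : σ'.reg 0 = σ.reg 0 + 1
  left : σ'.arr 1 = Function.update (σ.arr 1) (σ.reg 0) l
  right : σ'.arr 2 = Function.update (σ.arr 2) (σ.reg 0) r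

theorem State.Extends.of_eq {σ σ' : State} (h : σ'.reg 0 = σ.reg 0) (h1 : σ'.arr 1 = σ.arr 1)
    (h2 : σ'.arr 2 = σ.arr 2) : σ'.Extends σ :=
  ⟨h.ge, fun _ _ => by rw [h1], fun _ _ => by rw [h2]⟩

theorem State.Extends.refl (σ : State) : σ.Extends σ := .of_eq rfl rfl rfl

theorem State.Extends.trans {σ σ' σ'' : State} (h : σ''.Extends σ') (h' : σ'.Extends σ) :
    σ''.Extends σ :=
  ⟨h'.le.trans h.le, fun x hx => (h.left x (hx.trans_le h'.le)).trans (h'.left x hx),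
    fun x hx => (h.right x (hx.trans_le h'.le)).trans (h'.right x hx)⟩

theorem State.Computes.extend {σ σ' : State} {n v i j : ℕ} {τ : ℕ → ℕ} {a : ℝ}
    (h : σ.Computes n τ v i j a) (h' : σ'.Extends σ) : σ'.Computes n τ v i j a :=
  PrefixAdder.Computes.extend h h'.le h'.left h'.right

theorem State.Computes.mono {σ : State} {n v i j : ℕ} {τ : ℕ → ℕ} {a b : ℝ}
    (h : σ.Computes n τ v i j a) (h' : a ≤ b) : σ.Computes n τ v i j b :=
  PrefixAdder.Computes.mono h h'

theorem State.Computes.lt {σ : State} {n v i j : ℕ} {τ : ℕ → ℕ} {a : ℝ}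
    (h : σ.Computes n τ v i j a) : v < n + σ.reg 0 :=
  PrefixAdder.Computes.lt h

namespace State.Appends

variable {σ σ' : State} {l r : ℕ}

theorem extends_ (h : σ'.Appends σ l r) : σ'.Extends σ :=
  ⟨by rw [h.reg]; omega, fun x hx => by rw [h.left]; simp [hx.ne],
    fun x hx => by rw [h.right]; simp [hx.ne]⟩

theorem lt (h : σ'.Appends σ l r) {n S : ℕ} (hσ : σ.Valid n S) (hl : l < n + σ.reg 0)
    (hr : r < n + σ.reg 0) : ∀ x < σ'.reg 0, σ'.arr 1 x < n + x ∧ σ'.arr 2 x < n + x := by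
  intro x hx
  rw [h.reg] at hx
  rw [h.left, h.right]
  rcases Nat.lt_succ_iff_lt_or_eq.1 hx with hx | rfl
  · simpa [hx.ne] using hσ.lt x hx
  · simp [hl, hr]

theorem computes (h : σ'.Appends σ l r) {n i k j : ℕ} {τ : ℕ → ℕ} {a : ℝ}
    (hl : σ.Computes n τ l k j (a - 1)) (hr : σ.Computes n τ r i k (a - 2)) :
    σ'.Computes n τ (n + σ.reg 0) i j a := by
  unfold State.Computes
  rw [h.left, h.right, h.reg]
  exact PrefixAdder.Computes.append hl hr

end State.Appends

/-! ### The stack of a group product -/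

/-- The stack of nodes from which a product is built. The stack consists of the nodes `σ.arr 5 j`
for `1 ≤ j ≤ k`, and the node `j` computes the block of inputs from `bnd j` to `bnd (j - 1)`. The
level of a node is `σ.arr 6 j`, and `top` for the topmost one. The node `j` is the left operand of
a future gate of level `σ.arr 6 j + 1` whose right operand is made of the nodes above `j`, so that
right operand has to meet the level `σ.arr 6 j - 1`. Hence the gaps: a node below the topmost one
will itself be raised by one when it is merged with the nodes above it. The sentinel `σ.arr 6 0`
exceeds all levels. -/
structure State.Stack (σ : State) (n : ℕ) (τ : ℕ → ℕ) (k top : ℕ) (bnd : ℕ → ℕ) : Prop where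
  pos : 1 ≤ k
  comp : ∀ j, 1 ≤ j → j < k → σ.Computes n τ (σ.arr 5 j) (bnd j) (bnd (j - 1)) (σ.arr 6 j)
  gap : ∀ j, 1 ≤ j → j < k → σ.arr 6 j + 2 ≤ σ.arr 6 (j - 1)
  comp_top : σ.Computes n τ (σ.arr 5 k) (bnd k) (bnd (k - 1)) top
  gap_top : top + 1 ≤ σ.arr 6 (k - 1)

namespace State.Stack

variable {σ σ' : State} {n k top : ℕ} {τ bnd : ℕ → ℕ}

theorem transfer (h : σ.Stack n τ k top bnd) (hσ : σ'.Extends σ)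
    (h5 : ∀ j ≤ k, σ'.arr 5 j = σ.arr 5 j) (h6 : ∀ j < k, σ'.arr 6 j = σ.arr 6 j) :
    σ'.Stack n τ k top bnd where
  pos := h.pos
  comp j h1 h2 := by
    rw [h5 j h2.le, h6 j h2]
    exact (h.comp j h1 h2).extend hσ
  gap j h1 h2 := by
    rw [h6 j h2, h6 (j - 1) (by omega)]
    exact h.gap j h1 h2
  comp_top := by
    rw [h5 k le_rfl]
    exact h.comp_top.extend hσ
  gap_top := by
    rw [h6 (k - 1) (by have := h.pos; omega)]
    exact h.gap_top

theorem le_zero (h : σ.Stack n τ k top bnd) : ∀ j < k, σ.arr 6 j ≤ σ.arr 6 0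
  | 0, _ => le_rfl
  | j + 1, hj => by
    have h1 := h.gap (j + 1) (by omega) hj
    have h2 := h.le_zero j (by omega)
    simp only [Nat.add_sub_cancel] at h1
    omega

theorem lt (h : σ.Stack n τ k top bnd) {j : ℕ} (h1 : 1 ≤ j) (h2 : j ≤ k) :
    σ.arr 5 j < n + σ.reg 0 := by
  rcases h2.lt_or_eq with h2 | rfl
  · exact (h.comp j h1 h2).lt
  · exact h.comp_top.lt

/-- Merging the two topmost nodes. -/
theorem merge (h : σ.Stack n τ (k + 1) top bnd) (hk : 1 ≤ k)
    (hσ : σ'.Appends σ (σ.arr 5 k) (σ.arr 5 (k + 1)))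
    (h5 : σ'.arr 5 = Function.update (σ.arr 5) k (n + σ.reg 0))
    (h6 : ∀ j < k, σ'.arr 6 j = σ.arr 6 j) :
    σ'.Stack n τ k (σ.arr 6 k + 1) (Function.update bnd k (bnd (k + 1))) where
  pos := hk
  comp j h1 h2 := by
    rw [h5, h6 j h2]
    simpa [h2.ne, (show j - 1 ≠ k by omega)] using
      (h.comp j h1 (by omega)).extend hσ.extends_
  gap j h1 h2 := by
    rw [h6 j h2, h6 (j - 1) (by omega)]
    exact h.gap j h1 (by omega)
  comp_top := by
    have h1 := h.comp k hk (by omega)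
    have h2 := h.comp_top
    have h3 := h.gap_top
    simp only [Nat.add_sub_cancel] at h2 h3
    have h4 : (top : ℝ) + 1 ≤ σ.arr 6 k := by exact_mod_cast h3
    rw [h5]
    simp only [Function.update_self, Function.update_of_ne (show k - 1 ≠ k by omega)]
    exact hσ.computes (h1.mono (by push_cast; linarith)) (h2.mono (by push_cast; linarith))
  gap_top := by
    rw [h6 (k - 1) (by omega)]
    have := h.gap k hk (by omega)
    omega

/-- Raising the topmost node to the level `l` and pushing a new node of level `a`. -/
theorem push (h : σ.Stack n τ k top bnd) {l v i a : ℕ} (hl : top ≤ l)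
    (hgap : l + 2 ≤ σ.arr 6 (k - 1)) (ha : a + 1 ≤ l) (hv : σ.Computes n τ v i (bnd k) a)
    (hσ : σ'.Extends σ) (h5 : σ'.arr 5 = Function.update (σ.arr 5) (k + 1) v)
    (h6 : σ'.arr 6 = Function.update (Function.update (σ.arr 6) k l) (k + 1) a) :
    σ'.Stack n τ (k + 1) a (Function.update bnd (k + 1) i) where
  pos := by omega
  comp j h1 h2 := by
    rw [h5, h6]
    rcases (Nat.lt_succ_iff.1 h2).lt_or_eq with h2 | rfl
    · simpa [h2.ne, (show j ≠ k + 1 by omega), (show j - 1 ≠ k + 1 by omega)] using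
        (h.comp j h1 h2).extend hσ
    · have h3 : (top : ℝ) ≤ l := by exact_mod_cast hl
      simpa [(show j - 1 ≠ j + 1 by omega)] using (h.comp_top.extend hσ).mono h3
  gap j h1 h2 := by
    rw [h6]
    rcases (Nat.lt_succ_iff.1 h2).lt_or_eq with h2 | rfl
    · simpa [h2.ne, (show j ≠ k + 1 by omega), (show j - 1 ≠ k + 1 by omega),
        (show j - 1 ≠ k by omega)] using h.gap j h1 h2
    · simpa [(show j - 1 ≠ j + 1 by omega), (show j - 1 ≠ j by omega)] using hgap
  comp_top := by
    rw [h5]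
    simpa using hv.extend hσ
  gap_top := by
    rw [h6]
    simpa using ha

end State.Stack

/-! ### The program -/

/-- Appends the gate with the predecessors `l` and `r`, and stores its number in entry `i` of
array `a`. -/
def appendGate (l r : Expr) (a : ℕ) (i : Expr) : Cmd :=
  block [.store 1 (.reg 0) l, .store 2 (.reg 0) r, .store a i (.add (.reg 1) (.reg 0)),
    .assign 0 (.add (.reg 0) (.const 1))]

/-- Merges the two topmost nodes of the stack, whose height is in register `14`. -/
def mergeTop : Cmd :=
  block [appendGate (.arr 5 (.sub (.reg 14) (.const 1))) (.arr 5 (.reg 14)) 5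
    (.sub (.reg 14) (.const 1)), .assign 14 (.sub (.reg 14) (.const 1))]

/-- Raises register `13` to at least register `12` plus one. -/
def raise : Cmd :=
  .ite (.reg 13) (.add (.reg 12) (.const 1)) (.assign 13 (.add (.reg 12) (.const 1))) .skip

/-- Merges the two topmost nodes of the stack, and computes the level to which the new topmost
node has to be raised. -/
def mergeStep : Cmd :=
  block [mergeTop, .assign 13 (.add (.arr 6 (.reg 14)) (.const 1)), raise]

/-- Merges nodes until a leaf whose level is in register `12` can be pushed; register `13` holds
the level to which the topmost node has to be raised. -/
def mergeLoop : Cmd :=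
  .loop (.arr 6 (.sub (.reg 14) (.const 1))) (.add (.reg 13) (.const 2)) mergeStep

/-- Moves on to the next leaf, puts its level into register `12`, and starts register `13` with the
level to which the topmost node has to be raised if nothing is merged. -/
def nextLeaf : Cmd :=
  block [.assign 11 (.sub (.reg 11) (.const 1)), .assign 12 (.arr 0 (.reg 11)),
    .assign 13 (.arr 6 (.reg 14)), raise]

/-- Raises the topmost node to the level in register `13`, and pushes the leaf. -/
def pushLeaf : Cmd :=
  block [.store 6 (.reg 14) (.reg 13), .assign 14 (.add (.reg 14) (.const 1)),
    .store 5 (.reg 14) (.arr 3 (.reg 11)), .store 6 (.reg 14) (.reg 12)]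

/-- Starts the stack with the leaf of the highest number. -/
def initStack : Cmd :=
  block [.assign 11 (.add (.reg 2) (.reg 4)), .store 5 (.const 1) (.arr 3 (.reg 11)),
    .store 6 (.const 1) (.arr 0 (.reg 11)), .assign 14 (.const 1)]

/-- Merges the two topmost nodes, and stores the level of the new topmost node. -/
def flushStep : Cmd :=
  block [mergeTop, .store 6 (.reg 14) (.add (.arr 6 (.reg 14)) (.const 1))]

/-- Pushes the leaves with the numbers from register `11` minus one down to register `2`. -/
def leafLoop : Cmd :=
  .loop (.reg 2) (.reg 11) (block [nextLeaf, mergeLoop, pushLeaf])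

/-- Merges all nodes of the stack. -/
def flushLoop : Cmd :=
  .loop (.const 1) (.reg 14) flushStep

/-- Builds the product of the nodes `σ.arr 3 x` for `p ≤ x ≤ p + s`, where register `2` holds `p`
and register `4` holds `s`.  The resulting node and its level are left in entry `1` of the arrays
`5` and `6`. -/
def groupProduct : Cmd :=
  block [initStack, leafLoop, flushLoop]

/-- `State.Appends` as a conjunction, for the simplifier. -/
theorem State.appends_iff {σ σ' : State} {l r : ℕ} : σ'.Appends σ l r ↔
    σ'.reg 0 = σ.reg 0 + 1 ∧ σ'.arr 1 = Function.update (σ.arr 1) (σ.reg 0) l ∧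
      σ'.arr 2 = Function.update (σ.arr 2) (σ.reg 0) r :=
  ⟨fun h => ⟨h.reg, h.left, h.right⟩, fun h => ⟨h.1, h.2.1, h.2.2⟩⟩

theorem mergeStep_spec {procs : List Cmd} {M n k : ℕ} {σ : State} (h14 : σ.reg 14 = k + 1)
    (hn : σ.reg 1 = n) (h0 : n + σ.reg 0 + 1 ≤ M) (hk : k + 1 ≤ M) (h5 : σ.arr 5 k ≤ M)
    (h5' : σ.arr 5 (k + 1) ≤ M) (h6 : σ.arr 6 k + 1 ≤ M) (h12 : σ.reg 12 + 1 ≤ M) :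
    Spec procs M mergeStep σ fun σ' u => u ≤ 60 ∧
      σ'.Appends σ (σ.arr 5 k) (σ.arr 5 (k + 1)) ∧ σ'.reg 14 = k ∧
      σ'.reg 13 = max (σ.arr 6 k + 1) (σ.reg 12 + 1) ∧
      σ'.arr 5 = Function.update (σ.arr 5) k (n + σ.reg 0) ∧
      (∀ x, x ≠ 0 → x ≠ 13 → x ≠ 14 → σ'.reg x = σ.reg x) ∧
      (∀ a, a ≠ 1 → a ≠ 2 → a ≠ 5 → σ'.arr a = σ.arr a) := by
  refine Spec.straight ?_
  simp +contextual [mergeStep, mergeTop, appendGate, raise, block, Cmd.wp, Expr.Small, Expr.eval,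
    Cmd.steps, Expr.nodes, h14, hn, State.appends_iff]
  omega

theorem flushStep_spec {procs : List Cmd} {M n k : ℕ} {σ : State} (h14 : σ.reg 14 = k + 1)
    (hn : σ.reg 1 = n) (h0 : n + σ.reg 0 + 1 ≤ M) (hk : k + 1 ≤ M) (h5 : σ.arr 5 k ≤ M)
    (h5' : σ.arr 5 (k + 1) ≤ M) (h6 : σ.arr 6 k + 1 ≤ M) :
    Spec procs M flushStep σ fun σ' u => u ≤ 60 ∧
      σ'.Appends σ (σ.arr 5 k) (σ.arr 5 (k + 1)) ∧ σ'.reg 14 = k ∧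
      σ'.arr 5 = Function.update (σ.arr 5) k (n + σ.reg 0) ∧
      σ'.arr 6 = Function.update (σ.arr 6) k (σ.arr 6 k + 1) ∧
      (∀ x, x ≠ 0 → x ≠ 14 → σ'.reg x = σ.reg x) ∧
      (∀ a, a ≠ 1 → a ≠ 2 → a ≠ 5 → a ≠ 6 → σ'.arr a = σ.arr a) := by
  refine Spec.straight ?_
  simp +contextual [flushStep, mergeTop, appendGate, block, Cmd.wp, Expr.Small, Expr.eval,
    Cmd.steps, Expr.nodes, h14, hn, State.appends_iff]
  omega

theorem nextLeaf_spec {procs : List Cmd} {M i k : ℕ} {σ : State} (h14 : σ.reg 14 = k)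
    (h11 : σ.reg 11 = i + 1) (hi : i + 1 ≤ M) (hk : k ≤ M) (h6 : σ.arr 6 k ≤ M)
    (ha : σ.arr 0 i + 1 ≤ M) :
    Spec procs M nextLeaf σ fun σ' u => u ≤ 60 ∧
      σ'.reg 11 = i ∧ σ'.reg 12 = σ.arr 0 i ∧
      σ'.reg 13 = max (σ.arr 6 k) (σ.arr 0 i + 1) ∧
      (∀ x, x ≠ 11 → x ≠ 12 → x ≠ 13 → σ'.reg x = σ.reg x) ∧ σ'.arr = σ.arr := by
  refine Spec.straight ?_
  simp +contextual [nextLeaf, raise, block, Cmd.wp, Expr.Small, Expr.eval,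
    Cmd.steps, Expr.nodes, h14, h11]
  omega

theorem pushLeaf_spec {procs : List Cmd} {M i k : ℕ} {σ : State} (h14 : σ.reg 14 = k)
    (h11 : σ.reg 11 = i) (hi : i ≤ M) (hk : k + 1 ≤ M) (h3 : σ.arr 3 i ≤ M)
    (h12 : σ.reg 12 ≤ M) (h13 : σ.reg 13 ≤ M) :
    Spec procs M pushLeaf σ fun σ' u => u ≤ 60 ∧
      σ'.reg 14 = k + 1 ∧ σ'.arr 5 = Function.update (σ.arr 5) (k + 1) (σ.arr 3 i) ∧
      σ'.arr 6 = Function.update (Function.update (σ.arr 6) k (σ.reg 13)) (k + 1) (σ.reg 12) ∧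
      (∀ x, x ≠ 14 → σ'.reg x = σ.reg x) ∧
      (∀ a, a ≠ 5 → a ≠ 6 → σ'.arr a = σ.arr a) := by
  refine Spec.straight ?_
  simp +contextual [pushLeaf, block, Cmd.wp, Expr.Small, Expr.eval,
    Cmd.steps, Expr.nodes, h14, h11]
  omega

theorem initStack_spec {procs : List Cmd} {M p s : ℕ} {σ : State} (h2 : σ.reg 2 = p)
    (h4 : σ.reg 4 = s) (hi : p + s + 1 ≤ M) (h3 : σ.arr 3 (p + s) ≤ M)
    (ha : σ.arr 0 (p + s) ≤ M) :
    Spec procs M initStack σ fun σ' u => u ≤ 60 ∧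
      σ'.reg 11 = p + s ∧ σ'.reg 14 = 1 ∧
      σ'.arr 5 = Function.update (σ.arr 5) 1 (σ.arr 3 (p + s)) ∧
      σ'.arr 6 = Function.update (σ.arr 6) 1 (σ.arr 0 (p + s)) ∧
      (∀ x, x ≠ 11 → x ≠ 14 → σ'.reg x = σ.reg x) ∧
      (∀ a, a ≠ 5 → a ≠ 6 → σ'.arr a = σ.arr a) := by
  refine Spec.straight ?_
  simp +contextual [initStack, block, Cmd.wp, Expr.Small, Expr.eval,
    Cmd.steps, Expr.nodes, h2, h4]
  omega

/-- A stack node of level `c` occupies the room `φ ^ c`, and raising the level of a node wastes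
room. A merge wastes room only if the left operand of the new gate is at level at most `a + 2`,
where `a` is the level of the leaf to be pushed, and then all the room wasted for this leaf is at
most `φ ^ (a + 1)`. Here `r` is the room that the nodes below the two topmost ones occupy, and `X`
is the room that was occupied before the leaf was considered. -/
theorem golden_merge {r X : ℝ} {c ct a : ℕ} (h1 : r + Real.goldenRatio ^ c ≤ X)
    (h2 : r + Real.goldenRatio ^ c + Real.goldenRatio ^ max ct (a + 1) ≤
      X + Real.goldenRatio ^ (a + 1))
    (h3 : ct + 1 ≤ c) (h4 : c < max ct (a + 1) + 2) :
    r + Real.goldenRatio ^ max (c + 1) (a + 1) ≤ X + Real.goldenRatio ^ (a + 1) := by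
  have hc := golden_pow_pos c
  rcases Nat.lt_or_ge a c with h5 | h5
  · obtain ⟨c, rfl⟩ : ∃ d, c = d + 1 := ⟨c - 1, by omega⟩
    rw [max_eq_left (by omega), golden_pow_add_two c]
    -- The merged node needs `φ ^ c` more room than its left operand.  This is the room of its right
    -- operand, unless `φ ^ c` is at most the waste `φ ^ (a + 1)` that the leaf may cause.
    rcases Nat.lt_or_ge (a + 1) c with h6 | h6
    · rw [show max ct (a + 1) = c by omega] at h2
      linarith
    · have := golden_pow_le h6
      linarith
  · rw [max_eq_right (by omega)]
    linarith

/-- Here `k` is the height of the stack, `ct` is the level of its topmost node, and `a` is the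
level of the leaf to be pushed. Each merge removes a node from the stack, which pays for the steps.
-/
theorem mergeLoop_spec {procs : List Cmd} {M n S k a ct B : ℕ} {τ bnd : ℕ → ℕ} {X : ℝ}
    {σ : State}
    (hσ : σ.Valid n S) (h14 : σ.reg 14 = k) (h12 : σ.reg 12 = a)
    (h13 : σ.reg 13 = max ct (a + 1)) (hst : σ.Stack n τ k ct bnd)
    (hB : ∀ j, 1 ≤ j → j < k → σ.arr 6 j ≤ B) (hct : ct ≤ B + 1) (ha : a + 1 ≤ B)
    (hS : B + 3 ≤ S) (hM : S ≤ M) (hM' : n + σ.reg 0 + k ≤ M)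
    (hX : weight (σ.arr 6) 1 k + Real.goldenRatio ^ ct ≤ X) :
    Spec procs M mergeLoop σ fun σ' u => ∃ k' ct' bnd', u + 100 * k' ≤ 100 * k + 20 ∧
      σ'.reg 14 = k' ∧ σ'.reg 13 = max ct' (a + 1) ∧ σ'.reg 0 + k' = σ.reg 0 + k ∧
      σ'.Valid n S ∧ σ'.Extends σ ∧ σ'.Stack n τ k' ct' bnd' ∧
      bnd' 0 = bnd 0 ∧ bnd' k' = bnd k ∧ ct' ≤ B + 1 ∧
      max ct' (a + 1) + 2 ≤ σ'.arr 6 (k' - 1) ∧ k' ≤ k ∧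
      weight (σ'.arr 6) 1 k' + Real.goldenRatio ^ max ct' (a + 1) ≤
        X + Real.goldenRatio ^ (a + 1) ∧
      (∀ x, x ≠ 0 → x ≠ 13 → x ≠ 14 → σ'.reg x = σ.reg x) ∧
      (∀ b, b ≠ 1 → b ≠ 2 → b ≠ 5 → σ'.arr b = σ.arr b) := by
  refine Spec.loop (fun σ' u => ∃ k' ct' bnd', u + 100 * k' ≤ 100 * k ∧
      σ'.reg 14 = k' ∧ σ'.reg 13 = max ct' (a + 1) ∧ σ'.reg 0 + k' = σ.reg 0 + k ∧
      σ'.Valid n S ∧ σ'.Extends σ ∧ σ'.Stack n τ k' ct' bnd' ∧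
      bnd' 0 = bnd 0 ∧ bnd' k' = bnd k ∧ ct' ≤ B + 1 ∧ k' ≤ k ∧
      weight (σ'.arr 6) 1 k' ≤ X ∧
      weight (σ'.arr 6) 1 k' + Real.goldenRatio ^ max ct' (a + 1) ≤
        X + Real.goldenRatio ^ (a + 1) ∧
      (∀ x, x ≠ 0 → x ≠ 13 → x ≠ 14 → σ'.reg x = σ.reg x) ∧
      (∀ b, b ≠ 1 → b ≠ 2 → b ≠ 5 → σ'.arr b = σ.arr b)) (fun σ' => σ'.reg 14) ?_ ?_
  · rintro σ' u ⟨k', ct', bnd', hu, g14, g13, g0, gv, ge, gs, gb0, gbk, gct, gk, gX, gX', gr, ga⟩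
    have hpos := gs.pos
    have h6 : σ'.arr 6 = σ.arr 6 := ga 6 (by norm_num) (by norm_num) (by norm_num)
    have hle := gs.le_zero (k' - 1) (by omega)
    rw [gv.sentinel] at hle
    refine ⟨?_, ?_, ?_, ?_⟩
    · simp only [Expr.Small, Expr.eval, g14]
      omega
    · simp only [Expr.Small, Expr.eval, g13]
      omega
    · intro hlt
      simp only [Expr.eval, g14, g13] at hlt
      -- The sentinel exceeds all levels, so the stack has at least two nodes.
      have hk2 : 2 ≤ k' := by
        by_contra! hk2
        obtain rfl : k' = 1 := by omega
        have := gv.sentinel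
        simp only [Nat.sub_self] at hlt
        omega
      obtain ⟨l, rfl⟩ : ∃ l, k' = l + 1 := ⟨k' - 1, by omega⟩
      simp only [Nat.add_sub_cancel] at hlt hle
      have hl : 1 ≤ l := by omega
      have h5 := gs.lt (j := l) hl (by omega)
      have h5' := gs.lt (j := l + 1) (by omega) le_rfl
      have hBl : σ'.arr 6 l ≤ B := by
        rw [h6]
        exact hB l hl (by omega)
      have hgt := gs.gap_top
      simp only [Nat.add_sub_cancel] at hgt
      have h12' : σ'.reg 12 = a := (gr 12 (by norm_num) (by norm_num) (by norm_num)).trans h12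
      refine (mergeStep_spec g14 gv.reg_one (by omega) (by omega) (by omega) (by omega) (by omega)
        (by omega)).mono ?_
      rintro σ'' v ⟨hv, f0, f14, f13, f5, fr, fa⟩
      have f6 : σ''.arr 6 = σ'.arr 6 := fa 6 (by norm_num) (by norm_num) (by norm_num)
      refine ⟨⟨l, σ'.arr 6 l + 1, Function.update bnd' l (bnd' (l + 1)), ?_, f14, ?_, ?_,
        ⟨?_, ?_, f0.lt gv h5 h5'⟩, f0.extends_.trans ge,
        gs.merge hl f0 f5 (fun j _ => by rw [f6]), ?_, ?_, ?_, ?_, ?_, ?_, ?_, ?_⟩, ?_⟩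
      · simp only [Expr.nodes]
        omega
      · rw [f13, h12']
      · rw [f0.reg]
        omega
      · rw [fr 1 (by norm_num) (by norm_num) (by norm_num), gv.reg_one]
      · rw [f6, gv.sentinel]
      · rw [Function.update_of_ne (by omega), gb0]
      · rw [Function.update_self, gbk]
      · omega
      · omega
      · rw [f6]
        exact (weight_mono _ le_rfl (by omega)).trans gX
      · rw [f6]
        rw [weight_succ_right _ hl] at gX gX'
        exact golden_merge gX gX' hgt hlt
      · intro x h0 h1 h2
        rw [fr x h0 h1 h2, gr x h0 h1 h2]
      · intro x h0 h1 h2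
        rw [fa x h0 h1 h2, ga x h0 h1 h2]
      · rw [f14, g14]
        omega
    · intro hlt
      simp only [Expr.eval, g14, g13] at hlt
      refine ⟨k', ct', bnd', ?_, g14, g13, g0, gv, ge, gs, gb0, gbk, gct, by omega, gk, gX', gr,
        ga⟩
      simp only [Expr.nodes]
      omega
  · have hX' : weight (σ.arr 6) 1 k ≤ X := by linarith [golden_pow_pos ct]
    refine ⟨k, ct, bnd, by omega, h14, h13, rfl, hσ, .refl σ, hst, rfl, rfl, hct, le_rfl, hX', ?_,
      fun _ _ _ _ => rfl, fun _ _ _ _ => rfl⟩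
    rcases le_total ct (a + 1) with h | h
    · rw [max_eq_right h]
      linarith
    · rw [max_eq_left h]
      linarith [golden_pow_pos (a + 1)]

/-- The leaves are pushed from the highest number down to `p`. The room that the stack occupies is
at most `φ ^ 2` times the weight of the leaves: the leaf of level `a` occupies `φ ^ a` and wastes
at most `φ ^ (a + 1)`. -/
theorem leafLoop_spec {procs : List Cmd} {M n S p s H : ℕ} {τ pos : ℕ → ℕ} {σ : State}
    (hσ : σ.Valid n S) (h2 : σ.reg 2 = p) (h11 : σ.reg 11 = p + s) (h14 : σ.reg 14 = 1)
    (h5 : σ.arr 5 1 = σ.arr 3 (p + s)) (h6 : σ.arr 6 1 = σ.arr 0 (p + s))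
    (hcomp : ∀ x, p ≤ x → x ≤ p + s →
      σ.Computes n τ (σ.arr 3 x) (pos x) (pos (x + 1)) (σ.arr 0 x))
    (hH : ∀ x, p ≤ x → x ≤ p + s → σ.arr 0 x ≤ H) (hS : H + s + 5 ≤ S) (hSM : S ≤ M)
    (hM : n + σ.reg 0 + s + 1 ≤ M) (hp : p + s + 1 ≤ M) :
    Spec procs M leafLoop σ fun σ' u => ∃ k bnd, u + 100 * k ≤ 300 * (s + 1) + 10 ∧
      σ'.reg 14 = k ∧ σ'.reg 0 + k = σ.reg 0 + (s + 1) ∧ σ'.Valid n S ∧ σ'.Extends σ ∧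
      σ'.Stack n τ k (σ'.arr 6 k) bnd ∧ bnd 0 = pos (p + s + 1) ∧ bnd k = pos p ∧
      (∀ j, 1 ≤ j → j ≤ k → σ'.arr 6 j ≤ H + s + 2) ∧
      weight (σ'.arr 6) 1 (k + 1) ≤ Real.goldenRatio ^ 2 * weight (σ.arr 0) p (p + s + 1) ∧
      (∀ x, 1 ≤ x → x ≤ 10 → σ'.reg x = σ.reg x) ∧
      (∀ b, b ≠ 1 → b ≠ 2 → b ≠ 5 → b ≠ 6 → σ'.arr b = σ.arr b) := by
  refine Spec.loop (fun σ' u => ∃ i k bnd, u + 100 * k ≤ 300 * (p + s + 1 - i) ∧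
      p ≤ i ∧ i ≤ p + s ∧ σ'.reg 11 = i ∧
      σ'.reg 14 = k ∧ σ'.reg 0 + k = σ.reg 0 + (p + s + 1 - i) ∧ σ'.Valid n S ∧ σ'.Extends σ ∧
      σ'.Stack n τ k (σ'.arr 6 k) bnd ∧ bnd 0 = pos (p + s + 1) ∧ bnd k = pos i ∧
      (∀ j, 1 ≤ j → j ≤ k → σ'.arr 6 j ≤ H + 2 + (p + s - i)) ∧
      weight (σ'.arr 6) 1 (k + 1) ≤ Real.goldenRatio ^ 2 * weight (σ.arr 0) i (p + s + 1) ∧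
      (∀ x, 1 ≤ x → x ≤ 10 → σ'.reg x = σ.reg x) ∧
      (∀ b, b ≠ 1 → b ≠ 2 → b ≠ 5 → b ≠ 6 → σ'.arr b = σ.arr b)) (fun σ' => σ'.reg 11) ?_ ?_
  · rintro σ' u ⟨i, k, bnd, hu, hpi, hips, g11, g14, g0, gv, ge, gs, gb0, gbk, gB, gX, gr, ga⟩
    have g2 : σ'.reg 2 = p := (gr 2 (by norm_num) (by norm_num)).trans h2
    refine ⟨?_, ?_, ?_, ?_⟩
    · simp only [Expr.Small, g2]
      omega
    · simp only [Expr.Small, g11]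
      omega
    · intro hlt
      simp only [Expr.eval, g2, g11] at hlt
      obtain ⟨i, rfl⟩ : ∃ j, i = j + 1 := ⟨i - 1, by omega⟩
      have a0 : σ'.arr 0 = σ.arr 0 := ga 0 (by norm_num) (by norm_num) (by norm_num) (by norm_num)
      have a3 : σ'.arr 3 = σ.arr 3 := ga 3 (by norm_num) (by norm_num) (by norm_num) (by norm_num)
      have hHi : σ'.arr 0 i ≤ H := a0 ▸ hH i (by omega) (by omega)
      have hkpos := gs.pos
      have hBk := gB k hkpos le_rfl
      have hleaf := (hcomp i (by omega) (by omega)).extend ge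
      refine Spec.seq ((nextLeaf_spec g14 g11 (by omega) (by omega) (by omega) (by omega)).mono ?_)
      rintro σ₁ u₁ ⟨hu₁, f11, f12, f13, fr, fa⟩
      have e0 : σ₁.reg 0 = σ'.reg 0 := fr 0 (by norm_num) (by norm_num) (by norm_num)
      have e1 : σ₁.Extends σ' := .of_eq e0 (by rw [fa]) (by rw [fa])
      have v1 : σ₁.Valid n S := ⟨(fr 1 (by norm_num) (by norm_num) (by norm_num)).trans gv.reg_one,
        by rw [fa, gv.sentinel], by rw [e0, fa]; exact gv.lt⟩
      have s1 : σ₁.Stack n τ k (σ'.arr 6 k) bnd :=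
        gs.transfer e1 (fun _ _ => by rw [fa]) (fun _ _ => by rw [fa])
      refine Spec.seq ((mergeLoop_spec (B := H + 2 + (p + s - (i + 1)))
        (X := Real.goldenRatio ^ 2 * weight (σ.arr 0) (i + 1) (p + s + 1)) v1
        ((fr 14 (by norm_num) (by norm_num) (by norm_num)).trans g14) f12 f13 s1 ?_ ?_ ?_ ?_ hSM
        ?_ ?_).mono ?_)
      · intro j hj hj'
        rw [fa]
        exact gB j hj hj'.le
      · omega
      · omega
      · omega
      · rw [e0]
        omega
      · rw [fa, ← weight_succ_right _ hkpos]
        exact gX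
      rintro σ₂ u₂ ⟨k', ct, bnd', hu₂, h14₂, h13₂, h0₂, v₂, e₂, s₂, hb0, hbk, hct, hgap, hk', hX₂,
        r₂, a₂⟩
      have h11₂ : σ₂.reg 11 = i := (r₂ 11 (by norm_num) (by norm_num) (by norm_num)).trans f11
      have h12₂ : σ₂.reg 12 = σ'.arr 0 i :=
        (r₂ 12 (by norm_num) (by norm_num) (by norm_num)).trans f12
      have h3₂ : σ₂.arr 3 = σ.arr 3 := by
        rw [a₂ 3 (by norm_num) (by norm_num) (by norm_num), fa, a3]
      have h6₂ : σ₂.arr 6 = σ'.arr 6 := by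
        rw [a₂ 6 (by norm_num) (by norm_num) (by norm_num), fa]
      have hleaf₂ : σ₂.Computes n τ (σ.arr 3 i) (pos i) (bnd' k') (σ'.arr 0 i) := by
        rw [hbk, gbk, a0]
        exact (hleaf.extend e1).extend e₂
      refine (pushLeaf_spec h14₂ h11₂ (by omega) (by omega) ?_ (by omega) (by omega)).mono ?_
      · have := hleaf₂.lt
        rw [h3₂]
        omega
      rintro σ₃ u₃ ⟨hu₃, h14₃, h5₃, h6₃, r₃, a₃⟩
      have e₃ : σ₃.Extends σ₂ := .of_eq (r₃ 0 (by norm_num)) (a₃ 1 (by norm_num) (by norm_num))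
        (a₃ 2 (by norm_num) (by norm_num))
      rw [h13₂, h12₂] at h6₃
      rw [h3₂] at h5₃
      have s₃ := s₂.push (l := max ct (σ'.arr 0 i + 1)) (le_max_left _ _) hgap (le_max_right _ _)
        hleaf₂ e₃ h5₃ h6₃
      have hpos' := s₂.pos
      refine ⟨⟨i, k' + 1, Function.update bnd' (k' + 1) (pos i), ?_, by omega, by omega, ?_, h14₃,
        ?_, ⟨?_, ?_, ?_⟩, ((e₃.trans e₂).trans e1).trans ge, ?_, ?_, ?_, ?_, ?_, ?_, ?_⟩, ?_⟩
      · simp only [Expr.nodes]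
        omega
      · rw [r₃ 11 (by norm_num), h11₂]
      · rw [r₃ 0 (by norm_num)]
        omega
      · rw [r₃ 1 (by norm_num), v₂.reg_one]
      · rw [h6₃, Function.update_of_ne (by omega), Function.update_of_ne (by omega), v₂.sentinel]
      · rw [r₃ 0 (by norm_num), a₃ 1 (by norm_num) (by norm_num),
          a₃ 2 (by norm_num) (by norm_num)]
        exact v₂.lt
      · rw [show σ₃.arr 6 (k' + 1) = σ'.arr 0 i by rw [h6₃, Function.update_self]]
        exact s₃
      · rw [Function.update_of_ne (by omega), hb0, gb0]
      · rw [Function.update_self]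
      · intro j hj hj'
        rw [h6₃, h6₂]
        rcases hj'.lt_or_eq with hj' | rfl
        · rw [Function.update_of_ne (by omega)]
          rcases (Nat.lt_succ_iff.1 hj').lt_or_eq with hj' | rfl
          · rw [Function.update_of_ne (by omega)]
            have := gB j hj (by omega)
            omega
          · rw [Function.update_self]
            omega
        · rw [Function.update_self]
          omega
      · rw [weight_succ_right _ (by omega), weight_succ_right _ hpos',
          weight_congr (B := σ₂.arr 6) (fun x _ hx => by
            rw [h6₃, Function.update_of_ne (by omega), Function.update_of_ne (by omega)]),
          h6₃, Function.update_self, Function.update_of_ne (by omega), Function.update_self,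
          weight_succ_left (σ.arr 0) (by omega : i < p + s + 1), a0]
        have := Real.goldenRatio_sq
        rw [a0] at hX₂
        rw [pow_succ Real.goldenRatio (σ.arr 0 i)] at hX₂
        rw [mul_add]
        nlinarith [golden_pow_pos (σ.arr 0 i)]
      · intro x hx hx'
        rw [r₃ x (by omega), r₂ x (by omega) (by omega) (by omega),
          fr x (by omega) (by omega) (by omega), gr x hx hx']
      · intro b h1 h2 h5 h6
        rw [a₃ b h5 h6, a₂ b h1 h2 h5, fa, ga b h1 h2 h5 h6]
      · rw [r₃ 11 (by norm_num), h11₂, g11]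
        omega
    · intro hlt
      simp only [Expr.eval, g2, g11] at hlt
      obtain rfl : i = p := by omega
      refine ⟨k, bnd, ?_, g14, ?_, gv, ge, gs, gb0, gbk, ?_, gX, gr, ga⟩
      · simp only [Expr.nodes]
        omega
      · omega
      · intro j hj hj'
        have := gB j hj hj'
        omega
  · have hl := hcomp (p + s) (by omega) le_rfl
    have hH' := hH (p + s) (by omega) le_rfl
    refine ⟨p + s, 1, fun j => if j = 0 then pos (p + s + 1) else pos (p + s), by omega, by omega,
      le_rfl, h11, h14, by omega, hσ, .refl σ, ⟨le_rfl, by omega, by omega, ?_, ?_⟩, by simp,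
      by simp, ?_, ?_, fun _ _ _ => rfl, fun _ _ _ _ _ => rfl⟩
    · rw [h5, h6]
      simpa using hl
    · rw [h6, Nat.sub_self, hσ.sentinel]
      omega
    · intro j hj hj'
      obtain rfl : j = 1 := by omega
      omega
    · have h0 := golden_pow_pos (σ.arr 0 (p + s))
      simp only [weight, Nat.Ico_succ_singleton, Finset.sum_singleton, h6]
      have := Real.goldenRatio_sq
      have := Real.goldenRatio_pos
      nlinarith

/-- By the gaps, the stack collapses onto its lowest node, at the cost of one level. -/
theorem flushLoop_spec {procs : List Cmd} {M n S k : ℕ} {τ bnd : ℕ → ℕ} {σ : State}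
    (hσ : σ.Valid n S) (h14 : σ.reg 14 = k) (hst : σ.Stack n τ k (σ.arr 6 k) bnd)
    (hSM : S ≤ M) (hM : n + σ.reg 0 + k ≤ M) :
    Spec procs M flushLoop σ fun σ' u => u ≤ 100 * k + 10 ∧ σ'.reg 0 + 1 = σ.reg 0 + k ∧
      σ'.Valid n S ∧ σ'.Extends σ ∧
      σ'.Computes n τ (σ'.arr 5 1) (bnd k) (bnd 0) (σ'.arr 6 1) ∧ σ'.arr 6 1 ≤ σ.arr 6 1 + 1 ∧
      (∀ x, 1 ≤ x → x ≤ 10 → σ'.reg x = σ.reg x) ∧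
      (∀ b, b ≠ 1 → b ≠ 2 → b ≠ 5 → b ≠ 6 → σ'.arr b = σ.arr b) := by
  refine Spec.loop (fun σ' u => ∃ k' bnd', u + 100 * k' ≤ 100 * k ∧ k' ≤ k ∧ σ'.reg 14 = k' ∧
      σ'.reg 0 + k' = σ.reg 0 + k ∧ σ'.Valid n S ∧ σ'.Extends σ ∧
      σ'.Stack n τ k' (σ'.arr 6 k') bnd' ∧ bnd' 0 = bnd 0 ∧ bnd' k' = bnd k ∧
      σ'.arr 6 1 ≤ σ.arr 6 1 + 1 ∧ (2 ≤ k' → σ'.arr 6 1 = σ.arr 6 1) ∧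
      (∀ x, 1 ≤ x → x ≤ 10 → σ'.reg x = σ.reg x) ∧
      (∀ b, b ≠ 1 → b ≠ 2 → b ≠ 5 → b ≠ 6 → σ'.arr b = σ.arr b)) (fun σ' => σ'.reg 14) ?_ ?_
  · rintro σ' u ⟨k', bnd', hu, hk, g14, g0, gv, ge, gs, gb0, gbk, gle, geq, gr, ga⟩
    refine ⟨?_, ?_, ?_, ?_⟩
    · have := gs.pos
      simp only [Expr.Small]
      omega
    · simp only [Expr.Small, g14]
      omega
    · intro hlt
      simp only [Expr.eval, g14] at hlt
      obtain ⟨l, rfl⟩ : ∃ l, k' = l + 1 := ⟨k' - 1, by omega⟩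
      have hl : 1 ≤ l := by omega
      have h5 := gs.lt (j := l) hl (by omega)
      have h5' := gs.lt (j := l + 1) (by omega) le_rfl
      have h6 := gs.gap l hl (by omega)
      have h6' := gs.le_zero (l - 1) (by omega)
      rw [gv.sentinel] at h6'
      refine (flushStep_spec g14 gv.reg_one (by omega) (by omega) (by omega) (by omega)
        (by omega)).mono ?_
      rintro σ'' v ⟨hv, f0, f14, f5, f6, fr, fa⟩
      refine ⟨⟨l, Function.update bnd' l (bnd' (l + 1)), ?_, by omega, f14, ?_,
        ⟨?_, ?_, f0.lt gv h5 h5'⟩, f0.extends_.trans ge, ?_, ?_, ?_, ?_, ?_, ?_, ?_⟩, ?_⟩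
      · simp only [Expr.nodes]
        omega
      · rw [f0.reg]
        omega
      · rw [fr 1 (by norm_num) (by norm_num), gv.reg_one]
      · rw [f6, Function.update_of_ne (by omega), gv.sentinel]
      · rw [show σ''.arr 6 l = σ'.arr 6 l + 1 by rw [f6, Function.update_self]]
        exact gs.merge hl f0 f5 (fun j hj => by rw [f6, Function.update_of_ne (by omega)])
      · rw [Function.update_of_ne (by omega), gb0]
      · rw [Function.update_self, gbk]
      · rw [f6, ← geq (by omega)]
        rcases hl.lt_or_eq with hl | rfl
        · rw [Function.update_of_ne (by omega)]
          omega
        · rw [Function.update_self]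
      · intro h
        rw [f6, Function.update_of_ne (by omega), geq (by omega)]
      · intro x hx hx'
        rw [fr x (by omega) (by omega), gr x hx hx']
      · intro b h1 h2 h5 h6
        rw [fa b h1 h2 h5 h6, ga b h1 h2 h5 h6]
      · rw [f14, g14]
        omega
    · intro hlt
      simp only [Expr.eval, g14] at hlt
      have hpos := gs.pos
      obtain rfl : k' = 1 := by omega
      refine ⟨?_, g0, gv, ge, ?_, gle, gr, ga⟩
      · simp only [Expr.nodes]
        omega
      · have := gs.comp_top
        rwa [Nat.sub_self, gb0, gbk] at this
  · exact ⟨k, bnd, by omega, le_rfl, h14, rfl, hσ, .refl σ, hst, rfl, rfl, by omega,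
      fun _ => rfl, fun _ _ _ => rfl, fun _ _ _ _ _ => rfl⟩

/-- The level of the product exceeds the logarithm to base `φ` of the weight by at most `3`: the
stack costs `2`, and the final merges cost `1`. -/
theorem groupProduct_spec {procs : List Cmd} {M n S p s H : ℕ} {τ pos : ℕ → ℕ} {σ : State}
    (hσ : σ.Valid n S) (h2 : σ.reg 2 = p) (h4 : σ.reg 4 = s)
    (hcomp : ∀ x, p ≤ x → x ≤ p + s →
      σ.Computes n τ (σ.arr 3 x) (pos x) (pos (x + 1)) (σ.arr 0 x))
    (hH : ∀ x, p ≤ x → x ≤ p + s → σ.arr 0 x ≤ H) (hS : H + s + 5 ≤ S) (hSM : S ≤ M)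
    (hM : n + σ.reg 0 + s + 1 ≤ M) (hp : p + s + 1 ≤ M) :
    Spec procs M groupProduct σ fun σ' u => u ≤ 400 * (s + 1) ∧ σ'.reg 0 = σ.reg 0 + s ∧
      σ'.Valid n S ∧ σ'.Extends σ ∧
      σ'.Computes n τ (σ'.arr 5 1) (pos p) (pos (p + s + 1)) (σ'.arr 6 1) ∧
      σ'.arr 6 1 ≤ H + s + 3 ∧
      Real.goldenRatio ^ σ'.arr 6 1 ≤ Real.goldenRatio ^ 3 * weight (σ.arr 0) p (p + s + 1) ∧
      (∀ x, 1 ≤ x → x ≤ 10 → σ'.reg x = σ.reg x) ∧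
      (∀ b, b ≠ 1 → b ≠ 2 → b ≠ 5 → b ≠ 6 → σ'.arr b = σ.arr b) := by
  have hl := (hcomp (p + s) (by omega) le_rfl).lt
  have hl' := hH (p + s) (by omega) le_rfl
  refine Spec.seq ((initStack_spec h2 h4 hp (by omega) (by omega)).mono ?_)
  rintro σ₁ u₁ ⟨hu₁, h11₁, h14₁, h5₁, h6₁, r₁, a₁⟩
  have e₁ : σ₁.Extends σ := .of_eq (r₁ 0 (by norm_num) (by norm_num))
    (a₁ 1 (by norm_num) (by norm_num)) (a₁ 2 (by norm_num) (by norm_num))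
  have h0₁ : σ₁.arr 0 = σ.arr 0 := a₁ 0 (by norm_num) (by norm_num)
  have h3₁ : σ₁.arr 3 = σ.arr 3 := a₁ 3 (by norm_num) (by norm_num)
  have hr0 : σ₁.reg 0 = σ.reg 0 := r₁ 0 (by norm_num) (by norm_num)
  have v₁ : σ₁.Valid n S := ⟨(r₁ 1 (by norm_num) (by norm_num)).trans hσ.reg_one,
    by rw [h6₁, Function.update_of_ne (by norm_num), hσ.sentinel],
    by rw [hr0, a₁ 1 (by norm_num) (by norm_num), a₁ 2 (by norm_num) (by norm_num)]; exact hσ.lt⟩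
  refine Spec.seq ((leafLoop_spec (H := H) (τ := τ) (pos := pos) v₁
    ((r₁ 2 (by norm_num) (by norm_num)).trans h2) h11₁ h14₁
    (by rw [h5₁, Function.update_self, h3₁]) (by rw [h6₁, Function.update_self, h0₁]) ?_ ?_ hS hSM
    (by omega) hp).mono ?_)
  · intro x hx hx'
    rw [h3₁, h0₁]
    exact (hcomp x hx hx').extend e₁
  · intro x hx hx'
    rw [h0₁]
    exact hH x hx hx'
  rintro σ₂ u₂ ⟨k, bnd, hu₂, h14₂, h0₂, v₂, e₂, s₂, hb0, hbk, hB, hX, r₂, a₂⟩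
  have hk := s₂.pos
  refine (flushLoop_spec v₂ h14₂ s₂ hSM (by omega)).mono ?_
  rintro σ₃ u₃ ⟨hu₃, h0₃, v₃, e₃, hc, hle, r₃, a₃⟩
  refine ⟨by omega, by omega, v₃, (e₃.trans e₂).trans e₁, ?_, ?_, ?_, ?_, ?_⟩
  · rwa [hb0, hbk] at hc
  · have := hB 1 le_rfl hk
    omega
  · have h1 := pow_le_weight (σ₂.arr 6) (le_refl 1) (by omega : 1 < k + 1)
    have h2 := golden_pow_le hle
    have h3 := Real.goldenRatio_pos
    rw [h0₁] at hX
    rw [pow_succ] at h2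
    calc _ ≤ _ := h2
      _ ≤ Real.goldenRatio ^ 2 * weight (σ.arr 0) p (p + s + 1) * Real.goldenRatio :=
        mul_le_mul_of_nonneg_right (h1.trans hX) h3.le
      _ = _ := by ring
  · intro x hx hx'
    rw [r₃ x hx hx', r₂ x hx hx', r₁ x (by omega) (by omega)]
  · intro b h1 h2 h5 h6
    rw [a₃ b h1 h2 h5 h6, a₂ b h1 h2 h5 h6, a₁ b h5 h6]

/-! ### Rows of gates -/

/-- Replaces the node in entry `x` of array `3`, where `x` is in register `11`, by its product with
the node in entry `y`, and increments register `11`. -/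
def rowStep (y : Expr) : Cmd :=
  block [appendGate (.arr 3 (.reg 11)) (.arr 3 y) 3 (.reg 11),
    .assign 11 (.add (.reg 11) (.const 1))]

/-- Multiplies the nodes from register `2` on, as many as register `3` says, by the node before the
one to which register `6` points. -/
def combine : Cmd :=
  block [.assign 11 (.reg 2), block [.assign 12 (.add (.reg 2) (.reg 3)),
    .loop (.reg 11) (.reg 12) (rowStep (.sub (.reg 6) (.const 1)))]]

/-- Replaces the nodes from register `2` on, as many as register `3` says, by their prefix
products, one after the other. -/
def chain : Cmd :=
  block [.assign 11 (.add (.reg 2) (.const 1)), block [.assign 12 (.add (.reg 2) (.reg 3)),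
    .loop (.reg 11) (.reg 12) (rowStep (.sub (.reg 11) (.const 1)))]]

theorem rowStep_spec {procs : List Cmd} {M n x y : ℕ} {e : Expr} {σ : State}
    (h11 : σ.reg 11 = x) (he : ∀ z, e.eval (σ.setArr 1 (σ.reg 0) z) = y)
    (hy : ∀ z, e.Small M (σ.setArr 1 (σ.reg 0) z))
    (hn : σ.reg 1 = n) (h0 : n + σ.reg 0 + 1 ≤ M) (hx : x + 1 ≤ M) (h3 : σ.arr 3 x ≤ M)
    (h3' : σ.arr 3 y ≤ M) :
    Spec procs M (rowStep e) σ fun σ' u => u ≤ 40 + e.nodes ∧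
      σ'.Appends σ (σ.arr 3 x) (σ.arr 3 y) ∧ σ'.reg 11 = x + 1 ∧
      σ'.arr 3 = Function.update (σ.arr 3) x (n + σ.reg 0) ∧
      (∀ x, x ≠ 0 → x ≠ 11 → σ'.reg x = σ.reg x) ∧
      (∀ a, a ≠ 1 → a ≠ 2 → a ≠ 3 → σ'.arr a = σ.arr a) := by
  refine Spec.straight ?_
  simp +contextual [rowStep, appendGate, block, Cmd.wp, Expr.Small, Expr.eval,
    Cmd.steps, Expr.nodes, h11, hn, State.appends_iff, he, hy]
  omega

/-- What a row of gates does to the entries `lo ≤ x < hi` of array `3`: the entry `x` is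
multiplied by the entry `y x`, which has its final value at that time. -/
theorem rowLoop_spec {procs : List Cmd} {M n S lo hi d : ℕ} {τ : ℕ → ℕ} {e : Expr} {σ : State}
    {y i k j : ℕ → ℕ} {a : ℕ → ℝ} (hσ : σ.Valid n S) (hlh : lo ≤ hi)
    (h11 : σ.reg 11 = lo) (h12 : σ.reg 12 = hi) (hd : e.nodes ≤ d)
    (hy : ∀ σ' : State, (∀ x, 1 ≤ x → x ≤ 10 → σ'.reg x = σ.reg x) →
      lo ≤ σ'.reg 11 → σ'.reg 11 < hi → e.Small M σ' ∧ e.eval σ' = y (σ'.reg 11))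
    (hl : ∀ x, lo ≤ x → x < hi → σ.Computes n τ (σ.arr 3 x) (k x) (j x) (a x - 1))
    (hr : ∀ σ' : State, σ'.Extends σ → ∀ x, lo ≤ x → x < hi →
      (∀ z, z < lo ∨ hi ≤ z → σ'.arr 3 z = σ.arr 3 z) →
      (∀ z, lo ≤ z → z < x → σ'.Computes n τ (σ'.arr 3 z) (i z) (j z) (a z)) →
      σ'.Computes n τ (σ'.arr 3 (y x)) (i x) (k x) (a x - 2))
    (hM : n + σ.reg 0 + (hi - lo) ≤ M) (hM' : hi ≤ M) :
    Spec procs M (.loop (.reg 11) (.reg 12) (rowStep e)) σ fun σ' u =>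
      u ≤ (50 + d) * (hi - lo) + 3 ∧ σ'.reg 0 = σ.reg 0 + (hi - lo) ∧ σ'.Valid n S ∧
      σ'.Extends σ ∧
      (∀ x, lo ≤ x → x < hi → σ'.Computes n τ (σ'.arr 3 x) (i x) (j x) (a x)) ∧
      (∀ z, z < lo ∨ hi ≤ z → σ'.arr 3 z = σ.arr 3 z) ∧
      (∀ x, 1 ≤ x → x ≤ 10 → σ'.reg x = σ.reg x) ∧
      (∀ b, b ≠ 1 → b ≠ 2 → b ≠ 3 → σ'.arr b = σ.arr b) := by
  refine Spec.loop (fun σ' u => ∃ x, lo ≤ x ∧ x ≤ hi ∧ σ'.reg 11 = x ∧ σ'.reg 12 = hi ∧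
      u ≤ (50 + d) * (x - lo) ∧ σ'.reg 0 = σ.reg 0 + (x - lo) ∧ σ'.Valid n S ∧
      σ'.Extends σ ∧
      (∀ z, lo ≤ z → z < x → σ'.Computes n τ (σ'.arr 3 z) (i z) (j z) (a z)) ∧
      (∀ z, z < lo ∨ x ≤ z → σ'.arr 3 z = σ.arr 3 z) ∧
      (∀ x, 1 ≤ x → x ≤ 10 → σ'.reg x = σ.reg x) ∧
      (∀ b, b ≠ 1 → b ≠ 2 → b ≠ 3 → σ'.arr b = σ.arr b))
    (fun σ' => σ'.reg 12 - σ'.reg 11) ?_ ?_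
  · rintro σ' u ⟨x, hlx, hxh, g11, g12, hu, g0, gv, ge, gc, g3, gr, ga⟩
    refine ⟨?_, ?_, ?_, ?_⟩
    · simp only [Expr.Small, g11]
      omega
    · simp only [Expr.Small, g12]
      omega
    · intro hlt
      simp only [Expr.eval, g11, g12] at hlt
      have hleft := (hl x hlx hlt).extend ge
      rw [← g3 x (.inr le_rfl)] at hleft
      have hright := hr σ' ge x hlx hlt (fun z hz => g3 z (by omega)) gc
      have hlt1 := hleft.lt
      have hlt2 := hright.lt
      refine (rowStep_spec (y := y x) g11 (fun z => ?_) (fun z => ?_) gv.reg_one (by omega)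
        (by omega) (by omega) (by omega)).mono ?_
      · rw [(hy (σ'.setArr 1 (σ'.reg 0) z) gr (by simp; omega) (by simp; omega)).2]
        simp [g11]
      · exact (hy (σ'.setArr 1 (σ'.reg 0) z) gr (by simp; omega) (by simp; omega)).1
      rintro σ'' v ⟨hv, f0, f11, f3, fr, fa⟩
      have f12 : σ''.reg 12 = hi := (fr 12 (by norm_num) (by norm_num)).trans g12
      refine ⟨⟨x + 1, by omega, by omega, f11, f12, ?_, ?_, ⟨?_, ?_, f0.lt gv hlt1 hlt2⟩,
        f0.extends_.trans ge, ?_, ?_, ?_, ?_⟩, ?_⟩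
      · rw [show x + 1 - lo = x - lo + 1 by omega, mul_add]
        simp only [Expr.nodes]
        omega
      · rw [f0.reg]
        omega
      · rw [fr 1 (by norm_num) (by norm_num), gv.reg_one]
      · rw [fa 6 (by norm_num) (by norm_num) (by norm_num), gv.sentinel]
      · intro z hz hz'
        rw [f3]
        rcases (Nat.lt_succ_iff.1 hz').lt_or_eq with hz' | rfl
        · rw [Function.update_of_ne (by omega)]
          exact (gc z hz hz').extend f0.extends_
        · rw [Function.update_self]
          exact f0.computes hleft hright
      · intro z hz
        rw [f3, Function.update_of_ne (by omega), g3 z (by omega)]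
      · intro z hz hz'
        rw [fr z (by omega) (by omega), gr z hz hz']
      · intro z h1 h2 h3
        rw [fa z h1 h2 h3, ga z h1 h2 h3]
      · rw [f11, f12, g11, g12]
        omega
    · intro hlt
      simp only [Expr.eval, g11, g12] at hlt
      obtain rfl : x = hi := by omega
      refine ⟨?_, g0, gv, ge, gc, g3, gr, ga⟩
      simp only [Expr.nodes]
      omega
  · exact ⟨lo, le_rfl, hlh, h11, h12, by simp, by simp, hσ, .refl σ, fun _ _ _ => by omega,
      fun _ _ => rfl, fun _ _ _ => rfl, fun _ _ _ _ => rfl⟩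

/-- Setting the bounds of a row of gates. -/
theorem setRange_spec {procs : List Cmd} {M v w : ℕ} {σ : State} {e f : Expr}
    {c : Cmd} {Q : State → ℕ → Prop} (he : e.Small M σ) (hf : f.Small M (σ.setReg 11 v))
    (hv : e.eval σ = v) (hw : f.eval (σ.setReg 11 v) = w)
    (h : Spec procs M c ((σ.setReg 11 v).setReg 12 w) fun σ' u =>
      Q σ' (u + (2 + e.nodes + f.nodes))) :
    Spec procs M (block [.assign 11 e, block [.assign 12 f, c]]) σ Q := by
  subst hv hw
  refine Spec.seq (Spec.straight ⟨he, Spec.seq (Spec.straight ⟨hf, h.mono fun σ' u hQ => ?_⟩)⟩)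
  simp only [Cmd.steps]
  convert hQ using 1
  ring

/-- The nodes, of level at most `B - 1`, are multiplied by the node `σ.arr 3 (u - 1)`. -/
theorem combine_spec {procs : List Cmd} {M n S p e u i k : ℕ} {τ pos : ℕ → ℕ} {B : ℝ}
    {σ : State} (hσ : σ.Valid n S) (h2 : σ.reg 2 = p) (h3 : σ.reg 3 = e) (h6 : σ.reg 6 = u)
    (hpe : p + e < u)
    (hl : ∀ x, p ≤ x → x < p + e → σ.Computes n τ (σ.arr 3 x) k (pos (x + 1)) (B - 1))
    (hr : σ.Computes n τ (σ.arr 3 (u - 1)) i k (B - 2))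
    (hM : n + σ.reg 0 + e ≤ M) (hM' : u ≤ M) :
    Spec procs M combine σ fun σ' c => c ≤ 60 * e + 20 ∧ σ'.reg 0 = σ.reg 0 + e ∧
      σ'.Valid n S ∧ σ'.Extends σ ∧
      (∀ x, p ≤ x → x < p + e → σ'.Computes n τ (σ'.arr 3 x) i (pos (x + 1)) B) ∧
      (∀ z, z < p ∨ p + e ≤ z → σ'.arr 3 z = σ.arr 3 z) ∧
      (∀ x, 1 ≤ x → x ≤ 10 → σ'.reg x = σ.reg x) ∧
      (∀ b, b ≠ 1 → b ≠ 2 → b ≠ 3 → σ'.arr b = σ.arr b) := by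
  refine setRange_spec (v := p) (w := p + e) ?_ ?_ h2 ?_ ((rowLoop_spec
    (σ := (σ.setReg 11 p).setReg 12 (p + e)) (lo := p) (hi := p + e)
    (d := 3) (S := S) (y := fun _ => u - 1) (i := fun _ => i) (k := fun _ => k)
    (j := fun x => pos (x + 1)) (a := fun _ => B) (τ := τ) (n := n)
    ⟨hσ.reg_one, hσ.sentinel, hσ.lt⟩ (by omega) ?_ ?_ ?_ ?_ hl ?_ ?_ ?_).mono ?_)
  · simp only [Expr.Small]
    omega
  · simp [Expr.Small, Expr.eval, h2, h3]
    omega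
  · simp [Expr.eval, h2, h3]
  · simp
  · simp
  · simp [Expr.nodes]
  · intro σ' hr' h h'
    have e6 : σ'.reg 6 = u := by simpa [h6] using hr' 6 (by norm_num) (by norm_num)
    simp only [Expr.Small, Expr.eval, e6]
    exact ⟨⟨by omega, by omega⟩, trivial⟩
  · intro σ' hext x hx hx' h3' _
    rw [h3' (u - 1) (by omega)]
    exact hr.extend ⟨hext.le, hext.left, hext.right⟩
  · simp
    omega
  · omega
  rintro σ' c ⟨hc, h0, hv, he, hcomp, hz, hr', ha⟩
  refine ⟨?_, ?_, hv, ⟨he.le, he.left, he.right⟩, hcomp, hz, ?_, ha⟩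
  · simp only [Expr.nodes]
    omega
  · simpa using h0
  · intro x hx hx'
    rw [hr' x hx hx']
    simp [(show x ≠ 11 by omega), (show x ≠ 12 by omega)]

theorem chain_spec {procs : List Cmd} {M n S b m : ℕ} {τ pos : ℕ → ℕ} {A : ℝ}
    {σ : State} (hσ : σ.Valid n S) (h2 : σ.reg 2 = b) (h3 : σ.reg 3 = m) (hm : 1 ≤ m)
    (hcomp : ∀ x, b ≤ x → x < b + m →
      σ.Computes n τ (σ.arr 3 x) (pos x) (pos (x + 1)) A)
    (hM : n + σ.reg 0 + (m - 1) ≤ M) (hM' : b + m ≤ M) :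
    Spec procs M chain σ fun σ' c => c ≤ 60 * m + 20 ∧ σ'.reg 0 = σ.reg 0 + (m - 1) ∧
      σ'.Valid n S ∧ σ'.Extends σ ∧
      (∀ x, b ≤ x → x < b + m →
        σ'.Computes n τ (σ'.arr 3 x) (pos b) (pos (x + 1)) (A + 2 * ((m : ℝ) - 1))) ∧
      (∀ z, z < b ∨ b + m ≤ z → σ'.arr 3 z = σ.arr 3 z) ∧
      (∀ x, 1 ≤ x → x ≤ 10 → σ'.reg x = σ.reg x) ∧
      (∀ b, b ≠ 1 → b ≠ 2 → b ≠ 3 → σ'.arr b = σ.arr b) := by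
  refine setRange_spec (v := b + 1) (w := b + m) ?_ ?_ ?_ ?_ ((rowLoop_spec
    (σ := (σ.setReg 11 (b + 1)).setReg 12 (b + m)) (lo := b + 1)
    (hi := b + m) (d := 3) (S := S) (y := fun x => x - 1) (i := fun _ => pos b) (k := pos)
    (j := fun x => pos (x + 1)) (a := fun x => A + 2 * ((x : ℝ) - b)) (τ := τ) (n := n)
    ⟨hσ.reg_one, hσ.sentinel, hσ.lt⟩ (by omega) ?_ ?_ ?_ ?_ ?_ ?_ ?_ ?_).mono ?_)
  · simp only [Expr.Small, Expr.eval, h2]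
    omega
  · simp [Expr.Small, Expr.eval, h2, h3]
    omega
  · simp [Expr.eval, h2]
  · simp [Expr.eval, h2, h3]
  · simp
  · simp
  · simp [Expr.nodes]
  · intro σ' hr' h h'
    exact ⟨⟨h'.le.trans hM', by simp only [Expr.Small]; omega⟩, rfl⟩
  · intro x hx hx'
    have : (b : ℝ) + 1 ≤ x := by exact_mod_cast hx
    exact (hcomp x (by omega) hx').mono (by linarith)
  · intro σ' hext x hx hx' h3' hprev
    rcases Nat.lt_or_ge (b + 1) x with h | h
    · obtain ⟨z, rfl⟩ : ∃ z, x = z + 1 := ⟨x - 1, by omega⟩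
      refine (hprev z (by omega) (by omega)).mono ?_
      push_cast
      linarith
    · obtain rfl : x = b + 1 := by omega
      rw [Nat.add_sub_cancel, h3' b (by omega)]
      refine State.Computes.mono
        ((hcomp b le_rfl (by omega)).extend ⟨hext.le, hext.left, hext.right⟩) ?_
      push_cast
      linarith
  · simp
    omega
  · omega
  rintro σ' c ⟨hc, h0, hv, he, hc', hz, hr', ha⟩
  refine ⟨?_, ?_, hv, ⟨he.le, he.left, he.right⟩, ?_, fun z hz' => hz z (by omega), ?_, ha⟩
  · simp only [Expr.nodes]
    omega
  · simp only [State.reg_setReg] at h0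
    norm_num at h0
    omega
  · intro x hx hx'
    have h1 : (1 : ℝ) ≤ m := by exact_mod_cast hm
    rcases hx.lt_or_eq with hx | rfl
    · have : (x : ℝ) + 1 ≤ b + m := by exact_mod_cast hx'
      exact (hc' x hx hx').mono (by linarith)
    · rw [hz b (by omega)]
      exact State.Computes.mono
        ((hcomp b le_rfl (by omega)).extend ⟨he.le, he.left, he.right⟩) (by linarith)
  · intro x hx hx'
    rw [hr' x hx hx']
    simp [(show x ≠ 11 by omega), (show x ≠ 12 by omega)]

/-! ### The recursive procedure

The procedure `0` gets its arguments in the registers `8`, `9` and `10`: the nodes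
`σ.arr 3 x` for `b ≤ x < b + m`, with the levels `σ.arr 0 x`, are to be replaced by their prefix
products, and the arrays are free from the entry `top` on.  During a call, register `4` holds the
integer square root `s` of `m`, register `5` holds `top`, and the groups, of `s + 1` nodes each,
are traversed by the registers `2` (first node), `3` (number of nodes) and `6` (the node with the
product of the group).  Register `7` points to the end of the call stack in array `7`. -/

/-- Increments register `4` as long as the next square is at most register `3`; register `11` holds
the square of register `4` plus one. -/
def sqrtLoop : Cmd :=
  .loop (.reg 11) (.add (.reg 3) (.const 1))
    (block [.assign 4 (.add (.reg 4) (.const 1)),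
      .assign 11 (.add (.reg 11) (.add (.add (.reg 4) (.reg 4)) (.const 1)))])

/-- Leaves the integer square root of register `3` in register `4`. -/
def sqrt : Cmd :=
  .seq (block [.assign 4 (.const 0), .assign 11 (.const 1)]) sqrtLoop

/-- Stores the product of a group as a new node, with its level, and moves on to the next group;
register `3` holds the number of nodes that are left. -/
def storeProduct : Cmd :=
  block [.store 3 (.reg 6) (.arr 5 (.const 1)), .store 0 (.reg 6) (.arr 6 (.const 1)),
    .assign 6 (.add (.reg 6) (.const 1)),
    .assign 2 (.add (.reg 2) (.add (.reg 4) (.const 1))),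
    .assign 3 (.sub (.reg 3) (.add (.reg 4) (.const 1)))]

/-- Computes the products of all groups but the last. -/
def productLoop : Cmd :=
  .loop (.add (.reg 4) (.const 1)) (.reg 3) (.seq groupProduct storeProduct)

/-- Computes the prefix products of the group products. -/
def prefixProducts : Cmd :=
  .seq (block [.assign 8 (.reg 5), .assign 9 (.sub (.reg 6) (.reg 5)), .assign 10 (.reg 6)])
    (.call 0)

/-- Computes the prefix products of a group, and multiplies them by the product of all inputs
before the group. -/
def finishGroup : Cmd :=
  .seq (.seq (block [.assign 8 (.reg 2), .assign 9 (.reg 3), .assign 10 (.reg 6)]) (.call 0))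
    (.ite (.reg 5) (.reg 6) combine .skip)

/-- Moves back to the preceding group.  The product of all inputs up to the end of this group is
already known, and becomes the last entry of the group, so only `s` nodes are left. -/
def previousGroup : Cmd :=
  block [.assign 6 (.sub (.reg 6) (.const 1)),
    .assign 2 (.sub (.reg 2) (.add (.reg 4) (.const 1))),
    .store 3 (.add (.reg 2) (.reg 4)) (.arr 3 (.reg 6)), .assign 3 (.reg 4)]

/-- Finishes all groups but the last, from the highest to the lowest. -/
def groupLoop : Cmd :=
  .loop (.reg 5) (.reg 6) (.seq previousGroup finishGroup)

/-- Computes prefix products by splitting the nodes into groups.  After `productLoop`, the registers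
`2` and `3` describe the last group, which is finished first. -/
def split : Cmd :=
  .seq sqrt (.seq productLoop (.seq prefixProducts (.seq finishGroup groupLoop)))

/-- Saves the local registers on the call stack, and loads the arguments into them. -/
def save : Cmd :=
  block [.store 7 (.reg 7) (.reg 2), .store 7 (.add (.reg 7) (.const 1)) (.reg 3),
    .store 7 (.add (.reg 7) (.const 2)) (.reg 4), .store 7 (.add (.reg 7) (.const 3)) (.reg 5),
    .store 7 (.add (.reg 7) (.const 4)) (.reg 6), .assign 7 (.add (.reg 7) (.const 5)),
    .assign 2 (.reg 8), .assign 3 (.reg 9), .assign 5 (.reg 10), .assign 6 (.reg 10)]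

/-- Restores the local registers from the call stack. -/
def restore : Cmd :=
  block [.assign 7 (.sub (.reg 7) (.const 5)), .assign 2 (.arr 7 (.reg 7)),
    .assign 3 (.arr 7 (.add (.reg 7) (.const 1))), .assign 4 (.arr 7 (.add (.reg 7) (.const 2))),
    .assign 5 (.arr 7 (.add (.reg 7) (.const 3))), .assign 6 (.arr 7 (.add (.reg 7) (.const 4)))]

/-- The recursive procedure: a chain for at most five nodes, and groups otherwise. -/
def prefixProc : Cmd :=
  .seq save (.seq (.ite (.reg 3) (.const 6) chain split) restore)

theorem sqrt_spec {procs : List Cmd} {M m : ℕ} {σ : State} (h3 : σ.reg 3 = m) (hm : 1 ≤ m)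
    (hM : 4 * m + 4 ≤ M) :
    Spec procs M sqrt σ fun σ' u => ∃ s, u ≤ 30 * s + 20 ∧ σ'.reg 4 = s ∧ s * s ≤ m ∧
      m < (s + 1) * (s + 1) ∧ (∀ x, x ≠ 4 → x ≠ 11 → σ'.reg x = σ.reg x) ∧ σ'.arr = σ.arr := by
  refine Spec.seq (Spec.straight ?_)
  suffices H : Spec procs M sqrtLoop ((σ.setReg 4 0).setReg 11 1) fun σ' u => ∃ s,
      u ≤ 30 * s + 10 ∧ σ'.reg 4 = s ∧ s * s ≤ m ∧ m < (s + 1) * (s + 1) ∧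
      (∀ x, x ≠ 4 → x ≠ 11 → σ'.reg x = σ.reg x) ∧ σ'.arr = σ.arr by
    simp only [block, Cmd.wp, Expr.Small, Expr.eval]
    refine ⟨by omega, by omega, H.mono ?_⟩
    rintro σ' u ⟨s, hu, h⟩
    refine ⟨s, ?_, h⟩
    simp only [Cmd.steps, Expr.nodes]
    omega
  refine Spec.loop (fun σ' u => ∃ s, u ≤ 30 * s ∧ σ'.reg 4 = s ∧ σ'.reg 11 = (s + 1) * (s + 1) ∧
    s * s ≤ m ∧ (∀ x, x ≠ 4 → x ≠ 11 → σ'.reg x = σ.reg x) ∧ σ'.arr = σ.arr)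
    (fun σ' => σ'.reg 3 + 1 - σ'.reg 11) ?_ ?_
  · rintro σ' u ⟨s, hu, g4, g11, gs, gr, ga⟩
    have g3 : σ'.reg 3 = m := (gr 3 (by norm_num) (by norm_num)).trans h3
    have hs : s ≤ m := (Nat.le_mul_self s).trans gs
    refine ⟨?_, ?_, ?_, ?_⟩
    · simp only [Expr.Small, g11]
      nlinarith
    · simp only [Expr.Small, Expr.eval, g3]
      omega
    · intro hlt
      simp only [Expr.eval, g3, g11] at hlt
      have h1 : (s + 1 + 1) * (s + 1 + 1) = (s + 1) * (s + 1) + (s + 1 + (s + 1) + 1) := by ring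
      refine Spec.straight ?_
      simp only [block, Cmd.wp, Expr.Small, Expr.eval, State.reg_setReg, State.arr_setReg, g4, g11,
        g3, Cmd.steps, Expr.nodes]
      norm_num
      refine ⟨by omega, by omega, ⟨s + 1, by omega, rfl, by omega, by omega, ?_, ga⟩, by omega⟩
      intro x hx hx'
      simp [hx, hx', gr x hx hx']
    · intro hlt
      simp only [Expr.eval, g3, g11] at hlt
      refine ⟨s, ?_, g4, gs, by omega, gr, ga⟩
      simp only [Expr.nodes]
      omega
  · exact ⟨0, by simp, by simp, by simp, by simp, fun x hx hx' => by simp [hx, hx'], rfl⟩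

theorem storeProduct_spec {procs : List Cmd} {M s : ℕ} {σ : State} (h4 : σ.reg 4 = s)
    (h2 : σ.reg 2 + (s + 1) ≤ M) (h3 : σ.reg 3 ≤ M) (h6 : σ.reg 6 + 1 ≤ M) (h5 : σ.arr 5 1 ≤ M)
    (h6' : σ.arr 6 1 ≤ M) :
    Spec procs M storeProduct σ fun σ' u => u ≤ 40 ∧ σ'.reg 6 = σ.reg 6 + 1 ∧
      σ'.reg 2 = σ.reg 2 + (s + 1) ∧ σ'.reg 3 = σ.reg 3 - (s + 1) ∧
      σ'.arr 3 = Function.update (σ.arr 3) (σ.reg 6) (σ.arr 5 1) ∧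
      σ'.arr 0 = Function.update (σ.arr 0) (σ.reg 6) (σ.arr 6 1) ∧
      (∀ x, x ≠ 2 → x ≠ 3 → x ≠ 6 → σ'.reg x = σ.reg x) ∧
      (∀ a, a ≠ 0 → a ≠ 3 → σ'.arr a = σ.arr a) := by
  refine Spec.straight ?_
  simp +contextual [storeProduct, block, Cmd.wp, Expr.Small, Expr.eval, Cmd.steps, Expr.nodes, h4]
  omega

theorem previousGroup_spec {procs : List Cmd} {M s p u : ℕ} {σ : State} (h4 : σ.reg 4 = s)
    (h2 : σ.reg 2 = p + (s + 1)) (h6 : σ.reg 6 = u + 1) (hp : p + (s + 1) ≤ M) (hu : u + 1 ≤ M)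
    (h3 : σ.arr 3 u ≤ M) :
    Spec procs M previousGroup σ fun σ' c => c ≤ 40 ∧ σ'.reg 6 = u ∧
      σ'.reg 2 = p ∧ σ'.reg 3 = s ∧
      σ'.arr 3 = Function.update (σ.arr 3) (p + s) (σ.arr 3 u) ∧
      (∀ x, x ≠ 2 → x ≠ 3 → x ≠ 6 → σ'.reg x = σ.reg x) ∧
      (∀ a, a ≠ 3 → σ'.arr a = σ.arr a) := by
  refine Spec.straight ?_
  simp +contextual [previousGroup, block, Cmd.wp, Expr.Small, Expr.eval, Cmd.steps, Expr.nodes, h4,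
    h2, h6]
  omega

theorem save_spec {procs : List Cmd} {M sp : ℕ} {σ : State} (h7 : σ.reg 7 = sp)
    (hsp : sp + 5 ≤ M) (hM : ∀ x, 2 ≤ x → x ≤ 10 → σ.reg x ≤ M) :
    Spec procs M save σ fun σ' u => u ≤ 60 ∧ σ'.reg 7 = sp + 5 ∧ σ'.reg 2 = σ.reg 8 ∧
      σ'.reg 3 = σ.reg 9 ∧ σ'.reg 5 = σ.reg 10 ∧ σ'.reg 6 = σ.reg 10 ∧ σ'.reg 4 = σ.reg 4 ∧
      σ'.reg 1 = σ.reg 1 ∧ σ'.reg 0 = σ.reg 0 ∧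
      (∀ x < sp, σ'.arr 7 x = σ.arr 7 x) ∧
      (σ'.arr 7 sp = σ.reg 2 ∧ σ'.arr 7 (sp + 1) = σ.reg 3 ∧ σ'.arr 7 (sp + 2) = σ.reg 4 ∧
        σ'.arr 7 (sp + 3) = σ.reg 5 ∧ σ'.arr 7 (sp + 4) = σ.reg 6) ∧
      (∀ a, a ≠ 7 → σ'.arr a = σ.arr a) := by
  have := hM 2 (by norm_num) (by norm_num)
  have := hM 3 (by norm_num) (by norm_num)
  have := hM 4 (by norm_num) (by norm_num)
  have := hM 5 (by norm_num) (by norm_num)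
  have := hM 6 (by norm_num) (by norm_num)
  have := hM 8 (by norm_num) (by norm_num)
  have := hM 9 (by norm_num) (by norm_num)
  have := hM 10 (by norm_num) (by norm_num)
  refine Spec.straight ?_
  simp +contextual [save, block, Cmd.wp, Expr.Small, Expr.eval, Cmd.steps, Expr.nodes, h7,
    Function.update_apply]
  refine ⟨by omega, by omega, by omega, by omega, by omega, by omega, by omega, by omega, by omega,
    by omega, by omega, by omega, by omega, by omega, ?_⟩
  intro x hx
  rw [if_neg (by omega), if_neg (by omega), if_neg (by omega), if_neg (by omega),
    if_neg (by omega)]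

theorem restore_spec {procs : List Cmd} {M sp : ℕ} {σ : State} (h7 : σ.reg 7 = sp + 5)
    (hsp : sp + 5 ≤ M) (hM : ∀ x, x < 5 → σ.arr 7 (sp + x) ≤ M) :
    Spec procs M restore σ fun σ' u => u ≤ 60 ∧ σ'.reg 7 = sp ∧ σ'.reg 2 = σ.arr 7 sp ∧
      σ'.reg 3 = σ.arr 7 (sp + 1) ∧ σ'.reg 4 = σ.arr 7 (sp + 2) ∧ σ'.reg 5 = σ.arr 7 (sp + 3) ∧
      σ'.reg 6 = σ.arr 7 (sp + 4) ∧ σ'.reg 1 = σ.reg 1 ∧ σ'.reg 0 = σ.reg 0 ∧ σ'.arr = σ.arr := by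
  have h0 := hM 0 (by norm_num)
  have := hM 1 (by norm_num)
  have := hM 2 (by norm_num)
  have := hM 3 (by norm_num)
  have := hM 4 (by norm_num)
  rw [add_zero] at h0
  refine Spec.straight ?_
  simp +contextual [restore, block, Cmd.wp, Expr.Small, Expr.eval, Cmd.steps, Expr.nodes, h7]
  omega

/-- The situation in which the prefix products of the nodes `σ.arr 3 x` for `b ≤ x < b + m` can be
computed. The node `x` computes the block of inputs from `pos x` to `pos (x + 1)`, the levels are
at most `H`, at most `k` entries of the call stack are needed, and all numbers that will occur are
at most `M`. The bound `H + 2 * m` leaves room for the levels that arise in recursive calls. -/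
structure Ready (n : ℕ) (τ : ℕ → ℕ) (S M H : ℕ) (pos : ℕ → ℕ) (b m top k : ℕ) (σ : State) :
    Prop where
  valid : σ.Valid n S
  pos_m : 1 ≤ m
  le_top : b + m ≤ top
  comp : ∀ x, b ≤ x → x < b + m →
    σ.Computes n τ (σ.arr 3 x) (pos x) (pos (x + 1)) (σ.arr 0 x)
  level : ∀ x, b ≤ x → x < b + m → σ.arr 0 x ≤ H
  le_S : H + 2 * m ≤ S
  le_M : S ≤ M
  gates_le : n + σ.reg 0 + gates m ≤ M
  top_le : top + m ≤ M
  stack_le : σ.reg 7 + k ≤ M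
  reg_le : ∀ x, 2 ≤ x → x ≤ 7 → σ.reg x ≤ M

/-- The state `σ'` arises from `σ` by computing the prefix products of the nodes `σ.arr 3 x` for
`b ≤ x < b + m`. -/
structure Done (n : ℕ) (τ : ℕ → ℕ) (S : ℕ) (pos : ℕ → ℕ) (b m top : ℕ) (σ σ' : State) : Prop where
  valid : σ'.Valid n S
  ext : σ'.Extends σ
  count : σ'.reg 0 = σ.reg 0 + gates m
  reg_seven : σ'.reg 7 = σ.reg 7
  arr_three : ∀ x, x < b ∨ (b + m ≤ x ∧ x < top) → σ'.arr 3 x = σ.arr 3 x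
  arr_zero : ∀ x < top, σ'.arr 0 x = σ.arr 0 x
  arr_seven : ∀ x < σ.reg 7, σ'.arr 7 x = σ.arr 7 x
  comp : ∀ x, b ≤ x → x < b + m → σ'.Computes n τ (σ'.arr 3 x) (pos b) (pos (x + 1))
    (Real.logb Real.goldenRatio (weight (σ.arr 0) b (b + m)) + 5 * loglog m + 2)

theorem State.Valid.congr {σ σ' : State} {n S : ℕ} (h : σ.Valid n S)
    (hr : ∀ x ≤ 7, σ'.reg x = σ.reg x) (ha : σ'.arr = σ.arr) : σ'.Valid n S :=
  ⟨by rw [hr 1 (by norm_num), h.reg_one], by rw [ha, h.sentinel],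
    by rw [hr 0 (by norm_num), ha]; exact h.lt⟩

theorem State.Extends.of_congr {σ σ' : State}
    (hr : ∀ x ≤ 7, σ'.reg x = σ.reg x) (ha : σ'.arr = σ.arr) : σ'.Extends σ :=
  .of_eq (hr 0 (by norm_num)) (by rw [ha]) (by rw [ha])

section

variable {n S M H b m top k : ℕ} {τ pos : ℕ → ℕ} {σ σ' σ'' : State}

theorem Ready.congr (h : Ready n τ S M H pos b m top k σ) (hr : ∀ x ≤ 7, σ'.reg x = σ.reg x)
    (ha : σ'.arr = σ.arr) : Ready n τ S M H pos b m top k σ' where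
  valid := h.valid.congr hr ha
  pos_m := h.pos_m
  le_top := h.le_top
  comp x hx hx' := by
    rw [ha]
    exact (h.comp x hx hx').extend (.of_congr hr ha)
  level := by
    rw [ha]
    exact h.level
  le_S := h.le_S
  le_M := h.le_M
  gates_le := by
    rw [hr 0 (by norm_num)]
    exact h.gates_le
  top_le := h.top_le
  stack_le := by
    rw [hr 7 (by norm_num)]
    exact h.stack_le
  reg_le x hx hx' := by
    rw [hr x hx']
    exact h.reg_le x hx hx'

theorem Done.congr (h : Done n τ S pos b m top σ' σ'') (hr : ∀ x ≤ 7, σ'.reg x = σ.reg x)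
    (ha : σ'.arr = σ.arr) : Done n τ S pos b m top σ σ'' where
  valid := h.valid
  ext := h.ext.trans (.of_congr hr ha)
  count := by rw [h.count, hr 0 (by norm_num)]
  reg_seven := by rw [h.reg_seven, hr 7 (by norm_num)]
  arr_three x hx := by rw [h.arr_three x hx, ha]
  arr_zero x hx := by rw [h.arr_zero x hx, ha]
  arr_seven x hx := by rw [h.arr_seven x (by rwa [hr 7 (by norm_num)]), ha]
  comp := by
    rw [← ha]
    exact h.comp

end

/-- The procedure `0` computes prefix products of `m` nodes in at most `E` steps per node. It uses
at most `10 * m` entries of the call stack: a frame has `5` entries, and the number of nodes halves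
with each recursive call. -/
def ProcSpec (procs : List Cmd) (M n : ℕ) (τ : ℕ → ℕ) (S m E : ℕ) : Prop :=
  ∀ (H : ℕ) (pos : ℕ → ℕ) (b top : ℕ) (σ : State), σ.reg 8 = b → σ.reg 9 = m → σ.reg 10 = top →
    Ready n τ S M H pos b m top (10 * m) σ → Spec procs M (.call 0) σ fun σ' u => u ≤ E * m ∧
      Done n τ S pos b m top σ σ' ∧ ∀ x, 2 ≤ x → x ≤ 6 → σ'.reg x = σ.reg x

/-- Passing the arguments and calling the procedure `0`. -/
theorem callProc_spec {procs : List Cmd} {M n S m E H b top : ℕ} {τ pos : ℕ → ℕ} {σ : State}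
    (h : ProcSpec procs M n τ S m E) {e₁ e₂ e₃ : Expr}
    (h₁ : e₁.Small M σ) (h₂ : e₂.Small M (σ.setReg 8 b))
    (h₃ : e₃.Small M ((σ.setReg 8 b).setReg 9 m)) (hb : e₁.eval σ = b)
    (hm : e₂.eval (σ.setReg 8 b) = m) (ht : e₃.eval ((σ.setReg 8 b).setReg 9 m) = top)
    (hready : Ready n τ S M H pos b m top (10 * m) σ) :
    Spec procs M (.seq (block [.assign 8 e₁, .assign 9 e₂, .assign 10 e₃]) (.call 0)) σ
      fun σ' u => u ≤ E * m + (3 + e₁.nodes + e₂.nodes + e₃.nodes) ∧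
        Done n τ S pos b m top σ σ' ∧ ∀ x, 2 ≤ x → x ≤ 6 → σ'.reg x = σ.reg x := by
  refine Spec.seq (Spec.straight ?_)
  simp only [block, Cmd.wp, hb, hm, ht]
  refine ⟨h₁, h₂, h₃, ?_⟩
  have hr : ∀ x ≤ 7, (((σ.setReg 8 b).setReg 9 m).setReg 10 top).reg x = σ.reg x := by
    intro x hx
    simp [(show x ≠ 8 by omega), (show x ≠ 9 by omega), (show x ≠ 10 by omega)]
  refine (h H pos b top _ (by simp) (by simp) (by simp) (hready.congr hr rfl)).mono ?_
  rintro σ' u ⟨hu, hd, hx⟩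
  refine ⟨?_, hd.congr hr rfl, fun x h2 h6 => by rw [hx x h2 h6, hr x (by omega)]⟩
  simp only [Cmd.steps]
  omega

/-- Finishing the group of the `e` nodes from `p` on, where `g` is the number of groups before
it. -/
theorem finishGroup_spec {procs : List Cmd} {M n S E H b p e top g : ℕ} {τ pos : ℕ → ℕ}
    {σ : State} {L : ℝ} (h : ProcSpec procs M n τ S e E) (h2 : σ.reg 2 = p) (h3 : σ.reg 3 = e)
    (h5 : σ.reg 5 = top) (h6 : σ.reg 6 = top + g)
    (hready : Ready n τ S M H pos p e (top + g) (10 * e) σ) (hpe : p + e ≤ top)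
    (hM : n + σ.reg 0 + gates e + (if g = 0 then 0 else e) ≤ M)
    (hL : Real.logb Real.goldenRatio (weight (σ.arr 0) p (p + e)) + 5 * loglog e + 3 ≤ L)
    (hfirst : g = 0 → p = b)
    (hcarry : 1 ≤ g → σ.Computes n τ (σ.arr 3 (top + g - 1)) (pos b) (pos p) (L - 2)) :
    Spec procs M finishGroup σ fun σ' u => u ≤ E * e + 60 * e + 40 ∧ σ'.Valid n S ∧
      σ'.Extends σ ∧ σ'.reg 0 = σ.reg 0 + gates e + (if g = 0 then 0 else e) ∧
      (∀ x, x < p ∨ (p + e ≤ x ∧ x < top + g) → σ'.arr 3 x = σ.arr 3 x) ∧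
      (∀ x < top + g, σ'.arr 0 x = σ.arr 0 x) ∧
      (∀ x < σ.reg 7, σ'.arr 7 x = σ.arr 7 x) ∧
      (∀ x, 1 ≤ x → x ≤ 7 → σ'.reg x = σ.reg x) ∧
      (∀ x, p ≤ x → x < p + e → σ'.Computes n τ (σ'.arr 3 x) (pos b) (pos (x + 1)) L) := by
  have htop := hready.top_le
  refine Spec.seq ((callProc_spec (e₁ := .reg 2) (e₂ := .reg 3) (e₃ := .reg 6) h ?_ ?_ ?_ h2 ?_ ?_
    hready).mono ?_)
  · simp only [Expr.Small]
    omega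
  · simp [Expr.Small]
    omega
  · simp [Expr.Small]
    omega
  · simp [Expr.eval, h3]
  · simp [Expr.eval, h6]
  rintro σ₁ u₁ ⟨hu₁, d₁, r₁⟩
  simp only [Expr.nodes] at hu₁
  have hr1 : ∀ x, 1 ≤ x → x ≤ 7 → σ₁.reg x = σ.reg x := by
    intro x hx hx'
    rcases hx.lt_or_eq with hx | rfl
    · rcases hx'.lt_or_eq with hx' | rfl
      · exact r₁ x hx (by omega)
      · exact d₁.reg_seven
    · rw [d₁.valid.reg_one, hready.valid.reg_one]
  have h5' : σ₁.reg 5 = top := (r₁ 5 (by norm_num) (by norm_num)).trans h5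
  have h6' : σ₁.reg 6 = top + g := (r₁ 6 (by norm_num) (by norm_num)).trans h6
  have hc := d₁.count
  refine Spec.ite (by simp only [Expr.Small]; omega) (by simp only [Expr.Small]; omega) ?_ ?_
  · intro hlt
    simp only [Expr.eval, h5', h6'] at hlt
    rw [if_neg (by omega)] at hM
    refine (combine_spec (i := pos b) (k := pos p) (B := L) (pos := pos) (τ := τ) d₁.valid
      ((hr1 2 (by norm_num) (by norm_num)).trans h2)
      ((hr1 3 (by norm_num) (by norm_num)).trans h3) h6' (by omega) ?_ ?_ (by omega)
      (by omega)).mono ?_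
    · intro x hx hx'
      exact (d₁.comp x hx hx').mono (by linarith)
    · rw [d₁.arr_three _ (.inr (by omega))]
      exact (hcarry (by omega)).extend d₁.ext
    rintro σ₂ u₂ ⟨hu₂, h0₂, v₂, e₂, c₂, z₂, r₂, a₂⟩
    refine ⟨?_, v₂, e₂.trans d₁.ext, ?_, ?_, ?_, ?_, ?_, c₂⟩
    · simp only [Expr.nodes]
      omega
    · rw [if_neg (by omega)]
      omega
    · intro x hx
      rw [z₂ x (by omega), d₁.arr_three x hx]
    · intro x hx
      rw [a₂ 0 (by norm_num) (by norm_num) (by norm_num), d₁.arr_zero x hx]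
    · intro x hx
      rw [a₂ 7 (by norm_num) (by norm_num) (by norm_num), d₁.arr_seven x hx]
    · intro x hx hx'
      rw [r₂ x hx (by omega), hr1 x hx hx']
  · intro hlt
    simp only [Expr.eval, h5', h6'] at hlt
    obtain rfl : g = 0 := by omega
    obtain rfl := hfirst rfl
    refine Spec.straight ?_
    refine ⟨?_, d₁.valid, d₁.ext, by simpa using hc, d₁.arr_three, d₁.arr_zero,
      d₁.arr_seven, hr1, ?_⟩
    · simp only [Expr.nodes, Cmd.steps]
      omega
    · intro x hx hx'
      exact (d₁.comp x hx hx').mono (by linarith)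

/-- The products of the `q` groups become the nodes from `top` on.  Their total weight is at most
`φ ^ 3` times the weight of the nodes. -/
theorem productLoop_spec {procs : List Cmd} {M n S H b m top k s : ℕ} {τ pos : ℕ → ℕ} {σ : State}
    (h : Ready n τ S M H pos b m top k σ) (hm : 6 ≤ m) (h2 : σ.reg 2 = b) (h3 : σ.reg 3 = m)
    (h4 : σ.reg 4 = s) (h5 : σ.reg 5 = top) (h6 : σ.reg 6 = top) (hs : s * s ≤ m)
    (hs' : m < (s + 1) * (s + 1)) :
    Spec procs M productLoop σ fun σ' u => ∃ q l, Split m s q l ∧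
      u ≤ 500 * (q * (s + 1)) + 10 ∧ σ'.reg 6 = top + q ∧ σ'.reg 2 = b + q * (s + 1) ∧
      σ'.reg 3 = l ∧ σ'.reg 0 = σ.reg 0 + q * s ∧ σ'.Valid n S ∧ σ'.Extends σ ∧
      (∀ x, x ≠ 0 → x ≠ 2 → x ≠ 3 → x ≠ 6 → x ≤ 10 → σ'.reg x = σ.reg x) ∧
      (∀ x < top, σ'.arr 3 x = σ.arr 3 x) ∧ (∀ x < top, σ'.arr 0 x = σ.arr 0 x) ∧
      σ'.arr 7 = σ.arr 7 ∧
      (∀ g < q, σ'.Computes n τ (σ'.arr 3 (top + g)) (pos (b + g * (s + 1)))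
        (pos (b + (g + 1) * (s + 1))) (σ'.arr 0 (top + g)) ∧ σ'.arr 0 (top + g) ≤ H + s + 3) ∧
      weight (σ'.arr 0) top (top + q) ≤
        Real.goldenRatio ^ 3 * weight (σ.arr 0) b (b + q * (s + 1)) := by
  -- The number of nodes in the groups is fixed by `m`, which bounds the space that is needed.
  obtain rfl : s = m.sqrt := Nat.eq_sqrt.2 ⟨hs, hs'⟩
  have hsp := exists_split hm
  set s := m.sqrt with hsdef
  have hs2 := hsp.two_mul_add_one_lt
  have hs3 := hsp.two_le_s
  have hgates := hsp.gates
  have hone := hsp.one_le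
  have hqs : (m - 1) / (s + 1) * s + 1 ≤ gates m := by omega
  have hpos := h.pos_m
  have htop := h.top_le
  have hle := h.le_top
  have hS := h.le_S
  have hSM := h.le_M
  have hg := h.gates_le
  refine Spec.loop (fun σ' u => ∃ g, g * (s + 1) + 1 ≤ m ∧
      u ≤ 500 * (g * (s + 1)) ∧ σ'.reg 6 = top + g ∧ σ'.reg 2 = b + g * (s + 1) ∧
      σ'.reg 3 = m - g * (s + 1) ∧ σ'.reg 0 = σ.reg 0 + g * s ∧ σ'.Valid n S ∧ σ'.Extends σ ∧
      (∀ x, x ≠ 0 → x ≠ 2 → x ≠ 3 → x ≠ 6 → x ≤ 10 → σ'.reg x = σ.reg x) ∧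
      (∀ x < top, σ'.arr 3 x = σ.arr 3 x) ∧ (∀ x < top, σ'.arr 0 x = σ.arr 0 x) ∧
      σ'.arr 7 = σ.arr 7 ∧
      (∀ g' < g, σ'.Computes n τ (σ'.arr 3 (top + g')) (pos (b + g' * (s + 1)))
        (pos (b + (g' + 1) * (s + 1))) (σ'.arr 0 (top + g')) ∧
        σ'.arr 0 (top + g') ≤ H + s + 3) ∧
      weight (σ'.arr 0) top (top + g) ≤
        Real.goldenRatio ^ 3 * weight (σ.arr 0) b (b + g * (s + 1)))
    (fun σ' => σ'.reg 3) ?_ ?_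
  · rintro σ' u ⟨g, hgm, hu, g6, g2, g3, g0, gv, ge, gr, ga3, ga0, ga7, gc, gw⟩
    have hg1 : g ≤ g * (s + 1) := Nat.le_mul_of_pos_right g (by omega)
    have g4 : σ'.reg 4 = s := (gr 4 (by norm_num) (by norm_num) (by norm_num) (by norm_num)
      (by norm_num)).trans h4
    refine ⟨?_, ?_, ?_, ?_⟩
    · simp only [Expr.Small, Expr.eval, g4]
      omega
    · simp only [Expr.Small, g3]
      omega
    · intro hlt
      simp only [Expr.eval, g3, g4] at hlt
      have hK : (g + 1) * (s + 1) = g * (s + 1) + (s + 1) := by ring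
      have hK' : (g + 1) * s = g * s + s := by ring
      have hgq : (g + 1) * s ≤ (m - 1) / (s + 1) * s := by
        refine Nat.mul_le_mul_right s ?_
        rw [Nat.le_div_iff_mul_le (by omega)]
        omega
      have hgs : g + 1 ≤ s := by
        by_contra! hgs
        have : s * (s + 1) ≤ g * (s + 1) := Nat.mul_le_mul_right _ (by omega)
        have : (s + 1) * (s + 1) = s * (s + 1) + (s + 1) := by ring
        omega
      have hin (x : ℕ) (hx : b + g * (s + 1) ≤ x) (hx' : x ≤ b + g * (s + 1) + s) :
          σ'.arr 3 x = σ.arr 3 x ∧ σ'.arr 0 x = σ.arr 0 x ∧ b ≤ x ∧ x < b + m :=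
        ⟨ga3 x (by omega), ga0 x (by omega), by omega, by omega⟩
      have hwt : weight (σ'.arr 0) (b + g * (s + 1)) (b + g * (s + 1) + s + 1) =
          weight (σ.arr 0) (b + g * (s + 1)) (b + g * (s + 1) + s + 1) :=
        weight_congr fun x hx hx' => (hin x hx (by omega)).2.1
      refine Spec.seq ((groupProduct_spec (H := H) (pos := pos) (τ := τ) gv g2 g4 ?_ ?_ (by omega)
        hSM (by omega) (by omega)).mono ?_)
      · intro x hx hx'
        obtain ⟨e3, e0, hb, hb'⟩ := hin x hx hx'
        rw [e3, e0]
        exact (h.comp x hb hb').extend ge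
      · intro x hx hx'
        obtain ⟨e3, e0, hb, hb'⟩ := hin x hx hx'
        rw [e0]
        exact h.level x hb hb'
      rintro σ₁ u₁ ⟨hu₁, h0₁, v₁, e₁, c₁, l₁, w₁, r₁, a₁⟩
      rw [hwt] at w₁
      have a0₁ : σ₁.arr 0 = σ'.arr 0 :=
        a₁ 0 (by norm_num) (by norm_num) (by norm_num) (by norm_num)
      have a3₁ : σ₁.arr 3 = σ'.arr 3 :=
        a₁ 3 (by norm_num) (by norm_num) (by norm_num) (by norm_num)
      have h2₁ := r₁ 2 (by norm_num) (by norm_num)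
      have h3₁ := r₁ 3 (by norm_num) (by norm_num)
      have h6₁ := r₁ 6 (by norm_num) (by norm_num)
      have hlt₁ := c₁.lt
      refine (storeProduct_spec ((r₁ 4 (by norm_num) (by norm_num)).trans g4) (by omega) (by omega)
        (by omega) (by omega) (by omega)).mono ?_
      rintro σ₂ u₂ ⟨hu₂, h6₂, h2₂, h3₂, a3₂, a0₂, r₂, a₂⟩
      rw [h6₁, g6] at a3₂ a0₂ h6₂
      rw [a3₁] at a3₂
      rw [a0₁] at a0₂
      have e₂ : σ₂.Extends σ₁ := .of_eq (r₂ 0 (by norm_num) (by norm_num) (by norm_num))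
        (a₂ 1 (by norm_num) (by norm_num)) (a₂ 2 (by norm_num) (by norm_num))
      have h0₂ : σ₂.reg 0 = σ₁.reg 0 := r₂ 0 (by norm_num) (by norm_num) (by norm_num)
      refine ⟨⟨g + 1, by omega, ?_, by omega, by omega, by omega, by omega, ⟨?_, ?_, ?_⟩,
        (e₂.trans e₁).trans ge, ?_, ?_, ?_, ?_, ?_, ?_⟩, ?_⟩
      · simp only [Expr.nodes]
        omega
      · rw [r₂ 1 (by norm_num) (by norm_num) (by norm_num), v₁.reg_one]
      · rw [a₂ 6 (by norm_num) (by norm_num), v₁.sentinel]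
      · rw [h0₂, a₂ 1 (by norm_num) (by norm_num), a₂ 2 (by norm_num) (by norm_num)]
        exact v₁.lt
      · intro x hx0 hx2 hx3 hx6 hx10
        rw [r₂ x hx2 hx3 hx6, r₁ x (by omega) hx10, gr x hx0 hx2 hx3 hx6 hx10]
      · intro x hx
        rw [a3₂, Function.update_of_ne (by omega), ga3 x hx]
      · intro x hx
        rw [a0₂, Function.update_of_ne (by omega), ga0 x hx]
      · rw [a₂ 7 (by norm_num) (by norm_num),
          a₁ 7 (by norm_num) (by norm_num) (by norm_num) (by norm_num), ga7]
      · intro g' hg'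
        rcases (Nat.lt_succ_iff.1 hg').lt_or_eq with hg' | rfl
        · rw [a3₂, a0₂, Function.update_of_ne (by omega), Function.update_of_ne (by omega)]
          exact ⟨(((gc g' hg').1.extend e₁).extend e₂), (gc g' hg').2⟩
        · rw [a3₂, a0₂, Function.update_self, Function.update_self]
          refine ⟨?_, l₁⟩
          rw [hK, ← add_assoc, ← add_assoc]
          exact c₁.extend e₂
      · rw [← add_assoc, weight_succ_right _ (by omega), a0₂, Function.update_self,
          weight_congr (B := σ'.arr 0) (fun x _ hx => Function.update_of_ne (by omega) _ _), hK,
          ← add_assoc, ← add_assoc, ← weight_add (σ.arr 0) (b := b + g * (s + 1)) (by omega)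
            (by omega), mul_add]
        exact add_le_add gw w₁
      · rw [h3₂, h3₁, g3]
        omega
    · intro hlt
      simp only [Expr.eval, g3, g4] at hlt
      refine ⟨g, m - g * (s + 1), ⟨hm, hs, hs', by omega, by omega, by omega⟩, ?_, g6, g2, g3, g0,
        gv, ge, gr, ga3, ga0, ga7, gc, gw⟩
      simp only [Expr.nodes]
      omega
  · refine ⟨0, by omega, by omega, by omega, by omega, by omega, by omega, h.valid, .refl σ,
      fun _ _ _ _ _ _ => rfl, fun _ _ => rfl, fun _ _ => rfl, rfl, fun _ h => by omega, ?_⟩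
    simp [weight]

/-- Finishing the first `q` groups. The prefix product of the groups `0, …, g` is the node
`top + g`, which meets the level `L - 2` and so can be the right operand of gates of level `L`. The
groups are traversed downwards, because the recursive calls for the group `g` overwrite the nodes
from `top + g` on. -/
theorem groupLoop_spec {procs : List Cmd} {M n S E H b m top s q : ℕ} {τ pos : ℕ → ℕ} {σ : State}
    {L : ℝ} (h : ProcSpec procs M n τ S s E) (hv : σ.Valid n S) (hs : 1 ≤ s)
    (h2 : σ.reg 2 = b + q * (s + 1))
    (h4 : σ.reg 4 = s) (h5 : σ.reg 5 = top) (h6 : σ.reg 6 = top + q)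
    (hqm : b + q * (s + 1) ≤ b + m) (hmt : b + m ≤ top)
    (hcomp : ∀ x, b ≤ x → x < b + q * (s + 1) →
      σ.Computes n τ (σ.arr 3 x) (pos x) (pos (x + 1)) (σ.arr 0 x))
    (hH : ∀ x, b ≤ x → x < b + q * (s + 1) → σ.arr 0 x ≤ H)
    (hcarry : ∀ g < q, σ.Computes n τ (σ.arr 3 (top + g)) (pos b) (pos (b + (g + 1) * (s + 1)))
      (L - 2))
    (hL : ∀ p, b ≤ p → p + s ≤ b + m →
      Real.logb Real.goldenRatio (weight (σ.arr 0) p (p + s)) + 5 * loglog s + 3 ≤ L)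
    (hdone : ∀ x, b + q * (s + 1) ≤ x → x < b + m →
      σ.Computes n τ (σ.arr 3 x) (pos b) (pos (x + 1)) L)
    (hS : H + 2 * s ≤ S) (hSM : S ≤ M)
    (hg : n + σ.reg 0 + (q * gates s + (q - 1) * s) ≤ M) (htop : top + q + s ≤ M)
    (hsp : σ.reg 7 + 10 * s ≤ M) :
    Spec procs M groupLoop σ fun σ' u => u ≤ (E * s + 200 * (s + 1)) * q + 10 ∧ σ'.Valid n S ∧
      σ'.Extends σ ∧ σ'.reg 0 = σ.reg 0 + (q * gates s + (q - 1) * s) ∧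
      σ'.reg 7 = σ.reg 7 ∧ (∀ x, x < b ∨ (b + m ≤ x ∧ x < top) → σ'.arr 3 x = σ.arr 3 x) ∧
      (∀ x < top, σ'.arr 0 x = σ.arr 0 x) ∧ (∀ x < σ.reg 7, σ'.arr 7 x = σ.arr 7 x) ∧
      (∀ x, b ≤ x → x < b + m → σ'.Computes n τ (σ'.arr 3 x) (pos b) (pos (x + 1)) L) := by
  refine Spec.loop (fun σ' u => ∃ g, g ≤ q ∧ σ'.reg 6 = top + g ∧ σ'.reg 2 = b + g * (s + 1) ∧
      u ≤ (E * s + 200 * (s + 1)) * (q - g) ∧ σ'.Valid n S ∧ σ'.Extends σ ∧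
      σ'.reg 0 + (g * gates s + (g - 1) * s) = σ.reg 0 + (q * gates s + (q - 1) * s) ∧
      σ'.reg 4 = s ∧ σ'.reg 5 = top ∧ σ'.reg 7 = σ.reg 7 ∧
      (∀ x, x < b + g * (s + 1) ∨ (b + m ≤ x ∧ x < top + g) → σ'.arr 3 x = σ.arr 3 x) ∧
      (∀ x < top + g, σ'.arr 0 x = σ.arr 0 x) ∧ (∀ x < σ.reg 7, σ'.arr 7 x = σ.arr 7 x) ∧
      (∀ x, b + g * (s + 1) ≤ x → x < b + m →
        σ'.Computes n τ (σ'.arr 3 x) (pos b) (pos (x + 1)) L))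
    (fun σ' => σ'.reg 6) ?_ ?_
  · rintro σ' u ⟨g, hgq, g6, g2, hu, gv, ge, g0, g4, g5, g7, ga3, ga0, ga7, gd⟩
    have hgK : g * (s + 1) ≤ q * (s + 1) := Nat.mul_le_mul_right _ hgq
    refine ⟨?_, ?_, ?_, ?_⟩
    · simp only [Expr.Small]
      omega
    · simp only [Expr.Small]
      omega
    · intro hlt
      simp only [Expr.eval, g5, g6] at hlt
      obtain ⟨g, rfl⟩ : ∃ g', g = g' + 1 := ⟨g - 1, by omega⟩
      have hK : (g + 1) * (s + 1) = g * (s + 1) + (s + 1) := by ring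
      have hG : (g + 1) * gates s + (g + 1 - 1) * s =
          (g * gates s + (g - 1) * s) + (gates s + if g = 0 then 0 else s) := by
        rcases Nat.eq_zero_or_pos g with rfl | hg'
        · simp
        · obtain ⟨g, rfl⟩ := Nat.exists_eq_add_of_le' hg'
          simp only [Nat.add_sub_cancel, if_neg (Nat.succ_ne_zero g)]
          ring
      rw [hG] at g0
      have hcg := (hcarry g (by omega)).extend ge
      have hcg' := hcg.lt
      have hcell : σ'.arr 3 (top + g) = σ.arr 3 (top + g) := ga3 _ (.inr (by omega))
      refine Spec.seq ((previousGroup_spec g4 (p := b + g * (s + 1)) (u := top + g) (by omega)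
        (by omega) (by omega) (by omega) (by omega)).mono ?_)
      rintro σ₁ u₁ ⟨hu₁, h6₁, h2₁, h3₁, a3₁, r₁, a₁⟩
      have e₁ : σ₁.Extends σ' := .of_eq (r₁ 0 (by norm_num) (by norm_num) (by norm_num))
        (a₁ 1 (by norm_num)) (a₁ 2 (by norm_num))
      have h0₁ : σ₁.reg 0 = σ'.reg 0 := r₁ 0 (by norm_num) (by norm_num) (by norm_num)
      have h4₁ : σ₁.reg 4 = s := (r₁ 4 (by norm_num) (by norm_num) (by norm_num)).trans g4
      have h5₁ : σ₁.reg 5 = top := (r₁ 5 (by norm_num) (by norm_num) (by norm_num)).trans g5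
      have h7₁ : σ₁.reg 7 = σ.reg 7 := (r₁ 7 (by norm_num) (by norm_num) (by norm_num)).trans g7
      have a0₁ : σ₁.arr 0 = σ'.arr 0 := a₁ 0 (by norm_num)
      have a7₁ : σ₁.arr 7 = σ'.arr 7 := a₁ 7 (by norm_num)
      have v₁ : σ₁.Valid n S := ⟨(r₁ 1 (by norm_num) (by norm_num) (by norm_num)).trans gv.reg_one,
        by rw [a₁ 6 (by norm_num), gv.sentinel],
        by rw [h0₁, a₁ 1 (by norm_num), a₁ 2 (by norm_num)]; exact gv.lt⟩
      have ee := e₁.trans ge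
      have hin (x : ℕ) (hx : b + g * (s + 1) ≤ x) (hx' : x < b + g * (s + 1) + s) :
          σ₁.arr 3 x = σ.arr 3 x ∧ σ₁.arr 0 x = σ.arr 0 x := by
        rw [a3₁, Function.update_of_ne (by omega), ga3 x (.inl (by omega)), a0₁,
          ga0 x (by omega)]
        exact ⟨rfl, rfl⟩
      have hready : Ready n τ S M H pos (b + g * (s + 1)) s (top + g) (10 * s) σ₁ :=
        { valid := v₁
          pos_m := hs
          le_top := by omega
          comp := fun x hx hx' => by
            rw [(hin x hx hx').1, (hin x hx hx').2]
            exact (hcomp x (by omega) (by omega)).extend ee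
          level := fun x hx hx' => by
            rw [(hin x hx hx').2]
            exact hH x (by omega) (by omega)
          le_S := hS
          le_M := hSM
          gates_le := by omega
          top_le := by omega
          stack_le := by omega
          reg_le := fun x hx hx' => by
            interval_cases x <;> omega }
      refine (finishGroup_spec (L := L) (b := b) h h2₁ h3₁ h5₁ h6₁ hready (by omega) ?_ ?_ ?_
        ?_).mono ?_
      · rw [h0₁]
        omega
      · rw [weight_congr (fun x hx hx' => (hin x hx hx').2)]
        exact hL _ (by omega) (by omega)
      · rintro rfl
        simp
      · intro hg1
        obtain ⟨g', rfl⟩ := Nat.exists_eq_add_of_le' hg1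
        have hc := (hcarry g' (by omega)).extend ee
        rw [show top + (g' + 1) - 1 = top + g' by omega, a3₁, Function.update_of_ne (by omega),
          ga3 _ (.inr (by omega))]
        exact hc
      rintro σ₂ u₂ ⟨hu₂, v₂, e₂, h0₂, a3₂, a0₂, a7₂, r₂, c₂⟩
      refine ⟨⟨g, by omega, ?_, ?_, ?_, v₂, e₂.trans ee, by omega, ?_, ?_, ?_, ?_, ?_, ?_, ?_⟩, ?_⟩
      · rw [r₂ 6 (by norm_num) (by norm_num), h6₁]
      · rw [r₂ 2 (by norm_num) (by norm_num), h2₁]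
      · have : (E * s + 200 * (s + 1)) * (q - g) =
            (E * s + 200 * (s + 1)) * (q - (g + 1)) + (E * s + 200 * (s + 1)) := by
          rw [show q - g = q - (g + 1) + 1 by omega, mul_add, mul_one]
        rw [this]
        simp only [Expr.nodes]
        omega
      · rw [r₂ 4 (by norm_num) (by norm_num), h4₁]
      · rw [r₂ 5 (by norm_num) (by norm_num), h5₁]
      · rw [r₂ 7 (by norm_num) (by norm_num), h7₁]
      · intro x hx
        rw [a3₂ x (by omega), a3₁, Function.update_of_ne (by omega), ga3 x (by omega)]
      · intro x hx
        rw [a0₂ x hx, a0₁, ga0 x (by omega)]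
      · intro x hx
        rw [a7₂ x (by rwa [h7₁]), a7₁, ga7 x hx]
      · intro x hx hx'
        rcases Nat.lt_or_ge x (b + g * (s + 1) + s) with h1 | h1
        · exact c₂ x hx h1
        · rw [a3₂ x (.inr (by omega)), a3₁]
          rcases h1.lt_or_eq with h1 | rfl
          · rw [Function.update_of_ne (by omega)]
            exact ((gd x (by omega) hx').extend e₁).extend e₂
          · rw [Function.update_self, hcell, show b + g * (s + 1) + s + 1 =
              b + (g + 1) * (s + 1) by rw [hK]; omega]
            exact ((hcg.extend e₁).extend e₂).mono (by linarith)
      · rw [r₂ 6 (by norm_num) (by norm_num), h6₁, g6]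
        omega
    · intro hlt
      simp only [Expr.eval, g5, g6] at hlt
      obtain rfl : g = 0 := by omega
      simp only [zero_mul, add_zero, Nat.zero_sub] at *
      refine ⟨?_, gv, ge, g0, g7, ga3, ga0, ga7, gd⟩
      simp only [Expr.nodes, Nat.sub_zero] at *
      omega
  · exact ⟨q, le_rfl, h6, h2, by simp, hv, .refl σ, rfl, h4, h5, rfl, fun _ _ => rfl,
      fun _ _ => rfl, fun _ _ => rfl, hdone⟩

/-- The level bound of the recursion: the group products cost `φ ^ 3` in weight and the gates that
multiply by them cost `2` levels, and these five levels are gained because the iterated logarithm of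
`q` is smaller by one than that of `m`. -/
theorem split_spec {procs : List Cmd} {M n S E H b m top : ℕ} {τ pos : ℕ → ℕ} {σ : State}
    (hproc : ∀ x, 1 ≤ x → 2 * x ≤ m → ProcSpec procs M n τ S x E) (hm : 6 ≤ m)
    (h : Ready n τ S M H pos b m top (10 * m - 5) σ) (h2 : σ.reg 2 = b) (h3 : σ.reg 3 = m)
    (h5 : σ.reg 5 = top) (h6 : σ.reg 6 = top) :
    Spec procs M split σ fun σ' u => u ≤ (E + 1000) * m ∧ Done n τ S pos b m top σ σ' := by
  have hle_top := h.le_top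
  have htop := h.top_le
  have hle_S := h.le_S
  have hle_M := h.le_M
  have hstack := h.stack_le
  refine Spec.seq ((sqrt_spec h3 h.pos_m (by omega)).mono ?_)
  rintro σ₁ u₁ ⟨s, hu₁, h4₁, hs, hs', r₁, a₁⟩
  have sp := Split.two_mul_add_one_lt (exists_split hm)
  rw [← Nat.eq_sqrt.2 ⟨hs, hs'⟩] at sp
  have e₁ : σ₁.Extends σ := .of_eq (r₁ 0 (by norm_num) (by norm_num)) (by rw [a₁]) (by rw [a₁])
  have hr0₁ : σ₁.reg 0 = σ.reg 0 := r₁ 0 (by norm_num) (by norm_num)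
  have h7₁ : σ₁.reg 7 = σ.reg 7 := r₁ 7 (by norm_num) (by norm_num)
  have ready₁ : Ready n τ S M H pos b m top (10 * m - 5) σ₁ :=
    { valid := ⟨(r₁ 1 (by norm_num) (by norm_num)).trans h.valid.reg_one,
        by rw [a₁, h.valid.sentinel], by rw [hr0₁, a₁]; exact h.valid.lt⟩
      pos_m := h.pos_m
      le_top := h.le_top
      comp := fun x hx hx' => by
        rw [a₁]
        exact (h.comp x hx hx').extend e₁
      level := by
        rw [a₁]
        exact h.level
      le_S := h.le_S
      le_M := h.le_M
      gates_le := by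
        rw [hr0₁]
        exact h.gates_le
      top_le := h.top_le
      stack_le := by
        rw [h7₁]
        exact h.stack_le
      reg_le := fun x hx hx' => by
        rcases eq_or_ne x 4 with rfl | h4
        · omega
        · rw [r₁ x h4 (by omega)]
          exact h.reg_le x hx hx' }
  refine Spec.seq ((productLoop_spec ready₁ hm ((r₁ 2 (by norm_num) (by norm_num)).trans h2)
    ((r₁ 3 (by norm_num) (by norm_num)).trans h3) h4₁
    ((r₁ 5 (by norm_num) (by norm_num)).trans h5)
    ((r₁ 6 (by norm_num) (by norm_num)).trans h6) hs hs').mono ?_)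
  rintro σ₂ u₂ ⟨q, l, hsplit, hu₂, h6₂, h2₂, h3₂, h0₂, v₂, e₂, r₂, a3₂, a0₂, a7₂, c₂, w₂⟩
  rw [a₁] at a3₂ a0₂ a7₂ w₂
  have hq := hsplit.q_le
  have hq1 := hsplit.one_le_q
  have hs2 := hsplit.two_le_s
  have hl1 := hsplit.one_le
  have hl := hsplit.le
  have heq := hsplit.eq
  have hgates := hsplit.gates
  have hgM := h.gates_le
  have hr₂ (x : ℕ) (h1 : 4 ≤ x) (h2 : x ≤ 7) (h3 : x ≠ 6) : σ₂.reg x = σ₁.reg x :=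
    r₂ x (by omega) (by omega) (by omega) h3 (by omega)
  have h4₂ := hr₂ 4 (by norm_num) (by norm_num) (by norm_num)
  have h5₂ := hr₂ 5 (by norm_num) (by norm_num) (by norm_num)
  have h7₂ := hr₂ 7 (by norm_num) (by norm_num) (by norm_num)
  have h5₁ : σ₁.reg 5 = top := (r₁ 5 (by norm_num) (by norm_num)).trans h5
  have hbK : (0 : ℕ) * (s + 1) = 0 := zero_mul _
  -- Here the nodes are the group products, so that the node `top + g` ends at the end of group `g`.
  have ready₂ : Ready n τ S M (H + s + 3) (fun x => pos (b + (x - top) * (s + 1))) top q (top + q)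
      (10 * q) σ₂ :=
    { valid := v₂
      pos_m := hq1
      le_top := le_rfl
      comp := fun x hx hx' => by
        obtain ⟨g, rfl⟩ := Nat.exists_eq_add_of_le hx
        rw [Nat.add_sub_cancel_left, show top + g + 1 - top = g + 1 by omega]
        exact (c₂ g (by omega)).1
      level := fun x hx hx' => by
        obtain ⟨g, rfl⟩ := Nat.exists_eq_add_of_le hx
        exact (c₂ g (by omega)).2
      le_S := by omega
      le_M := hle_M
      gates_le := by omega
      top_le := by omega
      stack_le := by omega
      reg_le := fun x hx hx' => by
        interval_cases x <;> omega }
  refine Spec.seq ((callProc_spec (e₁ := .reg 5) (e₂ := .sub (.reg 6) (.reg 5)) (e₃ := .reg 6)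
    (hproc q hq1 (by omega)) ?_ ?_ ?_ (h5₂.trans h5₁) ?_ ?_ ready₂).mono ?_)
  · simp only [Expr.Small]
    omega
  · simp [Expr.Small]
    omega
  · simp [Expr.Small]
    omega
  · simp [Expr.eval]
    omega
  · simp [Expr.eval, h6₂]
  rintro σ₃ u₃ ⟨hu₃, d₃, r₃⟩
  simp only [Expr.nodes] at hu₃
  have h2₃ := r₃ 2 (by norm_num) (by norm_num)
  have h3₃ := r₃ 3 (by norm_num) (by norm_num)
  have h4₃ := r₃ 4 (by norm_num) (by norm_num)
  have h5₃ := r₃ 5 (by norm_num) (by norm_num)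
  have h6₃ := r₃ 6 (by norm_num) (by norm_num)
  have h7₃ := d₃.reg_seven
  have h0₃ := d₃.count
  have e₃ : σ₃.Extends σ := (d₃.ext.trans e₂).trans e₁
  have a3₃ (x : ℕ) (hx : x < top) : σ₃.arr 3 x = σ.arr 3 x := by
    rw [d₃.arr_three x (.inl hx), a3₂ x hx]
  have a0₃ (x : ℕ) (hx : x < top) : σ₃.arr 0 x = σ.arr 0 x := by
    rw [d₃.arr_zero x (by omega), a0₂ x hx]
  have a7₃ (x : ℕ) (hx : x < σ.reg 7) : σ₃.arr 7 x = σ.arr 7 x := by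
    rw [d₃.arr_seven x (by omega), a7₂]
  set L : ℝ :=
    Real.logb Real.goldenRatio (weight (σ.arr 0) b (b + m)) + 5 * loglog m + 2 with hLdef
  have hcarry (σ' : State) (he : σ'.Extends σ₃) (g : ℕ) (hg : g < q) :
      σ'.Computes n τ (σ₃.arr 3 (top + g)) (pos b) (pos (b + (g + 1) * (s + 1))) (L - 2) := by
    have h1 := d₃.comp (top + g) (by omega) (by omega)
    simp only [Nat.sub_self, hbK, add_zero, show top + g + 1 - top = g + 1 by omega] at h1
    refine (h1.extend he).mono ?_
    have hw : weight (σ₂.arr 0) top (top + q) ≤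
        Real.goldenRatio ^ 3 * weight (σ.arr 0) b (b + m) :=
      w₂.trans (mul_le_mul_of_nonneg_left (weight_mono _ le_rfl (by omega)) (golden_pow_pos 3).le)
    have h2 := logb_golden_le (weight_pos _ (by omega)) hw
    rw [logb_golden_pow_mul _ (weight_pos _ (by omega))] at h2
    have h3 := hsplit.loglog_q
    push_cast at h2
    linarith
  have hlevel {p e : ℕ} (he1 : 1 ≤ e) (hbp : b ≤ p) (hpe : p + e ≤ b + m)
      (hlog : 5 * loglog e + 1 ≤ 5 * loglog m) :
      Real.logb Real.goldenRatio (weight (σ₃.arr 0) p (p + e)) + 5 * loglog e + 3 ≤ L := by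
    rw [weight_congr (B := σ.arr 0) (fun x _ hx => a0₃ x (by omega))]
    have := logb_golden_le (weight_pos (σ.arr 0) (by omega : p < p + e)) (weight_mono _ hbp hpe)
    linarith
  have ready₃ : Ready n τ S M H pos (b + q * (s + 1)) l (top + q) (10 * l) σ₃ :=
    { valid := d₃.valid
      pos_m := hl1
      le_top := by omega
      comp := fun x hx hx' => by
        rw [a3₃ x (by omega), a0₃ x (by omega)]
        exact (h.comp x (by omega) (by omega)).extend e₃
      level := fun x hx hx' => by
        rw [a0₃ x (by omega)]
        exact h.level x (by omega) (by omega)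
      le_S := by omega
      le_M := hle_M
      gates_le := by omega
      top_le := by omega
      stack_le := by omega
      reg_le := fun x hx hx' => by
        interval_cases x <;> omega }
  -- The last group may be larger than the others, but its iterated logarithm is still smaller than
  -- that of `m` by `1 / 5`, which pays for the gates that multiply by the preceding groups.
  have hqs : l ≤ (q - 1) * s + l := Nat.le_add_left _ _
  refine Spec.seq ((finishGroup_spec (L := L) (b := b) (hproc l hl1 (by omega)) (h2₃.trans h2₂)
    (h3₃.trans h3₂) (h5₃.trans (h5₂.trans h5₁)) (h6₃.trans h6₂) ready₃ (by omega) ?_ ?_ ?_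
    ?_).mono ?_)
  · rw [if_neg (by omega)]
    omega
  · exact hlevel hl1 (by omega) (by omega) hsplit.loglog_l
  · omega
  · intro _
    have hc := hcarry σ₃ (.refl σ₃) (q - 1) (by omega)
    rwa [show top + (q - 1) = top + q - 1 by omega, show q - 1 + 1 = q by omega] at hc
  rintro σ₄ u₄ ⟨hu₄, v₄, e₄, h0₄, a3₄, a0₄, a7₄, r₄, c₄⟩
  rw [if_neg (by omega)] at h0₄
  have h2₄ := r₄ 2 (by norm_num) (by norm_num)
  have h4₄ := r₄ 4 (by norm_num) (by norm_num)
  have h5₄ := r₄ 5 (by norm_num) (by norm_num)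
  have h6₄ := r₄ 6 (by norm_num) (by norm_num)
  have h7₄ := r₄ 7 (by norm_num) (by norm_num)
  refine (groupLoop_spec (H := H) (m := m) (b := b) (q := q) (L := L) (pos := pos) (τ := τ)
    (hproc s (by omega) (by omega)) v₄ (by omega)
    (by omega) (by omega) (by omega) (by omega) (by omega) hle_top ?_ ?_ ?_ ?_ ?_
    (by omega) hle_M (by omega) (by omega) (by omega)).mono ?_
  · intro x hx hx'
    rw [a3₄ x (.inl hx'), a0₄ x (by omega), a3₃ x (by omega), a0₃ x (by omega)]
    exact (h.comp x (by omega) (by omega)).extend (e₄.trans e₃)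
  · intro x hx hx'
    rw [a0₄ x (by omega), a0₃ x (by omega)]
    exact h.level x (by omega) (by omega)
  · intro g hg
    rw [a3₄ _ (.inr (by omega))]
    exact hcarry σ₄ e₄ g hg
  · intro p hp hp'
    rw [weight_congr (B := σ₃.arr 0) (fun x _ hx => a0₄ x (by omega))]
    have := hsplit.loglog_s
    exact hlevel (by omega) hp hp' (by linarith)
  · intro x hx hx'
    exact c₄ x hx (by omega)
  rintro σ₅ u₅ ⟨hu₅, v₅, e₅, h0₅, h7₅, a3₅, a0₅, a7₅, c₅⟩
  refine ⟨?_, v₅, (e₅.trans e₄).trans e₃, by omega, by omega, ?_, ?_, ?_, c₅⟩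
  · have h1 : (E * s + 200 * (s + 1)) * q = E * (q * s) + 200 * (q * (s + 1)) := by ring
    have h2 : (E + 1000) * m = E * (q * s) + E * q + E * l + 1000 * m := by
      rw [← heq]
      ring
    have h3 : s + 1 ≤ q * (s + 1) := Nat.le_mul_of_pos_left _ hq1
    rw [h1] at hu₅
    rw [h2]
    omega
  · intro x hx
    rw [a3₅ x hx, a3₄ x (by omega), a3₃ x (by omega)]
  · intro x hx
    rw [a0₅ x hx, a0₄ x (by omega), a0₃ x hx]
  · intro x hx
    rw [a7₅ x (by omega), a7₄ x (by omega), a7₃ x hx]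

theorem ProcSpec.mono {procs : List Cmd} {M n S m E E' : ℕ} {τ : ℕ → ℕ}
    (h : ProcSpec procs M n τ S m E) (hE : E ≤ E') : ProcSpec procs M n τ S m E' := by
  intro H pos b top σ h8 h9 h10 hready
  refine (h H pos b top σ h8 h9 h10 hready).mono ?_
  rintro σ' u ⟨hu, hd⟩
  exact ⟨hu.trans (Nat.mul_le_mul_right m hE), hd⟩

theorem size_add_one_le {x m : ℕ} (hx : 1 ≤ x) (h : 2 * x ≤ m) : x.size + 1 ≤ m.size := by
  have h1 := Nat.size_pos.2 hx
  have h2 : 2 ^ (x.size - 1) ≤ x := Nat.lt_size.1 (by omega)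
  have h3 : 2 ^ x.size = 2 ^ (x.size - 1) * 2 := by rw [← pow_succ, Nat.sub_add_cancel h1]
  exact Nat.lt_size.2 (by omega)

/-- The chain meets the level bound, because it is used for at most five inputs only. -/
theorem chain_done {procs : List Cmd} {M n S H b m top k : ℕ} {τ pos : ℕ → ℕ} {σ : State}
    (h : Ready n τ S M H pos b m top k σ) (hm : m < 6) (h2 : σ.reg 2 = b) (h3 : σ.reg 3 = m) :
    Spec procs M chain σ fun σ' u => u ≤ 60 * m + 20 ∧ Done n τ S pos b m top σ σ' := by
  have hg := h.gates_le
  have htop := h.top_le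
  have hle := h.le_top
  have hm1 := h.pos_m
  rw [gates_of_lt hm] at hg
  refine (chain_spec (A := Real.logb Real.goldenRatio (weight (σ.arr 0) b (b + m))) (pos := pos)
    (τ := τ) h.valid h2 h3 h.pos_m ?_ hg (by omega)).mono ?_
  · intro x hx hx'
    exact (h.comp x hx hx').mono (le_logb_golden (pow_le_weight _ hx hx'))
  rintro σ' u ⟨hu, h0, hv, he, hc, hz, hr, ha⟩
  refine ⟨hu, hv, he, by rw [h0, gates_of_lt hm], hr 7 (by norm_num) (by norm_num),
    fun x hx => hz x (by omega), fun x _ => by rw [ha 0 (by norm_num) (by norm_num) (by norm_num)],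
    fun x _ => by rw [ha 7 (by norm_num) (by norm_num) (by norm_num)], fun x hx hx' => ?_⟩
  refine (hc x hx hx').mono ?_
  have := chain_level_le hm1 hm
  linarith

/-- The number of steps per node grows by a constant with each of the at most `m.size` nested calls,
because the nodes handled by the recursive calls are at most `m` in total, and each call has at most
half as many nodes. -/
theorem prefixProc_spec {procs : List Cmd} (hprocs : procs[0]? = some prefixProc) (M n : ℕ)
    (τ : ℕ → ℕ) (S : ℕ) {m : ℕ} (hm : 1 ≤ m) : ProcSpec procs M n τ S m (1200 * m.size) := by
  induction m using Nat.strong_induction_on with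
  | _ m ih =>
    intro H pos b top σ h8 h9 h10 h
    have hstack := h.stack_le
    have hle := h.le_top
    have htop := h.top_le
    have hg := h.gates_le
    have hsize : 1 ≤ m.size := Nat.size_pos.2 hm
    refine Spec.call hprocs (Spec.seq ((save_spec rfl (by omega) ?_).mono ?_))
    · intro x hx hx'
      rcases Nat.lt_or_ge x 8 with h8' | h8'
      · exact h.reg_le x hx (by omega)
      · interval_cases x <;> omega
    rintro σ₁ u₁ ⟨hu₁, h7₁, h2₁, h3₁, h5₁, h6₁, h4₁, h1₁, h0₁, hlow₁, hsave₁, a₁⟩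
    have e₁ : σ₁.Extends σ := .of_eq h0₁ (a₁ 1 (by norm_num)) (a₁ 2 (by norm_num))
    rw [h8] at h2₁
    rw [h9] at h3₁
    rw [h10] at h5₁ h6₁
    have ready₁ : Ready n τ S M H pos b m top (10 * m - 5) σ₁ :=
      { valid := ⟨by rw [h1₁, h.valid.reg_one], by rw [a₁ 6 (by norm_num), h.valid.sentinel],
          by rw [h0₁, a₁ 1 (by norm_num), a₁ 2 (by norm_num)]; exact h.valid.lt⟩
        pos_m := hm
        le_top := h.le_top
        comp := fun x hx hx' => by
          rw [a₁ 3 (by norm_num), a₁ 0 (by norm_num)]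
          exact (h.comp x hx hx').extend e₁
        level := by
          rw [a₁ 0 (by norm_num)]
          exact h.level
        le_S := h.le_S
        le_M := h.le_M
        gates_le := by
          rw [h0₁]
          exact hg
        top_le := h.top_le
        stack_le := by omega
        reg_le := fun x hx hx' => by
          have := h.reg_le 4 (by norm_num) (by norm_num)
          interval_cases x <;> omega }
    have body : Spec procs M (.ite (.reg 3) (.const 6) chain split) σ₁ fun σ' u =>
        u ≤ (1200 * (m.size - 1) + 1000) * m + 30 ∧ Done n τ S pos b m top σ₁ σ' := by
      have h1200 : 1000 * m ≤ (1200 * (m.size - 1) + 1000) * m :=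
        Nat.mul_le_mul_right m (Nat.le_add_left _ _)
      rcases Nat.lt_or_ge m 6 with hm6 | hm6
      · refine Spec.ite (by simp only [Expr.Small]; omega) (by simp only [Expr.Small]; omega)
          (fun _ => ?_) (fun hlt => by simp only [Expr.eval] at hlt; omega)
        refine (chain_done ready₁ hm6 h2₁ h3₁).mono ?_
        rintro σ' u ⟨hu, hd⟩
        refine ⟨?_, hd⟩
        simp only [Expr.nodes]
        omega
      · refine Spec.ite (by simp only [Expr.Small]; omega) (by simp only [Expr.Small]; omega)
          (fun hlt => by simp only [Expr.eval] at hlt; omega) (fun _ => ?_)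
        refine (split_spec (E := 1200 * (m.size - 1)) ?_ hm6 ready₁ h2₁ h3₁ h5₁ h6₁).mono ?_
        · intro x hx hx'
          have := size_add_one_le hx hx'
          exact (ih x (by omega) hx).mono (Nat.mul_le_mul_left _ (by omega))
        rintro σ' u ⟨hu, hd⟩
        refine ⟨?_, hd⟩
        simp only [Expr.nodes]
        omega
    refine Spec.seq (body.mono ?_)
    rintro σ₂ u₂ ⟨hu₂, d₂⟩
    have h7₂ : σ₂.reg 7 = σ.reg 7 + 5 := d₂.reg_seven.trans h7₁
    obtain ⟨s2, s3, s4, s5, s6⟩ := hsave₁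
    have f2 : σ₂.arr 7 (σ.reg 7) = σ.reg 2 := by rw [d₂.arr_seven _ (by omega), s2]
    have f3 : σ₂.arr 7 (σ.reg 7 + 1) = σ.reg 3 := by rw [d₂.arr_seven _ (by omega), s3]
    have f4 : σ₂.arr 7 (σ.reg 7 + 2) = σ.reg 4 := by rw [d₂.arr_seven _ (by omega), s4]
    have f5 : σ₂.arr 7 (σ.reg 7 + 3) = σ.reg 5 := by rw [d₂.arr_seven _ (by omega), s5]
    have f6 : σ₂.arr 7 (σ.reg 7 + 4) = σ.reg 6 := by rw [d₂.arr_seven _ (by omega), s6]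
    refine (restore_spec h7₂ (by omega) ?_).mono ?_
    · intro x hx
      have h2 := h.reg_le 2 (by norm_num) (by norm_num)
      have h3 := h.reg_le 3 (by norm_num) (by norm_num)
      have h4 := h.reg_le 4 (by norm_num) (by norm_num)
      have h5 := h.reg_le 5 (by norm_num) (by norm_num)
      have h6 := h.reg_le 6 (by norm_num) (by norm_num)
      interval_cases x
      · rw [add_zero]
        omega
      all_goals omega
    rintro σ₃ u₃ ⟨hu₃, r7, r2, r3, r4, r5, r6, r1, r0, a₃⟩
    have e₃ : σ₃.Extends σ₂ := .of_eq r0 (by rw [a₃]) (by rw [a₃])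
    have hc := d₂.count
    refine ⟨?_, ⟨⟨by rw [r1, d₂.valid.reg_one], by rw [a₃, d₂.valid.sentinel],
      by rw [r0, a₃]; exact d₂.valid.lt⟩, (e₃.trans d₂.ext).trans e₁, by omega, r7, ?_, ?_, ?_,
      ?_⟩, ?_⟩
    · obtain ⟨z, hz⟩ := Nat.exists_eq_add_of_le' hsize
      rw [hz, Nat.add_sub_cancel] at hu₂
      rw [hz]
      have h1 : (1200 * z + 1000) * m = 1200 * (z * m) + 1000 * m := by ring
      have h2 : 1200 * (z + 1) * m = 1200 * (z * m) + 1200 * m := by ring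
      omega
    · intro x hx
      rw [a₃, d₂.arr_three x hx, a₁ 3 (by norm_num)]
    · intro x hx
      rw [a₃, d₂.arr_zero x hx, a₁ 0 (by norm_num)]
    · intro x hx
      rw [a₃, d₂.arr_seven x (by omega), hlow₁ x hx]
    · intro x hx hx'
      have := (d₂.comp x hx hx').extend e₃
      rwa [a₁ 0 (by norm_num), ← a₃] at this
    · intro x hx hx'
      interval_cases x <;> omega

/-! ### Truncation of the arrival times -/

/-- Adds twice the number of bits of register `11` to register `12`. -/
def halveLoop : Cmd :=
  .loop (.const 0) (.reg 11)
    (block [.assign 11 (.half (.reg 11)), .assign 12 (.add (.reg 12) (.const 2))])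

/-- Leaves the maximum arrival time in register `13`. -/
def maxLoop : Cmd :=
  .loop (.reg 14) (.reg 1)
    (block [.ite (.reg 13) (.arr 0 (.reg 14)) (.assign 13 (.arr 0 (.reg 14))) .skip,
      .assign 14 (.add (.reg 14) (.const 1))])

/-- Subtracts register `13` from all arrival times, and makes input `x` the node in entry `x` of
array `3`. -/
def shiftLoop : Cmd :=
  .loop (.reg 14) (.reg 1)
    (block [.store 0 (.reg 14) (.sub (.arr 0 (.reg 14)) (.reg 13)),
      .store 3 (.reg 14) (.reg 14), .assign 14 (.add (.reg 14) (.const 1))])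

/-- Subtracts the maximum arrival time minus twice the number of bits of `n` from all arrival
times. -/
def truncate : Cmd :=
  .seq (block [.assign 1 (.reg 0), .assign 0 (.const 0), .assign 11 (.reg 1)])
    (.seq halveLoop (.seq maxLoop
      (.seq (block [.assign 13 (.sub (.reg 13) (.reg 12)), .assign 14 (.const 0)]) shiftLoop)))

theorem halveLoop_spec {procs : List Cmd} {M : ℕ} {σ : State} (h11 : 2 * σ.reg 11 ≤ M)
    (h12 : σ.reg 12 = 0) :
    Spec procs M halveLoop σ fun σ' u => u ≤ 20 * (σ.reg 11).size + 10 ∧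
      σ'.reg 12 = 2 * (σ.reg 11).size ∧ (∀ x, x ≠ 11 → x ≠ 12 → σ'.reg x = σ.reg x) ∧
      σ'.arr = σ.arr := by
  refine Spec.loop (fun σ' u => u + 20 * (σ'.reg 11).size ≤ 20 * (σ.reg 11).size ∧
    σ'.reg 12 + 2 * (σ'.reg 11).size = 2 * (σ.reg 11).size ∧ σ'.reg 11 ≤ σ.reg 11 ∧
    (∀ x, x ≠ 11 → x ≠ 12 → σ'.reg x = σ.reg x) ∧ σ'.arr = σ.arr) (fun σ' => σ'.reg 11) ?_ ?_
  · rintro σ' u ⟨hu, h12', hle, hr, ha⟩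
    have hsize : (σ.reg 11).size ≤ σ.reg 11 := Nat.size_le.2 Nat.lt_two_pow_self
    refine ⟨Nat.zero_le _, by simp only [Expr.Small]; omega, ?_, ?_⟩
    · intro hlt
      simp only [Expr.eval] at hlt
      have hstep : (σ'.reg 11 / 2).size + 1 ≤ (σ'.reg 11).size := by
        rcases Nat.eq_zero_or_pos (σ'.reg 11 / 2) with h | h
        · rw [h, Nat.size_zero]
          exact Nat.size_pos.2 hlt
        · exact size_add_one_le h (Nat.mul_div_le _ _)
      have hstep' : (σ'.reg 11).size ≤ (σ'.reg 11 / 2).size + 1 := by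
        rw [Nat.size_le, pow_succ]
        have := Nat.lt_size_self (σ'.reg 11 / 2)
        omega
      refine Spec.straight ?_
      simp only [block, Cmd.wp, Expr.Small, Expr.eval, State.reg_setReg, State.arr_setReg,
        Cmd.steps, Expr.nodes]
      norm_num
      refine ⟨by omega, by omega, ⟨by omega, by omega, by omega, ?_, ha⟩, by omega⟩
      intro x hx hx'
      simp [hx, hx', hr x hx hx']
    · intro hlt
      simp only [Expr.eval] at hlt
      have h0 : σ'.reg 11 = 0 := by omega
      rw [h0, Nat.size_zero] at hu h12'
      refine ⟨?_, by omega, hr, ha⟩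
      simp only [Expr.nodes]
      omega
  · exact ⟨by omega, by omega, le_rfl, fun _ _ _ => rfl, rfl⟩

theorem maxLoop_spec {procs : List Cmd} {M n : ℕ} {t : Fin n → ℕ} {σ : State}
    (ht : ∀ i : Fin n, σ.arr 0 i = t i) (h1 : σ.reg 1 = n) (h13 : σ.reg 13 = 0)
    (h14 : σ.reg 14 = 0) (hn : n + 1 ≤ M) (hM : Finset.univ.sup t ≤ M) :
    Spec procs M maxLoop σ fun σ' u => u ≤ 30 * n + 10 ∧ σ'.reg 13 = Finset.univ.sup t ∧
      (∀ x, x ≠ 13 → x ≠ 14 → σ'.reg x = σ.reg x) ∧ σ'.arr = σ.arr := by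
  refine Spec.loop (fun σ' u => u ≤ 30 * σ'.reg 14 ∧ σ'.reg 14 ≤ n ∧
    (∀ i : Fin n, (i : ℕ) < σ'.reg 14 → t i ≤ σ'.reg 13) ∧ σ'.reg 13 ≤ Finset.univ.sup t ∧
    (∀ x, x ≠ 13 → x ≠ 14 → σ'.reg x = σ.reg x) ∧ σ'.arr = σ.arr)
    (fun σ' => n - σ'.reg 14) ?_ ?_
  · rintro σ' u ⟨hu, hle, hmax, hsup, hr, ha⟩
    have h1' : σ'.reg 1 = n := (hr 1 (by norm_num) (by norm_num)).trans h1
    refine ⟨by simp only [Expr.Small]; omega, by simp only [Expr.Small]; omega, ?_, ?_⟩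
    · intro hlt
      simp only [Expr.eval, h1'] at hlt
      have hti := ht ⟨_, hlt⟩
      simp only at hti
      have hts := Finset.le_sup (f := t) (Finset.mem_univ ⟨_, hlt⟩)
      have hlast (i : Fin n) (hi : (i : ℕ) < σ'.reg 14 + 1) {v : ℕ} (hv : σ'.reg 13 ≤ v)
          (hv' : t ⟨_, hlt⟩ ≤ v) : t i ≤ v := by
        rcases (Nat.lt_succ_iff.1 hi).lt_or_eq with hi | hi
        · exact (hmax i hi).trans hv
        · rwa [show i = ⟨_, hlt⟩ from Fin.ext hi]
      refine Spec.straight ?_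
      simp only [block, Cmd.wp, Expr.Small, Expr.eval, State.reg_setReg, State.arr_setReg,
        Cmd.steps, Expr.nodes, ha, hti]
      norm_num
      refine ⟨by omega, by omega,
        fun h => ⟨by omega, by omega, ⟨by omega, hlt, ?_, hts, ?_⟩, by omega⟩,
        fun h => ⟨by omega, ⟨by omega, hlt, ?_, hsup, ?_⟩, by omega⟩⟩
      · exact fun i hi => hlast i (by omega) h.le le_rfl
      · intro x hx hx'
        simp [hx, hx', hr x hx hx']
      · exact fun i hi => hlast i (by omega) le_rfl h
      · intro x hx hx'
        simp [hx', hr x hx hx']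
    · intro hlt
      simp only [Expr.eval, h1'] at hlt
      refine ⟨?_, le_antisymm hsup (Finset.sup_le fun i _ => hmax i (by omega)), hr, ha⟩
      simp only [Expr.nodes]
      omega
  · exact ⟨by omega, by omega, fun i hi => by omega, by omega, fun _ _ _ => rfl, rfl⟩

theorem shiftLoop_spec {procs : List Cmd} {M n θ : ℕ} {σ : State} (h1 : σ.reg 1 = n)
    (h13 : σ.reg 13 = θ) (h14 : σ.reg 14 = 0) (hn : n + 1 ≤ M) (hθ : θ ≤ M)
    (hM : ∀ x < n, σ.arr 0 x ≤ M) :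
    Spec procs M shiftLoop σ fun σ' u => u ≤ 30 * n + 10 ∧
      (∀ x < n, σ'.arr 0 x = σ.arr 0 x - θ ∧ σ'.arr 3 x = x) ∧
      (∀ x, x ≠ 14 → σ'.reg x = σ.reg x) ∧
      (∀ a, a ≠ 0 → a ≠ 3 → σ'.arr a = σ.arr a) := by
  refine Spec.loop (fun σ' u => u ≤ 30 * σ'.reg 14 ∧ σ'.reg 14 ≤ n ∧
    (∀ x < σ'.reg 14, σ'.arr 0 x = σ.arr 0 x - θ ∧ σ'.arr 3 x = x) ∧
    (∀ x, σ'.reg 14 ≤ x → σ'.arr 0 x = σ.arr 0 x) ∧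
    (∀ x, x ≠ 14 → σ'.reg x = σ.reg x) ∧
    (∀ a, a ≠ 0 → a ≠ 3 → σ'.arr a = σ.arr a))
    (fun σ' => n - σ'.reg 14) ?_ ?_
  · rintro σ' u ⟨hu, hle, hdone, hrest, hr, ha⟩
    have h1' : σ'.reg 1 = n := (hr 1 (by norm_num)).trans h1
    have h13' : σ'.reg 13 = θ := (hr 13 (by norm_num)).trans h13
    refine ⟨by simp only [Expr.Small]; omega, by simp only [Expr.Small]; omega, ?_, ?_⟩
    · intro hlt
      simp only [Expr.eval, h1'] at hlt
      have hx := hrest _ le_rfl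
      have hxM := hM _ hlt
      refine Spec.straight ?_
      simp only [block, Cmd.wp, Expr.Small, Expr.eval, State.reg_setReg, State.arr_setReg,
        State.reg_setArr, State.arr_setArr, Cmd.steps, Expr.nodes, h13']
      norm_num
      refine ⟨by omega, by omega, by omega, by omega,
        ⟨by omega, by omega, ?_, ?_, ?_, ?_⟩, by omega⟩
      · intro x hx'
        rcases hx'.lt_or_eq with hx' | rfl
        · simpa [hx'.ne] using hdone x hx'
        · simp [hx]
      · intro x hx'
        rw [Function.update_of_ne (by omega), hrest x (by omega)]
      · intro x hx'
        simp [hx', hr x hx']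
      · intro a ha0 ha3
        simp [ha0, ha3, ha a ha0 ha3]
    · intro hlt
      simp only [Expr.eval, h1'] at hlt
      refine ⟨?_, fun x hx => hdone x (by omega), hr, ha⟩
      simp only [Expr.nodes]
      omega
  · exact ⟨by omega, by omega, fun x hx => by omega, fun _ _ => rfl, fun _ _ => rfl,
      fun _ _ _ => rfl⟩

theorem truncate_spec {procs : List Cmd} {M n : ℕ} (t : Fin n → ℕ) (hn : 2 * n + 1 ≤ M)
    (hM : Finset.univ.sup t ≤ M) :
    Spec procs M truncate (inputState t) fun σ u => u ≤ 80 * n + 60 ∧ σ.reg 0 = 0 ∧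
      σ.reg 1 = n ∧ (∀ x, 2 ≤ x → x ≤ 7 → σ.reg x = 0) ∧
      (∀ i : Fin n, σ.arr 0 i = t i - (Finset.univ.sup t - 2 * n.size)) ∧
      (∀ x < n, σ.arr 3 x = x) := by
  have hsize : n.size ≤ n := Nat.size_le.2 Nat.lt_two_pow_self
  have ht (i : Fin n) : (inputState t).arr 0 i = t i := by simp [inputState]
  refine Spec.seq (Spec.straight ?_)
  simp only [block, Cmd.wp, Expr.Small, Expr.eval, State.reg_setReg]
  norm_num
  have h0 : (inputState t).reg 0 = n := rfl
  rw [h0]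
  refine ⟨by omega, Spec.seq ((halveLoop_spec ?_ ?_).mono ?_)⟩
  · simp only [State.reg_setReg]
    norm_num
    omega
  · simp [inputState]
  rintro σ₁ u₁ ⟨hu₁, h12, r₁, a₁⟩
  simp only [State.reg_setReg, if_true] at hu₁ h12 r₁
  refine Spec.seq ((maxLoop_spec (t := t) ?_ ?_ ?_ ?_ (by omega) hM).mono ?_)
  · intro i
    rw [a₁]
    exact ht i
  · rw [r₁ 1 (by norm_num) (by norm_num)]
    norm_num
  · rw [r₁ 13 (by norm_num) (by norm_num)]
    simp [inputState]
  · rw [r₁ 14 (by norm_num) (by norm_num)]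
    simp [inputState]
  rintro σ₂ u₂ ⟨hu₂, h13, r₂, a₂⟩
  have h12₂ : σ₂.reg 12 = 2 * n.size := (r₂ 12 (by norm_num) (by norm_num)).trans h12
  have ht₂ (i : Fin n) : σ₂.arr 0 i = t i := by
    rw [a₂, a₁]
    exact ht i
  have hreg (x : ℕ) (h1 : x ≤ 7) : σ₂.reg x = if x = 1 then n else 0 := by
    rw [r₂ x (by omega) (by omega), r₁ x (by omega) (by omega)]
    interval_cases x <;> simp [inputState]
  refine Spec.seq (Spec.straight ?_)
  simp only [Cmd.wp, Expr.Small, Expr.eval, h12₂, h13, Nat.zero_le, true_and]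
  refine ⟨⟨hM, by omega⟩, (shiftLoop_spec (n := n) (θ := Finset.univ.sup t - 2 * n.size) ?_ ?_ ?_
    (by omega) (by omega) ?_).mono ?_⟩
  · simp [hreg]
  · simp
  · simp
  · intro x hx
    exact ((ht₂ ⟨x, hx⟩).le.trans (Finset.le_sup (Finset.mem_univ _))).trans hM
  rintro σ₃ u₃ ⟨hu₃, hdone, r₃, a₃⟩
  have hreg₃ (x : ℕ) (h1 : x ≤ 7) : σ₃.reg x = if x = 1 then n else 0 := by
    rw [r₃ x (by omega), ← hreg x h1]
    simp [(show x ≠ 13 by omega), (show x ≠ 14 by omega)]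
  refine ⟨?_, by simp [hreg₃], by simp [hreg₃], ?_, ?_, fun x hx => (hdone x hx).2⟩
  · simp only [Cmd.steps, Expr.nodes]
    omega
  · intro x hx hx'
    rw [hreg₃ x hx', if_neg (by omega)]
  · intro i
    rw [(hdone i i.2).1]
    simp [ht₂]

/-! ### The whole program -/

/-- Sets up the arguments of the procedure that computes the prefix products of all inputs, and the
sentinel `4 * n` of the stacks: the inputs have levels of at most `2 * n`, and all other levels that
are stored exceed these by less than `2 * n`. -/
def build : Cmd :=
  .seq (block [.store 6 (.const 0) (.add (.add (.reg 1) (.reg 1)) (.add (.reg 1) (.reg 1))),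
    .assign 8 (.const 0), .assign 9 (.reg 1), .assign 10 (.reg 1)]) (.call 0)

theorem build_spec {procs : List Cmd} (hprocs : procs[0]? = some prefixProc) {n : ℕ} (hn : 2 ≤ n)
    {σ : State} (h0 : σ.reg 0 = 0) (h1 : σ.reg 1 = n) (hr : ∀ x, 2 ≤ x → x ≤ 7 → σ.reg x = 0)
    (hlevel : ∀ x < n, σ.arr 0 x ≤ 2 * n) (h3 : ∀ x < n, σ.arr 3 x = x) :
    Spec procs (8 * n * n) build σ fun σ' u => u ≤ 1200 * n.size * n + 40 ∧
      σ'.reg 0 = gates n ∧ (∀ x < gates n, σ'.arr 1 x < n + x ∧ σ'.arr 2 x < n + x) ∧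
      ∀ x < n, σ'.Computes n (σ.arr 0) (σ'.arr 3 x) 0 (x + 1)
        (Real.logb Real.goldenRatio (weight (σ.arr 0) 0 n) + 5 * loglog n + 2) := by
  have hM : 16 * n ≤ 8 * n * n := by nlinarith
  refine Spec.seq (Spec.straight ?_)
  simp only [block, Cmd.wp, Expr.Small, Expr.eval, State.reg_setReg, State.reg_setArr, h1]
  norm_num
  refine ⟨by omega, by omega, ?_⟩
  refine (prefixProc_spec hprocs _ n (σ.arr 0) (4 * n) (m := n) (by omega) (2 * n) id 0 n _
    (by simp) (by simp) (by simp) ?_).mono ?_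
  · have hg := gates_le_sq n
    refine
      { valid := ⟨by simp [h1], by simp; omega, by simp [h0]⟩
        pos_m := by omega
        le_top := by omega
        comp := fun x _ hx => ?_
        level := fun x _ hx => ?_
        le_S := by omega
        le_M := by omega
        gates_le := ?_
        top_le := by omega
        stack_le := ?_
        reg_le := fun x hx hx' => ?_ }
    · simp only [State.arr_setReg, State.arr_setArr]
      norm_num
      rw [h3 x (by omega)]
      exact .input _ _ (by omega) le_rfl
    · simpa using hlevel x (by omega)
    · simp [h0]
      nlinarith
    · simp [hr]
      omega
    · simp [(show x ≠ 8 by omega), (show x ≠ 9 by omega), (show x ≠ 10 by omega), hr x hx hx']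
  · rintro σ' u ⟨hu, hd, -⟩
    have hc : σ'.reg 0 = gates n := by simpa [h0] using hd.count
    refine ⟨?_, hc, hc ▸ hd.valid.lt, fun x hx => ?_⟩
    · simp only [Cmd.steps, Expr.nodes]
      omega
    · simpa using hd.comp x (by omega) (by omega)

/-- The program that constructs the prefix graph: it truncates the arrival times, and then computes
the prefix products of all inputs. -/
def adderProgram : Program where
  main := .seq truncate build
  procs := [prefixProc]

/-! ### The bounds -/

/-- The bound comes from `85 / 59 < 1.441`, where `φ ^ 85` is just above `2 ^ 59`. -/
theorem logb_golden_two_le : Real.logb Real.goldenRatio 2 ≤ 1.441 := by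
  have h : (2 : ℝ) ^ 59 ≤ Real.goldenRatio ^ 85 := by
    have h1 : (1.618 : ℝ) ≤ Real.goldenRatio := by
      rw [Real.goldenRatio]
      have : (2.236 : ℝ) ≤ √5 := Real.le_sqrt_of_sq_le (by norm_num)
      linarith
    calc (2 : ℝ) ^ 59 ≤ 1.618 ^ 85 := by norm_num
      _ ≤ Real.goldenRatio ^ 85 := pow_le_pow_left₀ (by norm_num) h1 _
  have h1 := logb_golden_le (by norm_num) h
  rw [Real.logb_pow, logb_golden_pow] at h1
  push_cast at h1
  linarith

theorem two_le_golden_sq : 2 ≤ Real.goldenRatio ^ 2 := by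
  rw [Real.goldenRatio_sq]
  linarith [Real.one_lt_goldenRatio]

/-- Truncation costs at most `3 / 2`: the inputs that arrive before `θ` have together at most the
weight of the latest input, so the truncated weight is at most twice the weight. -/
theorem logb_truncated_weight_le {n θ : ℕ} (hn : 0 < n) (t : Fin n → ℕ)
    (hθ : θ = Finset.univ.sup t - 2 * n.size) {A : ℕ → ℕ} (hA : ∀ i : Fin n, A i = t i - θ) :
    Real.logb Real.goldenRatio (weight A 0 n) + θ ≤
      Real.logb Real.goldenRatio (∑ i, Real.goldenRatio ^ t i) + 3 / 2 := by
  have hne : (Finset.univ : Finset (Fin n)).Nonempty := ⟨⟨0, hn⟩, Finset.mem_univ _⟩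
  have hW : 0 < ∑ i, Real.goldenRatio ^ t i := Finset.sum_pos (fun _ _ => golden_pow_pos _) hne
  have key : Real.goldenRatio ^ θ * weight A 0 n ≤ 2 * ∑ i, Real.goldenRatio ^ t i := by
    have e : Real.goldenRatio ^ θ * weight A 0 n = ∑ i, Real.goldenRatio ^ (t i - θ + θ) := by
      rw [weight, Nat.Ico_zero_eq_range, Finset.sum_range, Finset.mul_sum]
      refine Finset.sum_congr rfl fun i _ => ?_
      rw [hA, pow_add, mul_comm]
    rw [e]
    rcases Nat.eq_zero_or_pos θ with h0 | h0
    · simp only [h0, Nat.sub_zero, Nat.add_zero]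
      linarith
    · have h1 : (n : ℝ) * Real.goldenRatio ^ θ ≤ ∑ i, Real.goldenRatio ^ t i := by
        obtain ⟨i, hi, hsup⟩ := Finset.exists_mem_eq_sup Finset.univ hne t
        calc (n : ℝ) * Real.goldenRatio ^ θ
            ≤ Real.goldenRatio ^ (2 * n.size) * Real.goldenRatio ^ θ := by
              refine mul_le_mul_of_nonneg_right ?_ (golden_pow_pos θ).le
              calc (n : ℝ) ≤ 2 ^ n.size := by exact_mod_cast (Nat.lt_size_self n).le
                _ ≤ (Real.goldenRatio ^ 2) ^ n.size :=
                  pow_le_pow_left₀ (by norm_num) two_le_golden_sq _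
                _ = Real.goldenRatio ^ (2 * n.size) := (pow_mul _ _ _).symm
          _ = Real.goldenRatio ^ t i := by
              rw [← pow_add, ← hsup]
              congr 1
              omega
          _ ≤ ∑ i, Real.goldenRatio ^ t i :=
              Finset.single_le_sum (f := fun i => Real.goldenRatio ^ t i)
                (fun _ _ => (golden_pow_pos _).le) hi
      have h2 : ∑ i, Real.goldenRatio ^ (t i - θ + θ) ≤
          ∑ i : Fin n, (Real.goldenRatio ^ t i + Real.goldenRatio ^ θ) := by
        refine Finset.sum_le_sum fun i _ => ?_
        rcases le_total θ (t i) with h | h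
        · rw [Nat.sub_add_cancel h]
          linarith [golden_pow_pos θ]
        · rw [Nat.sub_eq_zero_of_le h, zero_add]
          linarith [golden_pow_pos (t i)]
      rw [Finset.sum_add_distrib, Finset.sum_const, Finset.card_univ, Fintype.card_fin,
        nsmul_eq_mul] at h2
      linarith
  rw [← logb_golden_pow_mul θ (weight_pos A hn)]
  refine (logb_golden_le (mul_pos (golden_pow_pos θ) (weight_pos A hn)) key).trans ?_
  rw [Real.logb_mul (by norm_num) hW.ne']
  linarith [logb_golden_two_le]

theorem logb_golden_sum_le {n : ℕ} (hn : 0 < n) (t : Fin n → ℕ) :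
    Real.logb Real.goldenRatio (∑ i, Real.goldenRatio ^ t i) ≤
      1.441 * Real.logb 2 (∑ i, (2 : ℝ) ^ t i) := by
  have hne : (Finset.univ : Finset (Fin n)).Nonempty := ⟨⟨0, hn⟩, Finset.mem_univ _⟩
  have hy : 1 ≤ ∑ i, (2 : ℝ) ^ t i :=
    (one_le_pow₀ (by norm_num)).trans (Finset.single_le_sum (f := fun i => (2 : ℝ) ^ t i)
      (fun _ _ => by positivity) (Finset.mem_univ ⟨0, hn⟩))
  have h1 : Real.logb Real.goldenRatio (∑ i, Real.goldenRatio ^ t i) ≤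
      Real.logb Real.goldenRatio (∑ i, (2 : ℝ) ^ t i) :=
    logb_golden_le (Finset.sum_pos (fun _ _ => golden_pow_pos _) hne)
      (Finset.sum_le_sum fun i _ => pow_le_pow_left₀ Real.goldenRatio_pos.le
        Real.goldenRatio_lt_two.le _)
  refine h1.trans ?_
  rw [← Real.mul_logb (b := 2) (a := Real.goldenRatio) (by norm_num) (by norm_num) (by norm_num)]
  exact mul_le_mul_of_nonneg_right logb_golden_two_le (Real.logb_nonneg (by norm_num) hy)

theorem toCircuit_size {n : ℕ} (G : PrefixGraph n) : G.toCircuit.size = 3 * G.size := by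
  have h : Nat.card (Fin G.size × PrefixGraph.GadgetGate) = 3 * G.size := by
    rw [Nat.card_prod, Nat.card_fin, Nat.card_eq_fintype_card, mul_comm]
    rfl
  exact h

theorem size_le_two_mul_logb {n : ℕ} (hn : 2 ≤ n) : (n.size : ℝ) ≤ 2 * Real.logb 2 n := by
  have h1 := one_le_logb_two hn
  have h2 : 1 ≤ n.size := Nat.size_pos.2 (by omega)
  have h3 : 2 ^ (n.size - 1) ≤ n := Nat.lt_size.1 (by omega)
  have h4 := div_le_logb_two (x := n) (n.size - 1) 1 one_pos (by rw [pow_one]; exact_mod_cast h3)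
  push_cast [Nat.cast_sub h2] at h4
  linarith

/-- The running time: the first phase makes `u` steps with numbers of the size of the arrival
times, and the second phase makes `v` steps with polynomially bounded numbers. -/
theorem running_time_le {n s u v w T T' : ℕ} (hn : 2 ≤ n) (hw : 1 ≤ w) (hu : u ≤ 80 * n + 60)
    (hv : v ≤ 1200 * n.size * n + 40) (hT : T ≤ u * wordCost w (max s (2 * n + 1)))
    (hT' : T' ≤ v * wordCost w (8 * n * n)) :
    ((T + T' : ℕ) : ℝ) ≤ 20000 * (n * Real.logb 2 n ^ 2 + n * ((s.size : ℝ) / w)) := by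
  have hz2 : 2 ≤ n.size := Nat.lt_size.2 (by simpa using hn)
  have hlt := Nat.lt_size_self n
  have hsize1 : (max s (2 * n + 1)).size ≤ s.size + (n.size + 1) := by
    rcases max_choice s (2 * n + 1) with h | h <;> rw [h]
    · omega
    · refine le_trans (Nat.size_le.2 ?_) (Nat.le_add_left _ _)
      rw [pow_succ]
      omega
  have hsize2 : (8 * n * n).size ≤ 2 * n.size + 3 := by
    rw [Nat.size_le, pow_add, two_mul, pow_add]
    nlinarith
  have hw' : (1 : ℝ) ≤ w := by exact_mod_cast hw
  have hc1 : (wordCost w (max s (2 * n + 1)) : ℝ) ≤ s.size / w + 2 * n.size := by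
    have h1 : (wordCost w (max s (2 * n + 1)) : ℝ) ≤ 1 + ((max s (2 * n + 1)).size : ℝ) / w := by
      rw [wordCost]
      push_cast
      linarith [Nat.cast_div_le (α := ℝ) (m := (max s (2 * n + 1)).size) (n := w)]
    have h2 : ((max s (2 * n + 1)).size : ℝ) / w ≤ ((s.size : ℝ) + (n.size + 1)) / w := by
      gcongr
      exact_mod_cast hsize1
    have h3 : ((n.size : ℝ) + 1) / w ≤ n.size + 1 := div_le_self (by positivity) hw'
    have h4 : (2 : ℝ) ≤ n.size := by exact_mod_cast hz2
    rw [add_div] at h2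
    linarith
  have hc2 : wordCost w (8 * n * n) ≤ 4 * n.size := by
    have := Nat.div_le_self (8 * n * n).size w
    rw [wordCost]
    omega
  have hu' : u ≤ 110 * n := by omega
  have hv' : v ≤ 1220 * (n.size * n) := by nlinarith
  have hT1 : (T : ℝ) ≤ 110 * n * (s.size / w + 2 * n.size) := by
    calc (T : ℝ) ≤ u * wordCost w (max s (2 * n + 1)) := by exact_mod_cast hT
      _ ≤ 110 * n * (s.size / w + 2 * n.size) := by
        refine mul_le_mul ?_ hc1 (by positivity) (by positivity)
        exact_mod_cast hu'
  have hT2 : (T' : ℝ) ≤ 4880 * (n * (n.size : ℝ) ^ 2) := by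
    have h : T' ≤ 4880 * (n * n.size ^ 2) :=
      calc T' ≤ v * wordCost w (8 * n * n) := hT'
        _ ≤ 1220 * (n.size * n) * (4 * n.size) := Nat.mul_le_mul hv' hc2
        _ = 4880 * (n * n.size ^ 2) := by ring
    exact_mod_cast h
  have hz : (n : ℝ) * (n.size : ℝ) ^ 2 ≤ n * (2 * Real.logb 2 n) ^ 2 := by
    gcongr
    exact size_le_two_mul_logb hn
  have hz' : (n : ℝ) * (2 * n.size) ≤ n * (n.size : ℝ) ^ 2 := by
    have : (2 : ℝ) ≤ n.size := by exact_mod_cast hz2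
    gcongr
    nlinarith
  have hs : 0 ≤ (n : ℝ) * ((s.size : ℝ) / w) := by positivity
  have hl : 0 ≤ (n : ℝ) * Real.logb 2 n ^ 2 := by positivity
  push_cast
  nlinarith

end PrefixAdder

open PrefixAdder in
theorem mainTheorem3 :
    ∃ (P : PrefixAdder.Program) (C : ℝ), ∀ (n : ℕ), 2 ≤ n → ∀ (t : Fin n → ℕ),
      ∃ (σ : PrefixAdder.State) (G : PrefixAdder.PrefixGraph n),
        σ.Holds G ∧
        G.IsParallelPrefix ∧
        G.toCircuit.IsAdder ∧
        G.toCircuit.DelayAtMost (fun x => t x.2)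
          (Real.logb Real.goldenRatio (∑ i, Real.goldenRatio ^ t i) +
            5 * Real.logb 2 (Real.logb 2 n) + 4.5) ∧
        Real.logb Real.goldenRatio (∑ i, Real.goldenRatio ^ t i) +
            5 * Real.logb 2 (Real.logb 2 n) + 4.5 ≤
          1.441 * Real.logb 2 (∑ i, (2 : ℝ) ^ t i) +
            5 * Real.logb 2 (Real.logb 2 n) + 4.5 ∧
        (3 ≤ n → (G.toCircuit.size : ℝ) ≤ 6 * n * Real.logb 2 (Real.logb 2 n)) ∧
        ∀ (w : ℕ), 1 ≤ w → ∃ (T : ℕ),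
          P.Runs w (PrefixAdder.inputState t) σ T ∧
          (T : ℝ) ≤ C * (n * Real.logb 2 n ^ 2 +
            n * (((Finset.univ.sup t).size : ℝ) / w)) := by
  refine ⟨adderProgram, 20000, fun n hn t => ?_⟩
  obtain ⟨σ₁, u, ⟨hu, h0, h1, hr, hA, h3⟩, run₁⟩ := truncate_spec (procs := [prefixProc]) t
    (M := max (Finset.univ.sup t) (2 * n + 1)) (le_max_right _ _) (le_max_left _ _)
  have hsize : n.size ≤ n := Nat.size_le.2 Nat.lt_two_pow_self
  have hlevel : ∀ x < n, σ₁.arr 0 x ≤ 2 * n := by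
    intro x hx
    have h := hA ⟨x, hx⟩
    have h' := Finset.le_sup (f := t) (Finset.mem_univ ⟨x, hx⟩)
    simp only at h
    omega
  obtain ⟨σ, v, ⟨hv, hcount, hlt, hcomp⟩, run₂⟩ := build_spec (procs := [prefixProc]) rfl hn h0 h1
    hr hlevel h3
  have hout : ∀ x < n, σ.arr 3 x < n + gates n := fun x hx => hcount ▸ (hcomp x hx).lt
  let G := graphOf n (gates n) (σ.arr 1) (σ.arr 2) (σ.arr 3) hlt hout
  have hL : ∀ x : Fin G.size, σ.arr 1 x = nodeCode (G.left x) :=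
    fun x => (nodeCode_graphOf_left hlt hout x).symm
  have hR : ∀ x : Fin G.size, σ.arr 2 x = nodeCode (G.right x) :=
    fun x => (nodeCode_graphOf_right hlt hout x).symm
  have hO : ∀ i : Fin n, σ.arr 3 i = nodeCode (G.out i) :=
    fun i => (nodeCode_graphOf_out hlt hout i).symm
  have hG (i : Fin n) : Computes n (σ₁.arr 0) (σ.arr 1) (σ.arr 2) G.size (σ.arr 3 i) 0 (i + 1)
      (Real.logb Real.goldenRatio (weight (σ₁.arr 0) 0 n) + 5 * loglog n + 2) := by
    have h := hcomp i i.2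
    rw [State.Computes, hcount] at h
    exact h
  have hprefix : G.IsParallelPrefix := by
    intro i
    have h := (hG i).word hL hR (G.out i) (hO i).symm
    rwa [segWord, List.drop_zero] at h
  refine ⟨σ, G, ⟨hcount, hL, hR, hO⟩, hprefix, hprefix.isAdder, ?_, ?_, ?_, ?_⟩
  · rintro y ⟨s, i⟩ d hpath
    have h := (hG i).delay hL hR (θ := Finset.univ.sup t - 2 * n.size) (t := t)
      (fun x => by rw [hA]; omega) (G.out i) (hO i).symm y d
    -- The constant is `4.5 = 2 + 1 + 3 / 2`: the recursion, the generate signals, the truncation.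
    have hw := logb_truncated_weight_le (by omega) t rfl hA
    have hb : ((t y.2 + d : ℕ) : ℝ) ≤
        Real.logb Real.goldenRatio (weight (σ₁.arr 0) 0 n) + 5 * loglog n + 2 +
          ((Finset.univ.sup t - 2 * n.size : ℕ) : ℝ) + 1 := by
      cases s with
      | generate => exact h.2 hpath
      | propagate => linarith [h.1 hpath]
    rw [loglog] at hb
    norm_num at hb hw ⊢
    linarith
  · have := logb_golden_sum_le (by omega) t
    linarith
  · intro hn3
    have h := gates_le hn3
    rw [toCircuit_size]
    have e : G.size = gates n := rfl
    rw [e]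
    rw [loglog] at h
    push_cast
    linarith
  · intro w hw
    obtain ⟨T, hT, e₁⟩ := run₁ w hw
    obtain ⟨T', hT', e₂⟩ := run₂ w hw
    exact ⟨T + T', .seq _ _ _ _ _ _ _ e₁ e₂, running_time_le hn hw hu hv hT hT'⟩
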